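/- Let $a,b\in\mathbb R$ with $a>0$, $b\ne 0$, and let $G_{a,b}$ be the group of complex matrices $$M(p,q,r,s)=\begin{pmatrix} e^{s\sqrt2(-a+ib)}&0&p+iq\\0&e^{2\sqrt2\,as}&r\\0&0&1\end{pmatrix},\qquad p,q,r,s\in\mathbb R,$$ with the left-invariant complex structure $J$ for which $JX_1=X_2$, $JX_3=X_4$, where $X_1=(1-i)E_{13}$, $X_2=(1+i)E_{13}$, $X_3=E_{23}$, $X_4=\sqrt2(-a+ib)E_{11}+2\sqrt2\,a\,E_{22}$. (Equivalently, $G_{a,b}\cong\mathbb C\times\mathbb H$ as a complex manifold, via $M(p,q,r,s)\mapsto\big(p+iq,\ r+i\,e^{2\sqrt2as}/(2\sqrt2a)\big)$.) Put $Z_1=(X_1-iX_2)/\sqrt2$, $Z_2=(X_3-iX_4)/\sqrt2$. Let $A\in SL(3,\mathbb Z)$ have the eigenvalues $e^{2\sqrt2a}$ and $e^{\sqrt2(-a\pm ib)}$, let $v\in\mathbb R^3\setminus\{0\}$ and $w\in\mathbb C^3\setminus\{0\}$ be eigenvectors for $e^{2\sqrt2a}$ and $e^{\sqrt2(-a+ib)}$,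 let $\Gamma\subset G_{a,b}$ be the lattice generated by $M(0,0,0,1)$ and $M(\mathrm{Re}\,w_i,\mathrm{Im}\,w_i,v_i,0)$, $i=1,2,3$, and let $X=\Gamma\backslash G_{a,b}$ be the corresponding Inoue surface of type $S^0$. A Hermitian metric on $X$ is called locally homogeneous if its pull-back to the universal cover $G_{a,b}$ is left-invariant; for such a metric $g$ put $x=g(Z_1,\bar Z_1)$, $y=g(Z_2,\bar Z_2)$, $z=g(Z_1,\bar Z_2)$ and $u=|z|^2$. The Hermitian curvature flow (HCF) is $\partial_t g=-K(g)$ with $K=S-Q$, where, for the Chern connection with torsion $T$ and curvature $\Omega$, $S_{i\bar j}=g^{\bar\ell k}\Omega_{k\bar\ell i\bar j}$, $Q=\tfrac12Q^1-\tfrac14Q^2-\tfrac12Q^3+Q^4$ and $$Q^1_{i\bar j}=g^{\bar\ell k}g^{\bar qm}T_{ik\bar q}T_{\bar j\bar\ell m},\quad Q^2_{i\bar j}=g^{\bar\ell k}g^{\bar qm}T_{km\bar j}T_{\bar\ell\bar qi},\quad Q^3_{i\bar j}=g^{\bar\ell k}g^{\bar qm}T_{ik\bar\ell}T_{\bar j\bar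 qm},\quad Q^4_{i\bar j}=\tfrac12g^{\bar\ell k}g^{\bar qm}\big(T_{mk\bar\ell}T_{\bar q\bar ji}+T_{\bar q\bar\ell k}T_{mi\bar j}\big).$$ Let $g_0$ be a locally homogeneous Hermitian metric on $X$, with off-diagonal component $z_0=g_0(Z_1,\bar Z_2)$. Then there is a locally homogeneous solution $g(t)$ of the HCF with $g(0)=g_0$ that exists for all $t\ge 0$, and every locally homogeneous solution on an interval $[0,T)$ starting at $g_0$ coincides with it there. Moreover: 1. $y(t)\sim 8a^2t$ as $t\to\infty$. 2. If $z_0\neq0$, then $x(t)$ and $u(t)$ are strictly decreasing on $[0,\infty)$ (so $x(t)<x(0)$ and $u(t)<u(0)$ for $t>0$); if $z_0=0$, then $x(t)$ is constant and $u(t)=0$ for all $t\ge0$. 3. As $t\to\infty$, $X$ with the Riemannian distance of $(1+t)^{-1}g(t)$ converges in the Gromov–Hausdorff topology to the circle of length $2\sqrt2\,a$ with its arc-length distance. (Here the Riemannian metric is extended complex bilinearly, so that $|X_4|^2=g(Z_2,\bar Z_2)=y$.) -/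

import Mathlib

noncomputable section

open scoped ContDiff ComplexConjugate ComplexOrder

namespace InoueHCF

/-! ### Hermitian metrics and the Hermitian curvature flow in holomorphic coordinates -/

/-- A field of matrices on `ℂⁿ`; `g p i j` stands for the component
`g_{i j̄} = g(∂_i, ∂_{j̄})` at `p` of a Hermitian metric, where the Riemannian metric `g` is extended
complex bilinearly.  Only the values on the domain of the metric matter. -/
abbrev MetricField (n : ℕ) : Type := (Fin n → ℂ) → Matrix (Fin n) (Fin n) ℂ

/-- `g` is a smooth Hermitian metric on `U`. -/
def IsHermitianMetricOn {n : ℕ} (U : Set (Fin n → ℂ)) (g : MetricField n) : Prop :=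
  (∀ i j, ContDiffOn ℝ ∞ (fun p => g p i j) U) ∧ ∀ p ∈ U, (g p).PosDef

/-- The Wirtinger derivative `∂f/∂z_i`. -/
def dz {n : ℕ} (i : Fin n) (f : (Fin n → ℂ) → ℂ) (p : Fin n → ℂ) : ℂ :=
  (fderiv ℝ f p (Pi.single i 1) - Complex.I * fderiv ℝ f p (Pi.single i Complex.I)) / 2

/-- The Wirtinger derivative `∂f/∂z̄_i`. -/
def dzbar {n : ℕ} (i : Fin n) (f : (Fin n → ℂ) → ℂ) (p : Fin n → ℂ) : ℂ :=
  (fderiv ℝ f p (Pi.single i 1) + Complex.I * fderiv ℝ f p (Pi.single i Complex.I)) / 2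

/-- Christoffel symbols `Γ_{ij}^k = g^{l̄ k} ∂_i g_{j l̄}` of the Chern connection; the entry
`(l, k)` of the inverse matrix is `g^{l̄ k}`. -/
def chernGamma {n : ℕ} (g : MetricField n) (p : Fin n → ℂ) (i j k : Fin n) : ℂ :=
  ∑ l, (g p)⁻¹ l k * dz i (fun q => g q j l) p

/-- Torsion of the Chern connection with lowered index:
`T_{i j k̄} = g_{l k̄} (Γ_{ij}^l - Γ_{ji}^l)`. Its conjugate is `T_{ī j̄ k}`. -/
def torsion {n : ℕ} (g : MetricField n) (p : Fin n → ℂ) (i j k : Fin n) : ℂ :=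
  ∑ l, (chernGamma g p i j l - chernGamma g p j i l) * g p l k

/-- Curvature of the Chern connection: `Ω_{k l̄ i j̄} = g(Ω(∂_k, ∂_{l̄}) ∂_i, ∂_{j̄})`, where
`Ω(∂_k, ∂_{l̄}) ∂_i = -(∂_{l̄} Γ_{ki}^m) ∂_m`. -/
def chernCurvature {n : ℕ} (g : MetricField n) (p : Fin n → ℂ) (k l i j : Fin n) : ℂ :=
  ∑ m, -dzbar l (fun q => chernGamma g q k i m) p * g p m j

/-- Second Chern-Ricci curvature `S_{i j̄} = g^{l̄ k} Ω_{k l̄ i j̄}`. -/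
def secondChernRicci {n : ℕ} (g : MetricField n) (p : Fin n → ℂ) (i j : Fin n) : ℂ :=
  ∑ k, ∑ l, (g p)⁻¹ l k * chernCurvature g p k l i j

/-- `Q¹_{i j̄} = g^{l̄ k} g^{q̄ m} T_{i k q̄} T_{j̄ l̄ m}`. -/
def torsionQ1 {n : ℕ} (g : MetricField n) (p : Fin n → ℂ) (i j : Fin n) : ℂ :=
  ∑ k, ∑ l, ∑ m, ∑ q, (g p)⁻¹ l k * (g p)⁻¹ q m *
    (torsion g p i k q * conj (torsion g p j l m))

/-- `Q²_{i j̄} = g^{l̄ k} g^{q̄ m} T_{k m j̄} T_{l̄ q̄ i}`. -/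
def torsionQ2 {n : ℕ} (g : MetricField n) (p : Fin n → ℂ) (i j : Fin n) : ℂ :=
  ∑ k, ∑ l, ∑ m, ∑ q, (g p)⁻¹ l k * (g p)⁻¹ q m *
    (torsion g p k m j * conj (torsion g p l q i))

/-- `Q³_{i j̄} = g^{l̄ k} g^{q̄ m} T_{i k l̄} T_{j̄ q̄ m}`. -/
def torsionQ3 {n : ℕ} (g : MetricField n) (p : Fin n → ℂ) (i j : Fin n) : ℂ :=
  ∑ k, ∑ l, ∑ m, ∑ q, (g p)⁻¹ l k * (g p)⁻¹ q m *
    (torsion g p i k l * conj (torsion g p j q m))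

/-- `Q⁴_{i j̄} = ½ g^{l̄ k} g^{q̄ m} (T_{m k l̄} T_{q̄ j̄ i} + T_{q̄ l̄ k} T_{m i j̄})`. -/
def torsionQ4 {n : ℕ} (g : MetricField n) (p : Fin n → ℂ) (i j : Fin n) : ℂ :=
  (1 / 2) * ∑ k, ∑ l, ∑ m, ∑ q, (g p)⁻¹ l k * (g p)⁻¹ q m *
    (torsion g p m k l * conj (torsion g p q j i) + conj (torsion g p q l k) * torsion g p m i j)

/-- The HCF tensor `K = S - Q` with `Q = ½ Q¹ - ¼ Q² - ½ Q³ + Q⁴`. -/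
def hcfTensor {n : ℕ} (g : MetricField n) (p : Fin n → ℂ) (i j : Fin n) : ℂ :=
  secondChernRicci g p i j -
    ((1 / 2) * torsionQ1 g p i j - (1 / 4) * torsionQ2 g p i j - (1 / 2) * torsionQ3 g p i j
      + torsionQ4 g p i j)

/-- `g(t)`, `t ∈ I`, is a solution on `U` of the Hermitian curvature flow `∂ₜ g = -K(g)`
(derivatives at endpoints of `I` are one-sided). -/
def IsHCFSolutionOn {n : ℕ} (U : Set (Fin n → ℂ)) (I : Set ℝ) (g : ℝ → MetricField n) : Prop :=
  (∀ t ∈ I, IsHermitianMetricOn U (g t)) ∧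
    ∀ t ∈ I, ∀ p ∈ U, ∀ i j,
      HasDerivWithinAt (fun s => g s p i j) (-hcfTensor (g t) p i j) I t

/-- Pull-back of a metric field by a holomorphic map `φ`. -/
def pullback {n : ℕ} (φ : (Fin n → ℂ) → Fin n → ℂ) (g : MetricField n) : MetricField n :=
  fun p => Matrix.of fun i j =>
    ∑ k, ∑ l, dz i (fun q => φ q k) p * conj (dz j (fun q => φ q l) p) * g (φ p) k l

/-- Length over `[0, 1]` of a `C¹` curve for the Riemannian metric of `g`.  A real tangent vector
`v = ξ + ξ̄` with `ξ = ξ^i ∂_i` has `g(v, v) = 2 g_{i j̄} ξ^i ξ̄^j`. -/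
def curveLength {n : ℕ} (g : MetricField n) (c : ℝ → Fin n → ℂ) : ℝ :=
  ∫ t in (0 : ℝ)..1,
    √(2 * (∑ i, ∑ j, g (c t) i j * deriv c t i * conj (deriv c t j)).re)

/-! ### The group `G_{a,b} = (Sol₀⁴, J_{a,b})` -/

/-- The group of complex matrices
`M(p,q,r,s) = [[e^{s√2(-a+ib)}, 0, p+iq], [0, e^{2√2 a s}, r], [0, 0, 1]]`, with `w = p + iq`. -/
@[ext] structure Sol (a b : ℝ) where
  w : ℂ
  r : ℝ
  s : ℝ

namespace Sol

variable {a b : ℝ}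

/-- The upper left entry `e^{s√2(-a+ib)}`. -/
def alpha (a b s : ℝ) : ℂ := Complex.exp ((s * √2 : ℝ) * (-(a : ℂ) + b * Complex.I))

/-- The middle entry `e^{2√2 a s}`. -/
def lam (a s : ℝ) : ℝ := Real.exp (2 * √2 * a * s)

theorem alpha_add (s t : ℝ) : alpha a b (s + t) = alpha a b s * alpha a b t := by
  simp only [alpha, ← Complex.exp_add]; congr 1; push_cast; ring

theorem lam_add (s t : ℝ) : lam a (s + t) = lam a s * lam a t := by
  simp only [lam, ← Real.exp_add]; congr 1; ring

theorem alpha_zero : alpha a b 0 = 1 := by simp [alpha]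

theorem lam_zero : lam a 0 = 1 := by simp [lam]

theorem lam_pos (s : ℝ) : 0 < lam a s := Real.exp_pos _

/-- The matrix `M(p,q,r,s)`. -/
def toMatrix (g : Sol a b) : Matrix (Fin 3) (Fin 3) ℂ :=
  !![alpha a b g.s, 0, g.w; 0, (lam a g.s : ℂ), (g.r : ℂ); 0, 0, 1]

instance : Mul (Sol a b) :=
  ⟨fun g h => ⟨g.w + alpha a b g.s * h.w, g.r + lam a g.s * h.r, g.s + h.s⟩⟩

instance : One (Sol a b) := ⟨⟨0, 0, 0⟩⟩

instance : Inv (Sol a b) :=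
  ⟨fun g => ⟨-(alpha a b (-g.s) * g.w), -(lam a (-g.s) * g.r), -g.s⟩⟩

@[simp] theorem mul_w (g h : Sol a b) : (g * h).w = g.w + alpha a b g.s * h.w := rfl
@[simp] theorem mul_r (g h : Sol a b) : (g * h).r = g.r + lam a g.s * h.r := rfl
@[simp] theorem mul_s (g h : Sol a b) : (g * h).s = g.s + h.s := rfl
@[simp] theorem one_w : (1 : Sol a b).w = 0 := rfl
@[simp] theorem one_r : (1 : Sol a b).r = 0 := rfl
@[simp] theorem one_s : (1 : Sol a b).s = 0 := rfl
@[simp] theorem inv_w (g : Sol a b) : (g⁻¹).w = -(alpha a b (-g.s) * g.w) := rfl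
@[simp] theorem inv_r (g : Sol a b) : (g⁻¹).r = -(lam a (-g.s) * g.r) := rfl
@[simp] theorem inv_s (g : Sol a b) : (g⁻¹).s = -g.s := rfl

instance : Group (Sol a b) :=
  Group.ofLeftAxioms
    (fun g h k => by
      ext1
      · simp [alpha_add]; ring
      · simp [lam_add]; ring
      · simp; ring)
    (fun g => by ext1 <;> simp [alpha_zero, lam_zero])
    (fun g => by ext1 <;> simp)

/-- The group law is matrix multiplication. -/
theorem toMatrix_mul (g h : Sol a b) : (g * h).toMatrix = g.toMatrix * h.toMatrix := by
  ext i j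
  fin_cases i <;> fin_cases j <;>
    simp [toMatrix, Matrix.mul_apply, Fin.sum_univ_three, alpha_add, lam_add] <;> ring

/-- The action of `G_{a,b}` by affine biholomorphisms
`(ζ, τ) ↦ (e^{s√2(-a+ib)} ζ + w, e^{2√2 a s} τ + r)`. -/
def act (g : Sol a b) (p : Fin 2 → ℂ) : Fin 2 → ℂ :=
  ![alpha a b g.s * p 0 + g.w, (lam a g.s : ℂ) * p 1 + g.r]

theorem act_mul (g h : Sol a b) (p : Fin 2 → ℂ) : (g * h).act p = g.act (h.act p) := by
  ext i
  fin_cases i <;> simp [act, alpha_add, lam_add] <;> ring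

theorem act_one (p : Fin 2 → ℂ) : (1 : Sol a b).act p = p := by
  ext i
  fin_cases i <;> simp [act, alpha_zero, lam_zero]

end Sol

/-- The domain `ℂ × ℍ ⊆ ℂ²`. -/
def halfSpace : Set (Fin 2 → ℂ) := {p | 0 < (p 1).im}

/-- The point `(0, i/(2√2 a))` of `ℂ × ℍ`. For `a > 0` the orbit map
`M(p,q,r,s) ↦ M(p,q,r,s) · basePoint = (p + iq, r + i e^{2√2 a s}/(2√2 a))` is a biholomorphism
`G_{a,b} → ℂ × ℍ` that carries left translations to the action `Sol.act`. -/
def basePoint (a : ℝ) : Fin 2 → ℂ := ![0, Complex.I / ((2 * √2 * a : ℝ) : ℂ)]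

/-- The orbit map identifies `G_{a,b}` with `ℂ × ℍ`. -/
theorem orbitMap_bijOn (a b : ℝ) (ha : 0 < a) :
    Set.BijOn (fun g : Sol a b => g.act (basePoint a)) Set.univ halfSpace := by
  have hk : 0 < 2 * √2 * a := by positivity
  have im1 : ∀ g : Sol a b, ((g.act (basePoint a)) 1).im = Sol.lam a g.s / (2 * √2 * a) := by
    intro g
    simp only [Sol.act, basePoint, Matrix.cons_val_one, Matrix.cons_val_fin_one, Complex.add_im,
      Complex.ofReal_im, add_zero, Complex.im_ofReal_mul, Complex.div_ofReal_im, Complex.I_im]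
    ring
  have re1 : ∀ g : Sol a b, ((g.act (basePoint a)) 1).re = g.r := by
    intro g
    simp only [Sol.act, basePoint, Matrix.cons_val_one, Matrix.cons_val_fin_one, Complex.add_re,
      Complex.ofReal_re, Complex.re_ofReal_mul, Complex.div_ofReal_re, Complex.I_re]
    ring
  have at0 : ∀ g : Sol a b, (g.act (basePoint a)) 0 = g.w := by
    intro g; simp [Sol.act, basePoint]
  refine ⟨fun g _ => ?_, fun g _ h _ hgh => ?_, fun p hp => ?_⟩
  · change 0 < ((g.act (basePoint a)) 1).im
    rw [im1]; exact div_pos (Sol.lam_pos _) hk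
  · have e : g.act (basePoint a) = h.act (basePoint a) := hgh
    have e1 := congrArg (fun q => (q 1).im) e
    simp only [im1] at e1
    have e2 : Sol.lam a g.s = Sol.lam a h.s := by
      field_simp at e1; exact e1
    have e3 := Real.exp_injective e2
    ext1
    · rw [← at0 g, ← at0 h, e]
    · rw [← re1 g, ← re1 h, e]
    · exact mul_left_cancel₀ hk.ne' e3
  · have hp' : 0 < (p 1).im := hp
    refine ⟨⟨p 0, (p 1).re, Real.log ((2 * √2 * a) * (p 1).im) / (2 * √2 * a)⟩, trivial, ?_⟩
    ext i
    fin_cases i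
    · exact at0 _
    · apply Complex.ext
      · exact re1 _
      · refine (im1 _).trans ?_
        simp only [Sol.lam]
        rw [mul_div_cancel₀ _ hk.ne', Real.exp_log (by positivity)]
        field_simp
        rfl

/-- The universal cover `ℂ × ℍ` as a type. -/
abbrev Cover : Type := {p : Fin 2 → ℂ // p ∈ halfSpace}

instance (a b : ℝ) : MulAction (Sol a b) Cover where
  smul g p := ⟨g.act p.1, by
    have h : 0 < (p.1 1).im := p.2
    have h2 := mul_pos (Sol.lam_pos (a := a) g.s) h
    simpa [halfSpace, Sol.act] using h2⟩
  one_smul p := Subtype.ext (Sol.act_one p.1)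
  mul_smul g h p := Subtype.ext (Sol.act_mul g h p.1)

/-- The vector `Z_1` or `Z_2` at the identity of `G_{a,b}` in the coordinates of `ℂ × ℍ`, for the
left-invariant frame `Z₁ = (X₁ - iX₂)/√2`, `Z₂ = (X₃ - iX₄)/√2` of `T^{1,0} G_{a,b}`, where
`X₁ = (1-i)E₁₃`, `X₂ = (1+i)E₁₃ = J X₁`, `X₃ = E₂₃`, `X₄ = √2(-a+ib)E₁₁ + 2√2 a E₂₂ = J X₃`. Thus
`Z₁ = √2 (X₁)^{1,0}` and `Z₂ = √2 (X₃)^{1,0}`. -/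
def frameZ : Fin 2 → Fin 2 → ℂ :=
  ![![(√2 : ℂ) * (1 - Complex.I), 0], ![0, (√2 : ℂ)]]

/-- The derivatives at the identity of the orbit map along `exp(εX₁)`, …, `exp(εX₄)`: in the
coordinates of `ℂ × ℍ` they are `1 - i`, `1 + i` times the first and `1`, `i` times the second
coordinate vector. -/
theorem hasDerivAt_orbitMap (a b : ℝ) (ha : 0 < a) :
    HasDerivAt (fun ε : ℝ => (⟨ε * (1 - Complex.I), 0, 0⟩ : Sol a b).act (basePoint a))
      ![1 - Complex.I, 0] 0 ∧
    HasDerivAt (fun ε : ℝ => (⟨ε * (1 + Complex.I), 0, 0⟩ : Sol a b).act (basePoint a))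
      ![1 + Complex.I, 0] 0 ∧
    HasDerivAt (fun ε : ℝ => (⟨0, ε, 0⟩ : Sol a b).act (basePoint a)) ![0, 1] 0 ∧
    HasDerivAt (fun ε : ℝ => (⟨0, 0, ε⟩ : Sol a b).act (basePoint a)) ![0, Complex.I] 0 := by
  have hof : HasDerivAt (fun ε : ℝ => (ε : ℂ)) 1 0 := Complex.ofRealCLM.hasDerivAt
  have hk : ((2 * √2 * a : ℝ) : ℂ) ≠ 0 := by
    exact_mod_cast (by positivity : (0 : ℝ) < 2 * √2 * a).ne'
  have hlam : HasDerivAt (fun ε : ℝ => (Sol.lam a ε : ℂ)) ((2 * √2 * a : ℝ) : ℂ) 0 := by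
    have h1 : HasDerivAt (fun ε : ℝ => Real.exp (2 * √2 * a * ε)) (2 * √2 * a) 0 := by
      simpa using ((hasDerivAt_id (0 : ℝ)).const_mul (2 * √2 * a)).exp
    exact h1.ofReal_comp
  refine ⟨?_, ?_, ?_, ?_⟩ <;> rw [hasDerivAt_pi] <;> intro i <;> fin_cases i
  · simpa [Sol.act, basePoint] using hof.mul_const (1 - Complex.I)
  · simpa [Sol.act] using hasDerivAt_const (0 : ℝ) _
  · simpa [Sol.act, basePoint] using hof.mul_const (1 + Complex.I)
  · simpa [Sol.act] using hasDerivAt_const (0 : ℝ) _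
  · simpa [Sol.act, basePoint] using hasDerivAt_const (0 : ℝ) (0 : ℂ)
  · simpa [Sol.act, add_comm] using
      hof.const_add ((Sol.lam a 0 : ℂ) * basePoint a 1)
  · simpa [Sol.act, basePoint] using hasDerivAt_const (0 : ℝ) (0 : ℂ)
  · have h := hlam.mul_const (Complex.I / ((2 * √2 * a : ℝ) : ℂ))
    rw [mul_div_cancel₀ _ hk] at h
    simpa [Sol.act, basePoint] using h

/-- The components `g_{i j̄} = g(Z_i, Z̄_j)` of a left-invariant metric. -/
def comp (a : ℝ) (g : MetricField 2) (i j : Fin 2) : ℂ :=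
  ∑ k, ∑ l, frameZ i k * conj (frameZ j l) * g (basePoint a) k l

/-- `x = g(Z₁, Z̄₁)`. -/
def compX (a : ℝ) (g : MetricField 2) : ℝ := (comp a g 0 0).re

/-- `y = g(Z₂, Z̄₂)`. -/
def compY (a : ℝ) (g : MetricField 2) : ℝ := (comp a g 1 1).re

/-- `z = g(Z₁, Z̄₂)`. -/
def compZ (a : ℝ) (g : MetricField 2) : ℂ := comp a g 0 1

/-- `u = |z|²`. -/
def compU (a : ℝ) (g : MetricField 2) : ℝ := ‖compZ a g‖ ^ 2

/-- A metric is locally homogeneous with geometric structure of type `G_{a,b}` if its pull-back to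
the universal cover `ℂ × ℍ ≃ G_{a,b}` is invariant under left translations. (In particular it is
invariant under every lattice and descends to the quotients.) -/
def IsLeftInvariant (a b : ℝ) (g : MetricField 2) : Prop :=
  ∀ h : Sol a b, Set.EqOn (pullback h.act g) g halfSpace

/-- Locally homogeneous Hermitian metrics (as metrics on the universal cover). -/
def IsLocHomMetric (a b : ℝ) (g : MetricField 2) : Prop :=
  IsHermitianMetricOn halfSpace g ∧ IsLeftInvariant a b g

/-- Locally homogeneous solutions to the HCF with time interval `I`. -/
def IsLocHomHCFSolution (a b : ℝ) (I : Set ℝ) (g : ℝ → MetricField 2) : Prop :=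
  IsHCFSolutionOn halfSpace I g ∧ ∀ t ∈ I, IsLeftInvariant a b (g t)

/-! ### Inoue surfaces of type `S⁰` -/

/-- The lattice `Γ_{a,b}` generated by `h₀ = M(0,0,0,1)` and
`h_i = M(Re w_i, Im w_i, v_i, 0)`, `i = 1, 2, 3`. -/
def inoueLattice (a b : ℝ) (v : Fin 3 → ℝ) (w : Fin 3 → ℂ) : Subgroup (Sol a b) :=
  Subgroup.closure ({⟨0, 0, 1⟩} ∪ Set.range fun i => (⟨w i, v i, 0⟩ : Sol a b))

/-- The surface `X = Γ_{a,b} \ (ℂ × ℍ) = Γ_{a,b} \ G_{a,b}`. -/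
abbrev InoueS0 (a b : ℝ) (v : Fin 3 → ℝ) (w : Fin 3 → ℂ) : Type :=
  MulAction.orbitRel.Quotient (inoueLattice a b v w) Cover

/-- The projection `ℂ × ℍ → X`. -/
def proj (a b : ℝ) (v : Fin 3 → ℝ) (w : Fin 3 → ℂ) (p : Cover) : InoueS0 a b v w :=
  Quotient.mk (MulAction.orbitRel (inoueLattice a b v w) Cover) p

/-- The Riemannian distance on `X` of a metric that is given by its pull-back `g` to the universal
cover: the infimum of the lengths of the `C¹` curves in `X` between two points, each of which is the
projection of a curve in `ℂ × ℍ`. -/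
def riemDist (a b : ℝ) (v : Fin 3 → ℝ) (w : Fin 3 → ℂ) (g : MetricField 2)
    (P Q : InoueS0 a b v w) : ℝ :=
  sInf {L | ∃ c : ℝ → Cover, ContDiff ℝ 1 (fun t => (c t : Fin 2 → ℂ)) ∧
    proj a b v w (c 0) = P ∧ proj a b v w (c 1) = Q ∧
    L = curveLength g (fun t => (c t : Fin 2 → ℂ))}

/-- The spaces `(X, d_t)` converge to the compact metric space `Y` in the Gromov-Hausdorff topology
as `t → ∞`; part of this is that `d_t` makes `X` a (nonempty) compact metric space for large `t`. -/
def GHConverges {X : Type} (d : ℝ → X → X → ℝ) (Y : Type) [MetricSpace Y] [CompactSpace Y]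
    [Nonempty Y] : Prop :=
  ∀ ε > 0, ∀ᶠ t in Filter.atTop, ∃ (_ : MetricSpace X) (_ : CompactSpace X) (_ : Nonempty X),
    (∀ P Q : X, dist P Q = d t P Q) ∧ GromovHausdorff.ghDist X Y < ε

end InoueHCF

end

open InoueHCF

/-! The group acts simply transitively on ℂ × ℍ, so a left-invariant metric is given by a positive
definite matrix G at the base point; elsewhere its entries are those of G times complex powers of
the height 2√2 a Im τ (`IsLeftInvariant.eqOn_invField`). Derivatives of such powers are
multiplications by weights, so the flow becomes an ODE for G with diagonal A, B and off-diagonal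
entry C (`hcfTensor_invField_eq`): A' = -R A²|C|²/D², C' = -R A²B C/D², B' = 4a² - R|C|⁴/D², where D
= AB - |C|² and R = `flowCoeff a b` > 0.

The phase of C is constant, and h = |C|²/(AB), if not zero, satisfies (log h)' = -q/B with q =
R(2+h)/(1-h) + 4a². In the new time σ with σ' = q/B one has h = h₀e^{-σ}, and log A, log B are
integrals of explicit functions of h. So the system is solved by quadrature, and a lower bound for
log B makes σ a function of all t ≥ 0 (`exists_reduced_flow`). As σ → ∞, h → 0 and B' → 4a², which
gives y = 2B ∼ 8a²t; the signs of A' and C' give the monotonicity. Uniqueness holds because the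
vector field is rational in the entries of G, hence Lipschitz on compact sets where det G ≠ 0.

For the Gromov–Hausdorff limit, log of the height induces a map from X to the circle ℝ/2√2aℤ. After
division by 1+t, A tends to 0, while 2B and the Schur complement 2(B - |C|²/A) = 2B(1-h) both tend
to (2√2a)². The Schur complement bounds lengths below, so the map asymptotically does not increase
distances (`dist_circleMap_le`). For the opposite bound, motion along the height costs √(2B) per
unit of s and motion along ζ costs nothing in the limit, but motion along Re τ does not become
cheap. Here arithmetic enters: integer combinations of the entries of v are arbitrarily small, so a
lattice translation brings Re τ within any δ of its target, with the remaining ζ-displacement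
bounded in terms of δ alone (`exists_tube`, `exists_riemDist_le`).

This argument and the compactness of X rest on the independence of v, w and w̄. It holds because the
eigenvalue e^{√2(-a+ib)} is not real: otherwise it would be a double root of an integral cubic with
constant term -1, which `no_double_root` excludes. -/

namespace InoueHCF

open scoped ContDiff ComplexConjugate ComplexOrder Matrix

/-! ### The Chern connection and the HCF tensor of a left-invariant metric -/

/-- The weights `μ₀ = 1/2 - i b/(2a)`, `μ₁ = -1` with which the components of a left-invariant
metric depend on the height. -/
noncomputable def weight (a b : ℝ) : Fin 2 → ℂ := ![1 / 2 - (b / (2 * a) : ℝ) * Complex.I, -1]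

/-- The complex power `(2√2 a Im τ)^ν`. -/
noncomputable def heightPow (a : ℝ) (ν : ℂ) (p : Fin 2 → ℂ) : ℂ :=
  Complex.exp (ν * (Real.log (2 * √2 * a * (p 1).im) : ℝ))

/-- The left-invariant field of matrices with value `G` at the base point. -/
noncomputable def invField (a b : ℝ) (G : Matrix (Fin 2) (Fin 2) ℂ) : MetricField 2 :=
  fun p => Matrix.of fun i j => heightPow a (weight a b i + conj (weight a b j)) p * G i j

theorem invField_apply (a b : ℝ) (G : Matrix (Fin 2) (Fin 2) ℂ) (p : Fin 2 → ℂ) (i j : Fin 2) :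
    invField a b G p i j = heightPow a (weight a b i + conj (weight a b j)) p * G i j := rfl

theorem heightPow_add (a : ℝ) (μ ν : ℂ) (p : Fin 2 → ℂ) :
    heightPow a (μ + ν) p = heightPow a μ p * heightPow a ν p := by
  simp only [heightPow, ← Complex.exp_add]; congr 1; ring

theorem heightPow_zero (a : ℝ) (p : Fin 2 → ℂ) : heightPow a 0 p = 1 := by simp [heightPow]

theorem heightPow_ne_zero (a : ℝ) (ν : ℂ) (p : Fin 2 → ℂ) : heightPow a ν p ≠ 0 :=
  Complex.exp_ne_zero _

theorem conj_heightPow (a : ℝ) (ν : ℂ) (p : Fin 2 → ℂ) :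
    conj (heightPow a ν p) = heightPow a (conj ν) p := by
  simp [heightPow, ← Complex.exp_conj]

theorem kappa_pos {a : ℝ} (ha : 0 < a) : 0 < 2 * √2 * a := by positivity

theorem heightPow_neg_one {a : ℝ} (ha : 0 < a) {p : Fin 2 → ℂ} (hp : p ∈ halfSpace) :
    heightPow a (-1) p = (((2 * √2 * a) * (p 1).im : ℝ) : ℂ)⁻¹ := by
  have hp' : 0 < (p 1).im := hp
  have := kappa_pos ha
  rw [heightPow, neg_one_mul, Complex.exp_neg, ← Complex.ofReal_exp, Real.exp_log (by positivity)]

theorem isOpen_halfSpace : IsOpen halfSpace :=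
  isOpen_lt continuous_const (Complex.continuous_im.comp (continuous_apply 1))

theorem hasFDerivAt_heightPow {a : ℝ} (ha : 0 < a) (ν : ℂ) {p : Fin 2 → ℂ} (hp : p ∈ halfSpace) :
    HasFDerivAt (heightPow a ν)
      (((ν * heightPow a ν p / ((p 1).im : ℂ)) • Complex.ofRealCLM).comp
        (Complex.imCLM.comp (ContinuousLinearMap.proj (R := ℝ) (φ := fun _ : Fin 2 => ℂ) 1))) p := by
  have hp' : 0 < (p 1).im := hp
  have hk := kappa_pos ha
  have h1 : HasFDerivAt (fun q : Fin 2 → ℂ => (q 1).im)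
      (Complex.imCLM.comp (ContinuousLinearMap.proj (R := ℝ) (φ := fun _ : Fin 2 => ℂ) 1)) p :=
    (Complex.imCLM.comp (ContinuousLinearMap.proj (R := ℝ) (φ := fun _ : Fin 2 => ℂ) 1)).hasFDerivAt
  have h2 : HasDerivAt (fun y : ℝ => Complex.exp (ν * (Real.log (2 * √2 * a * y) : ℝ)))
      (ν * heightPow a ν p / ((p 1).im : ℂ)) (p 1).im := by
    have h3 : HasDerivAt (fun y : ℝ => Real.log (2 * √2 * a * y)) ((p 1).im)⁻¹ (p 1).im := by
      have : HasDerivAt (fun y : ℝ => Real.log (2 * √2 * a * y))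
          (2 * √2 * a * 1 / (2 * √2 * a * (p 1).im)) (p 1).im :=
        ((hasDerivAt_id (p 1).im).const_mul (2 * √2 * a)).log (by simp only [id]; positivity)
      exact this.congr_deriv (by field_simp)
    convert (h3.ofReal_comp.const_mul ν).cexp using 1
    rw [heightPow]; push_cast; ring
  have h4 := h2.hasFDerivAt.comp p h1
  refine h4.congr_fderiv ?_
  ext v
  simp [mul_comm]

theorem dz_zero_heightPow {a : ℝ} (ha : 0 < a) (ν : ℂ) {p : Fin 2 → ℂ} (hp : p ∈ halfSpace) (c : ℂ) :
    dz 0 (fun q => heightPow a ν q * c) p = 0 := by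
  rw [dz, ((hasFDerivAt_heightPow ha ν hp).mul_const c).fderiv]
  simp

theorem dz_one_heightPow {a : ℝ} (ha : 0 < a) (ν : ℂ) {p : Fin 2 → ℂ} (hp : p ∈ halfSpace) (c : ℂ) :
    dz 1 (fun q => heightPow a ν q * c) p
      = -(Complex.I / (2 * (p 1).im)) * ν * (heightPow a ν p * c) := by
  rw [dz, ((hasFDerivAt_heightPow ha ν hp).mul_const c).fderiv]
  simp
  ring

theorem dzbar_zero_heightPow {a : ℝ} (ha : 0 < a) (ν : ℂ) {p : Fin 2 → ℂ} (hp : p ∈ halfSpace)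
    (c : ℂ) : dzbar 0 (fun q => heightPow a ν q * c) p = 0 := by
  rw [dzbar, ((hasFDerivAt_heightPow ha ν hp).mul_const c).fderiv]
  simp

theorem dzbar_one_heightPow {a : ℝ} (ha : 0 < a) (ν : ℂ) {p : Fin 2 → ℂ} (hp : p ∈ halfSpace)
    (c : ℂ) : dzbar 1 (fun q => heightPow a ν q * c) p
      = (Complex.I / (2 * (p 1).im)) * ν * (heightPow a ν p * c) := by
  rw [dzbar, ((hasFDerivAt_heightPow ha ν hp).mul_const c).fderiv]
  simp
  ring

theorem dz_congr {n : ℕ} {U : Set (Fin n → ℂ)} (hU : IsOpen U) {f f' : (Fin n → ℂ) → ℂ}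
    (h : Set.EqOn f f' U) {p : Fin n → ℂ} (hp : p ∈ U) (i : Fin n) : dz i f p = dz i f' p := by
  have := (h.eventuallyEq_of_mem (hU.mem_nhds hp)).fderiv_eq (𝕜 := ℝ)
  simp only [dz, this]

theorem dzbar_congr {n : ℕ} {U : Set (Fin n → ℂ)} (hU : IsOpen U) {f f' : (Fin n → ℂ) → ℂ}
    (h : Set.EqOn f f' U) {p : Fin n → ℂ} (hp : p ∈ U) (i : Fin n) :
    dzbar i f p = dzbar i f' p := by
  have := (h.eventuallyEq_of_mem (hU.mem_nhds hp)).fderiv_eq (𝕜 := ℝ)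
  simp only [dzbar, this]

theorem chernGamma_congr {n : ℕ} {U : Set (Fin n → ℂ)} (hU : IsOpen U) {g g' : MetricField n}
    (h : Set.EqOn g g' U) {p : Fin n → ℂ} (hp : p ∈ U) (i j k : Fin n) :
    chernGamma g p i j k = chernGamma g' p i j k := by
  have hd : ∀ l, dz i (fun q => g q j l) p = dz i (fun q => g' q j l) p := fun l =>
    dz_congr hU (fun q hq => by rw [h hq]) hp i
  simp only [chernGamma, hd, h hp]

/-- The tensor is a local operator. This is needed because invariance identifies a metric with an
`invField` only on the half space, whereas `fderiv` is taken on all of ℂ². -/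
theorem hcfTensor_congr {n : ℕ} {U : Set (Fin n → ℂ)} (hU : IsOpen U) {g g' : MetricField n}
    (h : Set.EqOn g g' U) {p : Fin n → ℂ} (hp : p ∈ U) (i j : Fin n) :
    hcfTensor g p i j = hcfTensor g' p i j := by
  have hG : ∀ q ∈ U, ∀ i j k, chernGamma g q i j k = chernGamma g' q i j k :=
    fun q hq i j k => chernGamma_congr hU h hq i j k
  have hd : ∀ l k i m, dzbar l (fun q => chernGamma g q k i m) p
      = dzbar l (fun q => chernGamma g' q k i m) p := fun l k i m =>
    dzbar_congr hU (fun q hq => hG q hq k i m) hp l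
  simp only [hcfTensor, secondChernRicci, chernCurvature, torsionQ1, torsionQ2, torsionQ3,
    torsionQ4, torsion, hd, h hp, hG p hp]

theorem invField_inv (a b : ℝ) {G : Matrix (Fin 2) (Fin 2) ℂ} (hG : IsUnit G.det)
    (p : Fin 2 → ℂ) (l k : Fin 2) :
    (invField a b G p)⁻¹ l k
      = heightPow a (-conj (weight a b l) - weight a b k) p * G⁻¹ l k := by
  have h : (Matrix.of fun l k =>
      heightPow a (-conj (weight a b l) - weight a b k) p * G⁻¹ l k) * invField a b G p = 1 := by
    ext l j
    rw [← Matrix.nonsing_inv_mul G hG, Matrix.mul_apply, Matrix.mul_apply]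
    have : ∀ k, heightPow a (-conj (weight a b l) - weight a b k) p * G⁻¹ l k *
        (heightPow a (weight a b k + conj (weight a b j)) p * G k j)
        = heightPow a (-conj (weight a b l) + conj (weight a b j)) p * (G⁻¹ l k * G k j) := by
      intro k
      rw [mul_mul_mul_comm, ← heightPow_add]; ring_nf
    simp only [Matrix.of_apply, invField_apply, this, ← Finset.mul_sum]
    rw [← Matrix.mul_apply, Matrix.nonsing_inv_mul G hG]
    by_cases hlj : l = j
    · subst hlj; simp [heightPow_zero]
    · simp [hlj]
  rw [Matrix.inv_eq_left_inv h]; rfl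

theorem chernGamma_invField_zero {a b : ℝ} (ha : 0 < a) {G : Matrix (Fin 2) (Fin 2) ℂ}
    {p : Fin 2 → ℂ} (hp : p ∈ halfSpace) (j k : Fin 2) :
    chernGamma (invField a b G) p 0 j k = 0 := by
  simp only [chernGamma, invField_apply, dz_zero_heightPow ha _ hp, mul_zero,
    Finset.sum_const_zero]

theorem chernGamma_invField_one {a b : ℝ} (ha : 0 < a) {G : Matrix (Fin 2) (Fin 2) ℂ}
    {p : Fin 2 → ℂ} (hp : p ∈ halfSpace) (j k : Fin 2) :
    chernGamma (invField a b G) p 1 j k = ∑ l, (invField a b G p)⁻¹ l k *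
      (-(Complex.I / (2 * (p 1).im)) * (weight a b j + conj (weight a b l)) *
        invField a b G p j l) := by
  simp only [chernGamma, invField_apply, dz_one_heightPow ha _ hp]

/-- The weights of the metric and of its inverse combine, and 1/Im τ is itself a multiple of the
height power -1. What remains is one power times a constant, ready for the next derivative. -/
theorem chernGamma_invField_one' {a b : ℝ} (ha : 0 < a) {G : Matrix (Fin 2) (Fin 2) ℂ}
    (hG : IsUnit G.det) {p : Fin 2 → ℂ} (hp : p ∈ halfSpace) (j k : Fin 2) :
    chernGamma (invField a b G) p 1 j k = heightPow a (weight a b j - weight a b k - 1) p *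
      ∑ l, -(Complex.I / 2) * (2 * √2 * a : ℝ) * (weight a b j + conj (weight a b l)) *
        G⁻¹ l k * G j l := by
  rw [chernGamma_invField_one ha hp, Finset.mul_sum]
  refine Finset.sum_congr rfl fun l _ => ?_
  have hη : (Complex.I / (2 * (p 1).im)) =
      Complex.I / 2 * (2 * √2 * a : ℝ) * heightPow a (-1) p := by
    have hp' : (p 1).im ≠ 0 := (show 0 < (p 1).im from hp).ne'
    have := (kappa_pos ha).ne'
    rw [heightPow_neg_one ha hp]
    have h1 : (((2 * √2 * a : ℝ)) : ℂ) ≠ 0 := by exact_mod_cast this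
    have h2 : ((p 1).im : ℂ) ≠ 0 := by exact_mod_cast hp'
    rw [Complex.ofReal_mul _ (p 1).im]
    field_simp
  rw [invField_inv a b hG, hη, invField_apply,
    show weight a b j - weight a b k - 1 = (-conj (weight a b l) - weight a b k)
      + (-1) + (weight a b j + conj (weight a b l)) by ring, heightPow_add _ (_ + _),
    heightPow_add _ (-conj (weight a b l) - weight a b k)]
  ring

theorem dzbar_chernGamma_invField {a b : ℝ} (ha : 0 < a) {G : Matrix (Fin 2) (Fin 2) ℂ}
    (hG : IsUnit G.det) {p : Fin 2 → ℂ} (hp : p ∈ halfSpace) (k l i m : Fin 2) :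
    dzbar l (fun q => chernGamma (invField a b G) q k i m) p =
      if k = 1 ∧ l = 1 then (Complex.I / (2 * (p 1).im)) * (weight a b i - weight a b m - 1) *
        chernGamma (invField a b G) p 1 i m else 0 := by
  have h1 := dzbar_congr isOpen_halfSpace
    (fun q hq => chernGamma_invField_one' (b := b) ha hG hq i m) hp
  have h0 := dzbar_congr isOpen_halfSpace (f' := fun _ => 0)
    (fun q hq => chernGamma_invField_zero (b := b) (G := G) ha hq i m) hp
  fin_cases k <;> fin_cases l
  · simpa [dzbar] using h0 0
  · simpa [dzbar] using h0 1
  · simpa [dzbar_zero_heightPow ha _ hp] using h1 0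
  · simpa [dzbar_one_heightPow ha _ hp, chernGamma_invField_one' ha hG hp] using h1 1

theorem det_invField_ne_zero (a b : ℝ) {G : Matrix (Fin 2) (Fin 2) ℂ} (hG : IsUnit G.det)
    (p : Fin 2 → ℂ) : (invField a b G p).det ≠ 0 := by
  have : (invField a b G p).det = heightPow a (weight a b 0 + conj (weight a b 0)) p *
      heightPow a (weight a b 1 + conj (weight a b 1)) p * G.det := by
    rw [Matrix.det_fin_two, Matrix.det_fin_two]
    simp only [invField_apply, heightPow_add]
    ring
  rw [this]
  exact mul_ne_zero (mul_ne_zero (heightPow_ne_zero _ _ _) (heightPow_ne_zero _ _ _)) hG.ne_zero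

/-- Only one of the two Christoffel terms survives, since nothing depends on ζ; lowering the index
then cancels the inverse metric. -/
theorem torsion_invField {a b : ℝ} (ha : 0 < a) {G : Matrix (Fin 2) (Fin 2) ℂ}
    (hG : IsUnit G.det) {p : Fin 2 → ℂ} (hp : p ∈ halfSpace) (k : Fin 2) :
    torsion (invField a b G) p 1 0 k = -(Complex.I / (2 * (p 1).im)) *
      (weight a b 0 + conj (weight a b k)) * invField a b G p 0 k := by
  have hH := isUnit_iff_ne_zero.2 (det_invField_ne_zero a b hG p)
  simp only [torsion, chernGamma_invField_zero ha hp, sub_zero, chernGamma_invField_one ha hp,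
    Finset.sum_mul]
  rw [Finset.sum_comm]
  have : ∀ l, ∑ x, (invField a b G p)⁻¹ l x * (-(Complex.I / (2 * (p 1).im)) *
      (weight a b 0 + conj (weight a b l)) * invField a b G p 0 l) * invField a b G p x k
      = -(Complex.I / (2 * (p 1).im)) * (weight a b 0 + conj (weight a b l)) *
        invField a b G p 0 l * (1 : Matrix (Fin 2) (Fin 2) ℂ) l k := by
    intro l
    rw [← Matrix.nonsing_inv_mul _ hH, Matrix.mul_apply, Finset.mul_sum]
    exact Finset.sum_congr rfl fun x _ => by ring
  rw [Finset.sum_congr rfl fun l _ => this l]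
  simp [Matrix.one_apply]

theorem torsion_antisymm {n : ℕ} (g : MetricField n) (p : Fin n → ℂ) (i j k : Fin n) :
    torsion g p i j k = -torsion g p j i k := by
  rw [torsion, torsion, ← Finset.sum_neg_distrib]
  exact Finset.sum_congr rfl fun l _ => by ring

/-- The matrix `K̂` for which the HCF tensor of a left-invariant metric with components `H` at
height `η` is `(2η)⁻² K̂(H)`. -/
noncomputable def reducedHcf (a b : ℝ) (H : Matrix (Fin 2) (Fin 2) ℂ) : Matrix (Fin 2) (Fin 2) ℂ :=
  !![(9 / 4 + (b / (2 * a) : ℝ) ^ 2) * H 0 0 ^ 2 * (H 0 1 * H 1 0) / H.det ^ 2,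
      (9 / 4 + (b / (2 * a) : ℝ) ^ 2) * H 0 0 ^ 2 * H 1 1 * H 0 1 / H.det ^ 2;
    (9 / 4 + (b / (2 * a) : ℝ) ^ 2) * H 0 0 ^ 2 * H 1 1 * H 1 0 / H.det ^ 2,
      (9 / 4 + (b / (2 * a) : ℝ) ^ 2) * (H 0 1 * H 1 0) ^ 2 / H.det ^ 2 - 2]

theorem secondChernRicci_invField {a b : ℝ} (ha : 0 < a) {G : Matrix (Fin 2) (Fin 2) ℂ}
    (hG : IsUnit G.det) {p : Fin 2 → ℂ} (hp : p ∈ halfSpace) (i j : Fin 2) :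
    secondChernRicci (invField a b G) p i j = (invField a b G p)⁻¹ 1 1 *
      ∑ m, -((Complex.I / (2 * (p 1).im)) * (weight a b i - weight a b m - 1) *
        ∑ l, (invField a b G p)⁻¹ l m * (-(Complex.I / (2 * (p 1).im)) *
          (weight a b i + conj (weight a b l)) * invField a b G p i l)) *
        invField a b G p m j := by
  simp only [secondChernRicci, chernCurvature, dzbar_chernGamma_invField ha hG hp]
  simp [chernGamma_invField_one ha hp]
  ring

/-- Every term of S and Q contains exactly two derivatives, each contributing a factor ±i/(2 Im τ)
and a weight. Once these are inserted, the claim is a rational identity in the four entries of the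
metric and in μ₀, with conj μ₀ = 1 - μ₀ as the only relation. -/
theorem hcfTensor_invField {a b : ℝ} (ha : 0 < a) {G : Matrix (Fin 2) (Fin 2) ℂ}
    (hG : G.PosDef) {p : Fin 2 → ℂ} (hp : p ∈ halfSpace) (i j : Fin 2) :
    hcfTensor (invField a b G) p i j =
      (1 / (2 * (p 1).im)) ^ 2 * reducedHcf a b (invField a b G p) i j := by
  have hGu : IsUnit G.det := (Matrix.isUnit_iff_isUnit_det _).1 hG.isUnit
  have hdet := det_invField_ne_zero a b hGu p
  have t00 : ∀ k, torsion (invField a b G) p 0 0 k = 0 := fun k => by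
    have := torsion_antisymm (invField a b G) p 0 0 k; linear_combination this / 2
  have t11 : ∀ k, torsion (invField a b G) p 1 1 k = 0 := fun k => by
    have := torsion_antisymm (invField a b G) p 1 1 k; linear_combination this / 2
  have t01 := fun k => torsion_antisymm (invField a b G) p 0 1 k
  have t10 := fun k => torsion_invField (b := b) ha hGu hp k
  have hc : ∀ i j, conj (invField a b G p i j) = invField a b G p j i := fun i j => by
    have := hG.1.apply i j
    simp only [invField_apply, map_mul, conj_heightPow, map_add, Complex.conj_conj]
    rw [← this, add_comm]; simp
  have hS := fun i j => secondChernRicci_invField (b := b) ha hGu hp i j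
  have hccj : conj (Complex.I / (2 * (p 1).im)) = -(Complex.I / (2 * (p 1).im)) := by
    rw [map_div₀, map_mul, Complex.conj_I, Complex.conj_ofReal, map_ofNat, neg_div]
  have hcc : (1 / (2 * ((p 1).im : ℂ))) ^ 2 = -(Complex.I / (2 * (p 1).im)) ^ 2 := by
    rw [div_pow, div_pow, Complex.I_sq]; ring
  have hm : conj (weight a b 0) = 1 - weight a b 0 := by
    simp only [weight, Matrix.cons_val_zero, map_sub, map_mul, map_div₀, map_one, map_ofNat,
      Complex.conj_ofReal, Complex.conj_I]
    ring
  have hm2 : conj (1 - weight a b 0) = weight a b 0 := by rw [map_sub, map_one, hm, sub_sub_cancel]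
  -- The constant of the flow is |μ₀|² + 2; writing it through μ₀ removes a and b from the identity.
  have hm' : (9 / 4 + ((b / (2 * a) : ℝ) : ℂ) ^ 2) = weight a b 0 * (1 - weight a b 0) + 2 := by
    simp only [weight, Matrix.cons_val_zero]
    linear_combination ((b / (2 * a) : ℝ) : ℂ) ^ 2 * Complex.I_sq
  have hw1 : weight a b 1 = -1 := rfl
  rw [hcc]
  revert i j
  simp only [Fin.forall_fin_two]
  simp only [hcfTensor, hS, torsionQ1, torsionQ2, torsionQ3, torsionQ4, Fin.sum_univ_two, t00, t11,
    t01, t10, map_zero, map_neg, map_mul, map_add, hc, hccj, hm, hm2, Complex.conj_conj, hw1, map_one,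
    zero_mul, mul_zero, add_zero, zero_add, reducedHcf, hm']
  rw [Matrix.inv_def, Ring.inverse_eq_inv', Matrix.adjugate_fin_two]
  generalize invField a b G p = H at *
  generalize Complex.I / (2 * ((p 1).im : ℂ)) = c
  generalize weight a b 0 = m
  have hD' : H.det = H 0 0 * H 1 1 - H 0 1 * H 1 0 := Matrix.det_fin_two H
  simp only [Fin.isValue, Matrix.smul_apply, Matrix.of_apply,
      Matrix.cons_val', Matrix.cons_val_zero, Matrix.cons_val_one, Matrix.cons_val_fin_one,
      smul_eq_mul]
  generalize H.det = D at *
  generalize H 0 0 = A at *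
  generalize H 0 1 = C at *
  generalize H 1 0 = C' at *
  generalize H 1 1 = B at *
  refine ⟨⟨?_, ?_⟩, ?_, ?_⟩
  all_goals field_simp
  all_goals subst hD'
  all_goals ring

end InoueHCF

/-! ### Left-invariant metrics correspond to positive definite matrices -/

namespace InoueHCF

open scoped ContDiff ComplexConjugate ComplexOrder Matrix

/-- The field is a congruence of G by an invertible diagonal matrix, which is why positivity at the
base point gives positivity everywhere. -/
theorem invField_eq_diagonal (a b : ℝ) (G : Matrix (Fin 2) (Fin 2) ℂ) (p : Fin 2 → ℂ) :
    invField a b G p = Matrix.diagonal (fun i => heightPow a (weight a b i) p) * G *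
      (Matrix.diagonal (fun i => heightPow a (weight a b i) p))ᴴ := by
  ext i j
  rw [Matrix.diagonal_conjTranspose, Matrix.mul_diagonal, Matrix.diagonal_mul, invField_apply,
    heightPow_add, Pi.star_apply, ← starRingEnd_apply, conj_heightPow]
  ring

theorem posDef_invField (a b : ℝ) {G : Matrix (Fin 2) (Fin 2) ℂ} (hG : G.PosDef) (p : Fin 2 → ℂ) :
    (invField a b G p).PosDef := by
  rw [invField_eq_diagonal]
  refine hG.mul_mul_conjTranspose_same ?_
  rw [Matrix.vecMul_injective_iff_isUnit, Matrix.isUnit_diagonal, Pi.isUnit_iff]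
  exact fun i => (heightPow_ne_zero _ _ _).isUnit

theorem contDiffOn_heightPow {a : ℝ} (ha : 0 < a) (ν : ℂ) :
    ContDiffOn ℝ ∞ (heightPow a ν) halfSpace := by
  have h : ContDiffOn ℝ ∞ (fun p : Fin 2 → ℂ => Real.log (2 * √2 * a * (p 1).im)) halfSpace := by
    refine ContDiffOn.log (contDiff_const.mul
      (Complex.imCLM.contDiff.comp (contDiff_apply ℝ ℂ (1 : Fin 2)))).contDiffOn fun p hp => ?_
    have hp' : 0 < (p 1).im := hp
    have := kappa_pos ha
    positivity
  exact (contDiffOn_const.mul (Complex.ofRealCLM.contDiff.comp_contDiffOn h)).cexp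

theorem isHermitianMetricOn_invField {a b : ℝ} (ha : 0 < a) {G : Matrix (Fin 2) (Fin 2) ℂ}
    (hG : G.PosDef) : IsHermitianMetricOn halfSpace (invField a b G) :=
  ⟨fun i j => by
    simp only [invField_apply]
    exact (contDiffOn_heightPow ha _).mul contDiffOn_const, fun p _ => posDef_invField a b hG p⟩

/-- The derivatives `e^{s√2(-a+ib)}` and `e^{2√2 a s}` of the two components of `Sol.act`. -/
noncomputable def multiplier (a b s : ℝ) (i : Fin 2) : ℂ :=
  Complex.exp (-(weight a b i * (2 * √2 * a * s : ℝ)))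

theorem multiplier_zero {a : ℝ} (ha : 0 < a) (b s : ℝ) :
    multiplier a b s 0 = Sol.alpha a b s := by
  have : (a : ℂ) ≠ 0 := by exact_mod_cast ha.ne'
  simp only [multiplier, Sol.alpha, weight, Matrix.cons_val_zero]
  congr 1
  push_cast
  field_simp
  ring

theorem multiplier_one (a b s : ℝ) : multiplier a b s 1 = (Sol.lam a s : ℂ) := by
  simp [multiplier, Sol.lam, weight]

theorem heightPow_act {a b : ℝ} (ha : 0 < a) (ν : ℂ) (h : Sol a b) {p : Fin 2 → ℂ}
    (hp : p ∈ halfSpace) :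
    heightPow a ν (h.act p) = Complex.exp (ν * (2 * √2 * a * h.s : ℝ)) * heightPow a ν p := by
  have hp' : 0 < (p 1).im := hp
  have hk := kappa_pos ha
  have : Real.log (2 * √2 * a * (h.act p 1).im)
      = 2 * √2 * a * h.s + Real.log (2 * √2 * a * (p 1).im) := by
    have : 2 * √2 * a * (h.act p 1).im = Sol.lam a h.s * (2 * √2 * a * (p 1).im) := by
      simp [Sol.act]; ring
    rw [this, Real.log_mul (Sol.lam_pos _).ne' (by positivity), Sol.lam, Real.log_exp]
  rw [heightPow, this, heightPow, ← Complex.exp_add]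
  congr 1; push_cast; ring

theorem heightPow_basePoint {a : ℝ} (ha : 0 < a) (ν : ℂ) : heightPow a ν (basePoint a) = 1 := by
  have hk := kappa_pos ha
  have : 2 * √2 * a * (basePoint a 1).im = 1 := by
    simp only [basePoint, Matrix.cons_val_one, Matrix.cons_val_fin_one, Complex.div_ofReal_im,
      Complex.I_im]
    field_simp
  rw [heightPow, this]; simp

theorem invField_basePoint {a : ℝ} (ha : 0 < a) (b : ℝ) (G : Matrix (Fin 2) (Fin 2) ℂ) :
    invField a b G (basePoint a) = G := by
  ext i j
  rw [invField_apply, heightPow_basePoint ha, one_mul]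

theorem dz_act {a b : ℝ} (ha : 0 < a) (h : Sol a b) (p : Fin 2 → ℂ) (i k : Fin 2) :
    dz i (fun q => h.act q k) p = if i = k then multiplier a b h.s i else 0 := by
  have h0 : HasFDerivAt (fun q : Fin 2 → ℂ => h.act q k)
      (multiplier a b h.s k • ContinuousLinearMap.proj (R := ℝ) (φ := fun _ : Fin 2 => ℂ) k) p := by
    have := ((ContinuousLinearMap.proj (R := ℝ) (φ := fun _ : Fin 2 => ℂ) k).hasFDerivAt
      (x := p)).const_mul (multiplier a b h.s k)
    have h2 : (fun q : Fin 2 → ℂ => h.act q k) = fun q => multiplier a b h.s k *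
      ContinuousLinearMap.proj (R := ℝ) (φ := fun _ : Fin 2 => ℂ) k q + h.act 0 k := by
      ext q
      fin_cases k
      · simp [Sol.act, multiplier_zero ha]
      · simp [Sol.act, multiplier_one]
    rw [h2]
    exact this.add_const _
  rw [dz, h0.fderiv]
  fin_cases i <;> fin_cases k <;> simp
  all_goals
    linear_combination (-multiplier a b h.s _ / 2) * Complex.I_sq

theorem pullback_act_apply {a b : ℝ} (ha : 0 < a) (h : Sol a b) (g : MetricField 2)
    (p : Fin 2 → ℂ) (i j : Fin 2) : pullback h.act g p i j =
      multiplier a b h.s i * conj (multiplier a b h.s j) * g (h.act p) i j := by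
  rw [pullback, Matrix.of_apply]
  simp only [dz_act ha]
  fin_cases i <;> fin_cases j <;> simp

theorem multiplier_mul_exp (a b s : ℝ) (i j : Fin 2) :
    multiplier a b s i * conj (multiplier a b s j) *
      Complex.exp ((weight a b i + conj (weight a b j)) * (2 * √2 * a * s : ℝ)) = 1 := by
  rw [multiplier, multiplier, ← Complex.exp_conj, ← Complex.exp_add, ← Complex.exp_add]
  simp only [map_neg, map_mul, Complex.conj_ofReal]
  rw [← Complex.exp_zero]; congr 1; ring

theorem isLeftInvariant_invField {a b : ℝ} (ha : 0 < a) (G : Matrix (Fin 2) (Fin 2) ℂ) :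
    IsLeftInvariant a b (invField a b G) := by
  intro h p hp
  ext i j
  rw [pullback_act_apply ha, invField_apply, heightPow_act ha _ h hp, invField_apply]
  linear_combination (heightPow a (weight a b i + conj (weight a b j)) p * G i j) *
    multiplier_mul_exp a b h.s i j

theorem basePoint_mem {a : ℝ} (ha : 0 < a) : basePoint a ∈ halfSpace := by
  have := (orbitMap_bijOn a 0 ha).mapsTo (Set.mem_univ 1)
  simpa [Sol.act_one] using this

/-- The action is transitive, so invariance transports the value at the base point to every point;
the multipliers of the action are exactly compensated by the weights. -/
theorem IsLeftInvariant.eqOn_invField {a b : ℝ} (ha : 0 < a) {g : MetricField 2}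
    (hg : IsLeftInvariant a b g) : Set.EqOn g (invField a b (g (basePoint a))) halfSpace := by
  intro p hp
  obtain ⟨h, -, rfl⟩ := (orbitMap_bijOn a b ha).surjOn hp
  ext i j
  have h1 := congrFun (congrFun (hg h (basePoint_mem ha)) i) j
  rw [pullback_act_apply ha] at h1
  change g (h.act (basePoint a)) i j = invField a b (g (basePoint a)) (h.act (basePoint a)) i j
  rw [invField_apply, heightPow_act ha _ h (basePoint_mem ha), heightPow_basePoint ha, ← h1]
  linear_combination (-g (h.act (basePoint a)) i j) * multiplier_mul_exp a b h.s i j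

/-- The HCF tensor of a left-invariant metric is left-invariant. -/
theorem hcfTensor_invField_eq {a b : ℝ} (ha : 0 < a) {G : Matrix (Fin 2) (Fin 2) ℂ}
    (hG : G.PosDef) {p : Fin 2 → ℂ} (hp : p ∈ halfSpace) (i j : Fin 2) :
    hcfTensor (invField a b G) p i j
      = invField a b ((2 * a ^ 2 : ℂ) • reducedHcf a b G) p i j := by
  rw [hcfTensor_invField ha hG hp]
  have hGu : IsUnit G.det := (Matrix.isUnit_iff_isUnit_det _).1 hG.isUnit
  have hdet := det_invField_ne_zero a b hGu p
  have hdG := hGu.ne_zero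
  have hη : (1 / (2 * ((p 1).im : ℂ))) ^ 2 = 2 * a ^ 2 * heightPow a (-1) p ^ 2 := by
    have hp' : (p 1).im ≠ 0 := (show 0 < (p 1).im from hp).ne'
    have h2 : ((p 1).im : ℂ) ≠ 0 := by exact_mod_cast hp'
    have h3 : (a : ℂ) ≠ 0 := by exact_mod_cast ha.ne'
    have h4 : ((√2 : ℝ) : ℂ) ≠ 0 := by simp
    have h5 : ((√2 : ℝ) : ℂ) ^ 2 = 2 := by
      rw [← Complex.ofReal_pow, Real.sq_sqrt (by norm_num)]; norm_num
    rw [heightPow_neg_one ha hp]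
    push_cast
    field_simp
    rw [h5]
  rw [hη]
  have hm : conj (-1 : ℂ) = -1 := by simp
  have hw1 : weight a b 1 = -1 := rfl
  rw [Matrix.det_fin_two] at hdet hdG
  revert i j
  simp only [Fin.forall_fin_two]
  simp only [reducedHcf, Matrix.det_fin_two, invField_apply, Matrix.smul_apply, Matrix.of_apply,
      Matrix.cons_val', Matrix.cons_val_zero, Matrix.cons_val_one, Matrix.cons_val_fin_one,
      smul_eq_mul, heightPow_add, hm, hw1] at hdet ⊢
  have e0 := heightPow_ne_zero a (weight a b 0) p
  have e1 := heightPow_ne_zero a (conj (weight a b 0)) p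
  have e2 := heightPow_ne_zero a (-1) p
  generalize heightPow a (weight a b 0) p = x0 at *
  generalize heightPow a (conj (weight a b 0)) p = x1 at *
  generalize heightPow a (-1) p = x2 at *
  -- The determinant has weight x0 x1 x2². Hence each entry of `reducedHcf` lacks exactly the factor
  -- x2² to have the weight of a metric component, and that factor is supplied by 1/(2 Im τ)².
  have hd : x0 * x1 * G 0 0 * (x2 * x2 * G 1 1) - x0 * x2 * G 0 1 * (x2 * x1 * G 1 0)
      = x0 * x1 * x2 ^ 2 * (G 0 0 * G 1 1 - G 0 1 * G 1 0) := by ring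
  rw [hd]
  generalize G 0 0 * G 1 1 - G 0 1 * G 1 0 = D at *
  refine ⟨⟨?_, ?_⟩, ?_, ?_⟩
  all_goals field_simp

/-- The factors come from the frame: |√2(1-i)|² = 4, |√2|² = 2, and their product 8 for the squared
modulus of the mixed component. -/
theorem comp_invField {a : ℝ} (ha : 0 < a) (b : ℝ) (G : Matrix (Fin 2) (Fin 2) ℂ) :
    compX a (invField a b G) = 4 * (G 0 0).re ∧ compY a (invField a b G) = 2 * (G 1 1).re ∧
      compU a (invField a b G) = 8 * Complex.normSq (G 0 1) := by
  have h5 : ((√2 : ℝ) : ℂ) * ((√2 : ℝ) : ℂ) = 2 := by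
    rw [← Complex.ofReal_mul, Real.mul_self_sqrt (by norm_num)]; norm_num
  have h0 : comp a (invField a b G) 0 0 = 4 * G 0 0 := by
    simp only [comp, invField_basePoint ha, frameZ, Fin.sum_univ_two, Matrix.cons_val_zero,
      Matrix.cons_val_one, Matrix.cons_val_fin_one, map_mul, map_sub, map_one, map_zero,
      Complex.conj_I, Complex.conj_ofReal]
    linear_combination (1 - Complex.I) * (1 + Complex.I) * G 0 0 * h5 - 2 * G 0 0 * Complex.I_sq
  have h1 : comp a (invField a b G) 1 1 = 2 * G 1 1 := by
    simp [comp, invField_basePoint ha, frameZ, h5]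
  have h2 : comp a (invField a b G) 0 1 = 2 * (1 - Complex.I) * G 0 1 := by
    simp only [comp, invField_basePoint ha, frameZ, Fin.sum_univ_two, Matrix.cons_val_zero,
      Matrix.cons_val_one, Matrix.cons_val_fin_one, map_mul, map_sub, map_one, map_zero,
      Complex.conj_I, Complex.conj_ofReal]
    linear_combination (1 - Complex.I) * G 0 1 * h5
  refine ⟨?_, ?_, ?_⟩
  · rw [compX, h0]; simp
  · rw [compY, h1]; simp
  · rw [compU, compZ, h2, ← Complex.normSq_eq_norm_sq]
    simp [Complex.normSq_apply]
    ring

theorem comp_congr {a : ℝ} {g g' : MetricField 2} (h : g (basePoint a) = g' (basePoint a)) :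
    comp a g = comp a g' := by
  ext i j
  simp only [comp, h]

end InoueHCF

/-! ### Solution of the reduced system by quadrature -/

namespace InoueHCF

open scoped ContDiff ComplexConjugate ComplexOrder Matrix

/-- A continuous positive speed that is bounded below is the derivative of the inverse of a time
change of the line fixing `0`. -/
theorem exists_time_change {f : ℝ → ℝ} (hf : Continuous f) {δ : ℝ} (hδ : 0 < δ)
    (hfδ : ∀ s, δ ≤ f s) : ∃ σ : ℝ → ℝ, σ 0 = 0 ∧ StrictMono σ ∧
      Filter.Tendsto σ Filter.atTop Filter.atTop ∧ ∀ t, HasDerivAt σ (f (σ t))⁻¹ t := by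
  set τ : ℝ → ℝ := fun u => ∫ s in (0 : ℝ)..u, f s with hτ
  have hd : ∀ u, HasDerivAt τ (f u) u := fun u => (hf.integral_hasStrictDerivAt 0 u).hasDerivAt
  have hτ0 : τ 0 = 0 := by simp [hτ]
  -- Linear growth of τ in both directions makes it a bijection of the line; σ is its inverse.
  have hmono : Monotone fun u => τ u - δ * u := by
    have hd' : ∀ u, HasDerivAt (fun u => τ u - δ * u) (f u - δ) u := fun u => by
      exact ((hd u).sub ((hasDerivAt_id u).const_mul δ)).congr_deriv (by rw [mul_one])
    refine monotone_of_deriv_nonneg (fun u => (hd' u).differentiableAt) fun u => ?_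
    rw [(hd' u).deriv]
    linarith [hfδ u]
  have hstrict : StrictMono τ := strictMono_of_deriv_pos fun u => by
    rw [(hd u).deriv]; linarith [hfδ u]
  have hcont : Continuous τ := continuous_iff_continuousAt.2 fun u => (hd u).continuousAt
  have htop : Filter.Tendsto τ Filter.atTop Filter.atTop := by
    refine Filter.tendsto_atTop_mono' _ ?_ (Filter.tendsto_id.const_mul_atTop hδ)
    filter_upwards [Filter.eventually_ge_atTop 0] with u hu
    have := hmono hu
    simp only [hτ0, mul_zero, sub_zero, id] at this ⊢
    linarith
  have hbot : Filter.Tendsto τ Filter.atBot Filter.atBot := by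
    refine Filter.tendsto_atBot_mono' _ ?_ (Filter.tendsto_id.const_mul_atBot hδ)
    filter_upwards [Filter.eventually_le_atBot 0] with u hu
    have := hmono hu
    simp only [hτ0, mul_zero, sub_zero, id] at this ⊢
    linarith
  have hsurj := hcont.surjective htop hbot
  set e := hstrict.orderIsoOfSurjective τ hsurj with he
  have hsymm : ∀ t, τ (e.symm t) = t := fun t => e.apply_symm_apply t
  refine ⟨e.symm, ?_, e.symm.strictMono, e.symm.tendsto_atTop, fun t => ?_⟩
  · apply hstrict.injective; rw [hsymm, hτ0]
  · exact HasDerivAt.of_local_left_inverse e.symm.continuous.continuousAt (hd _)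
      (hδ.trans_le (hfδ _)).ne' (Filter.Eventually.of_forall hsymm)

/-- The reduced flow: global solution of the system satisfied by the components of a left-invariant
metric, where `C₀ ρ(t)` is the off-diagonal component and `N = |C₀|²`. -/
theorem exists_reduced_flow {R m A₀ B₀ N : ℝ} (hR : 0 < R) (hm : 0 < m) (hA₀ : 0 < A₀)
    (hB₀ : 0 < B₀) (hN : 0 ≤ N) (hN' : N < A₀ * B₀) :
    ∃ A B ρ : ℝ → ℝ, A 0 = A₀ ∧ B 0 = B₀ ∧ ρ 0 = 1 ∧ (∀ t, 0 < A t ∧ 0 < B t ∧ 0 < ρ t) ∧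
      (∀ t ≥ 0, N * ρ t ^ 2 < A t * B t) ∧
      Filter.Tendsto (fun t => N * ρ t ^ 2 / (A t * B t)) Filter.atTop (nhds 0) ∧
      (∀ t ≥ 0,
        HasDerivAt A (-(R * (A t ^ 2 * (N * ρ t ^ 2)) / (A t * B t - N * ρ t ^ 2) ^ 2)) t ∧
        HasDerivAt ρ (-(R * (A t ^ 2 * B t * ρ t) / (A t * B t - N * ρ t ^ 2) ^ 2)) t ∧
        HasDerivAt B (m - R * (N * ρ t ^ 2) ^ 2 / (A t * B t - N * ρ t ^ 2) ^ 2) t) := by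
  -- Along a solution h = Nρ²/(AB) obeys h' = -h q/B, because 2 - h - h² = (2+h)(1-h). So h =
  -- h₀e^{-σ} in the time σ with σ' = q/B, and the solution is built backwards from this.
  set h₀ : ℝ := N / (A₀ * B₀) with hh₀
  have hAB : 0 < A₀ * B₀ := mul_pos hA₀ hB₀
  have h₀0 : 0 ≤ h₀ := div_nonneg hN hAB.le
  have h₀1 : h₀ < 1 := (div_lt_one hAB).2 hN'
  -- Only s ≥ 0 matters; freezing h for negative s keeps h ≤ h₀ < 1, so that the following functions
  -- are continuous on the whole line.
  set h : ℝ → ℝ := fun s => h₀ * Real.exp (-max s 0) with hh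
  have hcont : Continuous h := by fun_prop
  have hnn : ∀ s, 0 ≤ h s := fun s => mul_nonneg h₀0 (Real.exp_pos _).le
  have hle : ∀ s, h s ≤ h₀ := fun s =>
    mul_le_of_le_one_right h₀0 (Real.exp_le_one_iff.2 (by simp))
  have h1 : ∀ s, 0 < 1 - h s := fun s => by linarith [hle s]
  set q : ℝ → ℝ := fun s => R * (2 + h s) / (1 - h s) + m with hq
  have hqm : ∀ s, m ≤ q s := fun s => by
    have := hnn s; have := h1 s
    have : 0 ≤ R * (2 + h s) / (1 - h s) := by positivity
    simp only [hq]; linarith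
  have hqpos : ∀ s, 0 < q s := fun s => hm.trans_le (hqm s)
  have hqc : Continuous q := by
    refine (Continuous.div (by fun_prop) (by fun_prop) fun s => (h1 s).ne').add continuous_const
  have hqle : ∀ s, q s ≤ R * 3 / (1 - h₀) + m := fun s => by
    have := hle s; have h1' := h1 s
    have : R * (2 + h s) / (1 - h s) ≤ R * 3 / (1 - h₀) := by
      apply div_le_div₀ (by positivity) _ (by linarith) (by linarith)
      nlinarith
    simp only [hq]; linarith
  -- These are d(log A)/dσ and d(log B)/dσ, obtained on dividing A'/A and B'/B by q/B.
  set α : ℝ → ℝ := fun s => -(R * h s / (1 - h s) ^ 2) / q s with hα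
  set β : ℝ → ℝ := fun s => (m - R * h s ^ 2 / (1 - h s) ^ 2) / q s with hβ
  have hαc : Continuous α := by
    refine Continuous.div (Continuous.neg (Continuous.div (by fun_prop) (by fun_prop) fun s => ?_))
      hqc fun s => (hqpos s).ne'
    exact pow_ne_zero _ (h1 s).ne'
  have hβc : Continuous β := by
    refine Continuous.div (continuous_const.sub (Continuous.div (by fun_prop) (by fun_prop)
      fun s => ?_)) hqc fun s => (hqpos s).ne'
    exact pow_ne_zero _ (h1 s).ne'
  set IA : ℝ → ℝ := fun u => ∫ s in (0 : ℝ)..u, α s with hIA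
  set IB : ℝ → ℝ := fun u => ∫ s in (0 : ℝ)..u, β s with hIB
  have dIA : ∀ u, HasDerivAt IA (α u) u := fun u => (hαc.integral_hasStrictDerivAt 0 u).hasDerivAt
  have dIB : ∀ u, HasDerivAt IB (β u) u := fun u => (hβc.integral_hasStrictDerivAt 0 u).hasDerivAt
  have IA0 : IA 0 = 0 := by simp [hIA]
  have IB0 : IB 0 = 0 := by simp [hIB]
  have hIBc : Continuous IB := continuous_iff_continuousAt.2 fun u => (dIB u).continuousAt
  -- The negative part of β is at most K h, by h² ≤ h₀h and q ≥ m. As h decays exponentially in s,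
  -- its integral is finite and log B stays bounded below.
  set K : ℝ := R * h₀ / (1 - h₀) ^ 2 / m with hK
  have hβK : ∀ s, 0 ≤ s → -(K * (h₀ * Real.exp (-s))) ≤ β s := fun s hs => by
    have e : h₀ * Real.exp (-s) = h s := by simp only [hh, max_eq_left hs]
    rw [e]
    have := hle s; have := hnn s; have h1' := h1 s; have := hqm s; have hq' := hqpos s
    have h2 : R * h s ^ 2 / (1 - h s) ^ 2 ≤ R * h₀ / (1 - h₀) ^ 2 * h s := by
      have : R * h s ^ 2 / (1 - h s) ^ 2 ≤ R * (h₀ * h s) / (1 - h₀) ^ 2 := by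
        apply div_le_div₀ (by positivity) _ (by nlinarith) (by gcongr)
        rw [sq]; gcongr
      calc _ ≤ _ := this
        _ = _ := by ring
    have h3 : (0 : ℝ) ≤ R * h s ^ 2 / (1 - h s) ^ 2 := by positivity
    calc -(K * h s) = -(R * h₀ / (1 - h₀) ^ 2 * h s) / m := by rw [hK]; ring
      _ ≤ -(R * h s ^ 2 / (1 - h s) ^ 2) / m := by gcongr
      _ ≤ -(R * h s ^ 2 / (1 - h s) ^ 2) / q s := by
        rw [neg_div, neg_div]; gcongr
      _ ≤ β s := by simp only [hβ]; gcongr; linarith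
  have hIBK : ∀ u, 0 ≤ u → -(K * h₀) ≤ IB u := by
    have hd' : ∀ u, HasDerivAt (fun u => IB u - K * h₀ * Real.exp (-u))
        (β u + K * (h₀ * Real.exp (-u))) u := fun u => by
      have := (dIB u).sub (((hasDerivAt_neg u).exp).const_mul (K * h₀))
      exact this.congr_deriv (by ring)
    have hmono : MonotoneOn (fun u => IB u - K * h₀ * Real.exp (-u)) (Set.Ici 0) := by
      refine monotoneOn_of_deriv_nonneg (convex_Ici 0)
        (fun u _ => (hd' u).continuousAt.continuousWithinAt)
        (fun u _ => (hd' u).differentiableAt.differentiableWithinAt) fun u hu => ?_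
      rw [interior_Ici] at hu
      rw [(hd' u).deriv]
      linarith [hβK u (le_of_lt hu)]
    intro u hu
    have := hmono Set.self_mem_Ici hu hu
    simp only [IB0, neg_zero, Real.exp_zero, zero_sub, mul_one] at this
    have h1' : 0 ≤ K * h₀ * Real.exp (-u) := by
      have : 0 < 1 - h₀ := by linarith
      positivity
    linarith
  -- The speed is dt/dσ = B/q. The lower bound for log B and the upper bound for q keep it away from
  -- zero, so the original time runs to infinity only together with σ.
  obtain ⟨σ, σ0, σmono, σtop, σd⟩ := exists_time_change
    (f := fun s => B₀ * Real.exp (IB (max s 0)) / q s)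
    (Continuous.div (by fun_prop) hqc fun s => (hqpos s).ne')
    (δ := B₀ * Real.exp (-(K * h₀)) / (R * 3 / (1 - h₀) + m))
    (by have : 0 < 1 - h₀ := by linarith
        positivity)
    (fun s => by
      have := hqle s; have := hqpos s
      have := hIBK (max s 0) (le_max_right _ _)
      gcongr)
  -- The choice of ρ is forced by Nρ² = hAB when N is nonzero; the same formula also serves N = 0,
  -- where h vanishes.
  refine ⟨fun t => A₀ * Real.exp (IA (σ t)), fun t => B₀ * Real.exp (IB (σ t)),
    fun t => Real.exp ((IA (σ t) + IB (σ t) - σ t) / 2), by simp [σ0, IA0], by simp [σ0, IB0],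
    by simp [σ0, IA0, IB0], fun t => ⟨by positivity, by positivity, by positivity⟩, ?_⟩
  have hσ : ∀ t, 0 ≤ t → 0 ≤ σ t := fun t ht => by rw [← σ0]; exact σmono.monotone ht
  have hkey : ∀ t, 0 ≤ t → N * Real.exp ((IA (σ t) + IB (σ t) - σ t) / 2) ^ 2
      = h (σ t) * ((A₀ * Real.exp (IA (σ t))) * (B₀ * Real.exp (IB (σ t)))) := fun t ht => by
    simp only [hh, max_eq_left (hσ t ht)]
    rw [← Real.exp_nat_mul, hh₀]
    rw [show ((2 : ℕ) : ℝ) * ((IA (σ t) + IB (σ t) - σ t) / 2) = IA (σ t) + IB (σ t) + -σ t by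
      push_cast; ring, Real.exp_add, Real.exp_add]
    field_simp
  refine ⟨fun t ht => ?_, ?_, fun t ht => ?_⟩
  · rw [hkey t ht]
    have : 0 < (A₀ * Real.exp (IA (σ t))) * (B₀ * Real.exp (IB (σ t))) := by positivity
    have := h1 (σ t)
    nlinarith
  · have h2 : Filter.Tendsto (fun t => h₀ * Real.exp (-σ t)) Filter.atTop (nhds (h₀ * 0)) :=
      ((Real.tendsto_exp_atBot.comp
        (Filter.tendsto_neg_atTop_atBot.comp σtop))).const_mul h₀
    rw [mul_zero] at h2
    refine h2.congr' ?_
    filter_upwards [Filter.eventually_ge_atTop 0] with t ht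
    rw [hkey t ht, mul_div_assoc, div_self (by positivity), mul_one]
    simp only [hh, max_eq_left (hσ t ht)]
  · have hσt := hσ t ht
    have hd := σd t
    rw [max_eq_left hσt] at hd
    have hAt := (((dIA (σ t)).comp t hd).exp).const_mul A₀
    have hBt := (((dIB (σ t)).comp t hd).exp).const_mul B₀
    have hρt := ((((((dIA (σ t)).comp t hd).add ((dIB (σ t)).comp t hd)).sub hd)).div_const 2).exp
    rw [hkey t ht]
    simp only [Function.comp_apply, Pi.add_apply, Pi.sub_apply] at hAt hBt hρt
    have hkt := hkey t ht
    have e1 : 1 - h (σ t) ≠ 0 := (h1 _).ne'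
    have e2 : q (σ t) ≠ 0 := (hqpos _).ne'
    have e2' : q (σ t) * (1 - h (σ t)) = R * (2 + h (σ t)) + m * (1 - h (σ t)) := by
      simp only [hq]; field_simp
    simp only [hα, hβ] at hAt hBt hρt
    generalize h (σ t) = H at *
    generalize q (σ t) = Q at *
    have e3 : (A₀ * Real.exp (IA (σ t))) * (B₀ * Real.exp (IB (σ t))) -
        H * ((A₀ * Real.exp (IA (σ t))) * (B₀ * Real.exp (IB (σ t)))) =
        (1 - H) * ((A₀ * Real.exp (IA (σ t))) * (B₀ * Real.exp (IB (σ t)))) := by ring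
    refine ⟨hAt.congr_deriv ?_, hρt.congr_deriv ?_, hBt.congr_deriv ?_⟩
    · rw [e3]
      field_simp
    · rw [e3]
      have : Real.exp (IA (σ t)) ≠ 0 := (Real.exp_pos _).ne'
      field_simp
      linear_combination (-(1 - H)) * e2'
    · rw [e3]
      field_simp

end InoueHCF

/-! ### The flow on Hermitian 2 × 2 matrices -/

namespace InoueHCF

open scoped ContDiff ComplexConjugate ComplexOrder Matrix

/-- The Hermitian `2 × 2` matrix with diagonal `A`, `B` and upper right entry `C`. -/
noncomputable def hermMatrix (A B : ℝ) (C : ℂ) : Matrix (Fin 2) (Fin 2) ℂ :=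
  !![(A : ℂ), C; conj C, (B : ℂ)]

@[simp] theorem hermMatrix_00 (A B : ℝ) (C : ℂ) : hermMatrix A B C 0 0 = A := rfl
@[simp] theorem hermMatrix_01 (A B : ℝ) (C : ℂ) : hermMatrix A B C 0 1 = C := rfl
@[simp] theorem hermMatrix_10 (A B : ℝ) (C : ℂ) : hermMatrix A B C 1 0 = conj C := rfl
@[simp] theorem hermMatrix_11 (A B : ℝ) (C : ℂ) : hermMatrix A B C 1 1 = B := rfl

/-- The Hermitian form of `hermMatrix A B C` on `(ξ, η)`. -/
noncomputable def hermForm (A B : ℝ) (C ξ η : ℂ) : ℝ :=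
  A * Complex.normSq ξ + B * Complex.normSq η + 2 * (C * ξ * conj η).re

/-- Completing the square in ξ. Besides positivity, this gives the Schur-complement lower bounds for
lengths. -/
theorem mul_hermForm (A B : ℝ) (C ξ η : ℂ) : A * hermForm A B C ξ η =
    Complex.normSq (A * ξ + conj C * η) + (A * B - Complex.normSq C) * Complex.normSq η := by
  simp [hermForm, Complex.normSq_apply]
  ring

theorem mul_hermForm' (A B : ℝ) (C ξ η : ℂ) : B * hermForm A B C ξ η =
    Complex.normSq (C * ξ + B * η) + (A * B - Complex.normSq C) * Complex.normSq ξ := by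
  simp [hermForm, Complex.normSq_apply]
  ring

theorem hermForm_pos {A B : ℝ} {C : ℂ} (hA : 0 < A) (hC : Complex.normSq C < A * B) {ξ η : ℂ}
    (h : ξ ≠ 0 ∨ η ≠ 0) : 0 < hermForm A B C ξ η := by
  have h1 := mul_hermForm A B C ξ η
  refine pos_of_mul_pos_right (a := A) ?_ hA.le
  rw [h1]
  by_cases hη : η = 0
  · have hξ : ξ ≠ 0 := h.resolve_right (not_not.2 hη)
    have hξ' := Complex.normSq_pos.2 hξ
    simp only [hη, mul_zero, add_zero, map_mul, Complex.normSq_ofReal, map_zero]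
    positivity
  · have h2 := Complex.normSq_pos.2 hη
    have h3 := Complex.normSq_nonneg (A * ξ + conj C * η)
    have : 0 < (A * B - Complex.normSq C) * Complex.normSq η := mul_pos (by linarith) h2
    linarith

theorem posDef_hermMatrix {A B : ℝ} {C : ℂ} (hA : 0 < A) (hC : Complex.normSq C < A * B) :
    (hermMatrix A B C).PosDef := by
  refine Matrix.PosDef.of_dotProduct_mulVec_pos ?_ fun x hx => ?_
  · ext i j
    fin_cases i <;> fin_cases j <;> simp [Matrix.conjTranspose_apply]
  · have h1 : star x ⬝ᵥ (hermMatrix A B C *ᵥ x)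
        = ((hermForm A B C (conj (x 0)) (conj (x 1)) : ℝ) : ℂ) := by
      apply Complex.ext
      · simp [dotProduct, Matrix.mulVec, Fin.sum_univ_two, hermForm, Complex.normSq_apply]
        ring
      · simp [dotProduct, Matrix.mulVec, Fin.sum_univ_two]
        ring
    rw [h1]
    have : conj (x 0) ≠ 0 ∨ conj (x 1) ≠ 0 := by
      by_contra! h0
      apply hx
      ext i
      fin_cases i
      · simpa using h0.1
      · simpa using h0.2
    exact_mod_cast hermForm_pos hA hC this

theorem PosDef.eq_hermMatrix {G : Matrix (Fin 2) (Fin 2) ℂ} (hG : G.PosDef) :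
    G = hermMatrix (G 0 0).re (G 1 1).re (G 0 1) ∧ 0 < (G 0 0).re ∧ 0 < (G 1 1).re ∧
      Complex.normSq (G 0 1) < (G 0 0).re * (G 1 1).re := by
  have h0 := Complex.lt_def.1 (hG.diag_pos (i := 0))
  have h1 := Complex.lt_def.1 (hG.diag_pos (i := 1))
  have h2 := hG.1.apply 1 0
  have heq : G = hermMatrix (G 0 0).re (G 1 1).re (G 0 1) := by
    ext i j
    fin_cases i <;> fin_cases j
    · exact Complex.ext (by simp) (by simpa using h0.2.symm)
    · rfl
    · exact h2.symm
    · exact Complex.ext (by simp) (by simpa using h1.2.symm)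
  refine ⟨heq, by simpa using h0.1, by simpa using h1.1, ?_⟩
  have h3 := (Complex.lt_def.1 hG.det_pos).1
  rw [Matrix.det_fin_two, heq] at h3
  simp [Complex.normSq_apply] at h3 ⊢
  linarith

theorem det_hermMatrix (A B : ℝ) (C : ℂ) :
    (hermMatrix A B C).det = ((A * B - Complex.normSq C : ℝ) : ℂ) := by
  rw [Matrix.det_fin_two]
  simp [Complex.mul_conj]

/-- The coefficient `2a²(9/4 + b²/(4a²))` of the reduced flow. -/
noncomputable def flowCoeff (a b : ℝ) : ℝ := 2 * a ^ 2 * (9 / 4 + (b / (2 * a)) ^ 2)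

theorem flowCoeff_pos {a : ℝ} (ha : 0 < a) (b : ℝ) : 0 < flowCoeff a b := by
  unfold flowCoeff; positivity

/-- The off-diagonal entry is a real multiple of C, so C keeps its phase along the flow and the ODE
involves only A, B and the real factor ρ. -/
theorem smul_reducedHcf_hermMatrix (a b A B : ℝ) (C : ℂ) :
    (2 * a ^ 2 : ℂ) • reducedHcf a b (hermMatrix A B C) = hermMatrix
      (flowCoeff a b * (A ^ 2 * Complex.normSq C) / (A * B - Complex.normSq C) ^ 2)
      (flowCoeff a b * Complex.normSq C ^ 2 / (A * B - Complex.normSq C) ^ 2 - 4 * a ^ 2)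
      ((flowCoeff a b * (A ^ 2 * B) / (A * B - Complex.normSq C) ^ 2 : ℝ) * C) := by
  ext i j
  fin_cases i <;> fin_cases j <;>
    simp [reducedHcf, det_hermMatrix, Complex.mul_conj, flowCoeff, map_ofNat] <;> ring

/-- The mean value inequality for f(t) - lt beyond a time S after which f' is within ε/2 of l; the
value at S becomes negligible after division by t. -/
theorem tendsto_div_of_tendsto_deriv {f f' : ℝ → ℝ} {l : ℝ} (hf : ∀ t ≥ 0, HasDerivAt f (f' t) t)
    (hl : Filter.Tendsto f' Filter.atTop (nhds l)) :
    Filter.Tendsto (fun t => f t / t) Filter.atTop (nhds l) := by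
  rw [Metric.tendsto_nhds]
  intro ε hε
  obtain ⟨T, hT⟩ := Filter.eventually_atTop.1 (Metric.tendsto_nhds.1 hl (ε / 2) (half_pos hε))
  set S := max T 1 with hS
  have hS1 : 1 ≤ S := le_max_right _ _
  have h1 : Filter.Tendsto (fun t : ℝ => |f S - l * S| / t) Filter.atTop (nhds 0) :=
    Filter.Tendsto.const_div_atTop Filter.tendsto_id _
  filter_upwards [Filter.eventually_ge_atTop S,
    h1.eventually (gt_mem_nhds (half_pos hε))] with t ht ht2
  have ht0 : 0 < t := by linarith
  have h2 : ‖(f t - l * t) - (f S - l * S)‖ ≤ ε / 2 * ‖t - S‖ := by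
    refine (convex_Ici S).norm_image_sub_le_of_norm_hasDerivWithin_le
      (f := fun s => f s - l * s) (f' := fun s => f' s - l) (fun s hs => ?_) (fun s hs => ?_)
      Set.self_mem_Ici ht
    · have hs' : S ≤ s := hs
      exact (((hf s (by linarith)).sub ((hasDerivAt_id s).const_mul l)).congr_deriv
        (by rw [mul_one])).hasDerivWithinAt
    · have := hT s ((le_max_left _ _).trans hs)
      rw [Real.dist_eq] at this
      exact this.le
  rw [Real.norm_eq_abs, Real.norm_eq_abs, abs_of_nonneg (sub_nonneg.2 ht)] at h2
  rw [Real.dist_eq]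
  have h3 : |f t - l * t| < ε * t := by
    have h4 : |f t - l * t| ≤ |(f t - l * t) - (f S - l * S)| + |f S - l * S| := by
      simpa using abs_add_le ((f t - l * t) - (f S - l * S)) (f S - l * S)
    rw [div_lt_iff₀ ht0] at ht2
    nlinarith
  have h5 : f t / t - l = (f t - l * t) / t := by field_simp
  rw [h5, abs_div, abs_of_pos ht0, div_lt_iff₀ ht0]
  exact h3

/-- Long-time existence and asymptotics for the components of a left-invariant metric evolving
under the flow. -/
theorem exists_flow {a : ℝ} (ha : 0 < a) (b : ℝ) {G₀ : Matrix (Fin 2) (Fin 2) ℂ}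
    (hG₀ : G₀.PosDef) : ∃ G : ℝ → Matrix (Fin 2) (Fin 2) ℂ, G 0 = G₀ ∧
      (∀ t ≥ 0, (G t).PosDef) ∧
      (∀ t ≥ 0, ∀ i j, HasDerivAt (fun s => G s i j)
        (-((2 * a ^ 2 : ℂ) • reducedHcf a b (G t)) i j) t) ∧
      Filter.Tendsto (fun t => (G t 1 1).re / t) Filter.atTop (nhds (4 * a ^ 2)) ∧
      Filter.Tendsto (fun t => Complex.normSq (G t 0 1) / ((G t 0 0).re * (G t 1 1).re))
        Filter.atTop (nhds 0) ∧
      (∀ t ≥ 0, (G t 0 0).re ≤ (G₀ 0 0).re) ∧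
      (G₀ 0 1 ≠ 0 → StrictAntiOn (fun t => (G t 0 0).re) (Set.Ici 0) ∧
        StrictAntiOn (fun t => Complex.normSq (G t 0 1)) (Set.Ici 0)) ∧
      (G₀ 0 1 = 0 → ∀ t ≥ 0, (G t 0 0).re = (G₀ 0 0).re ∧ G t 0 1 = 0) := by
  obtain ⟨heq, hA₀, hB₀, hN⟩ := PosDef.eq_hermMatrix hG₀
  have hR := flowCoeff_pos ha b
  obtain ⟨A, B, ρ, A0, B0, ρ0, hpos, hlt, hlim, hder⟩ := exists_reduced_flow hR
    (by positivity : 0 < 4 * a ^ 2) hA₀ hB₀ (Complex.normSq_nonneg (G₀ 0 1)) hN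
  have hnsq : ∀ t, Complex.normSq ((ρ t : ℂ) * G₀ 0 1) = Complex.normSq (G₀ 0 1) * ρ t ^ 2 :=
    fun t => by rw [Complex.normSq_mul, Complex.normSq_ofReal]; ring
  have hAanti : AntitoneOn A (Set.Ici 0) := by
    refine antitoneOn_of_deriv_nonpos (convex_Ici 0)
      (fun t ht => (hder t ht).1.continuousAt.continuousWithinAt)
      (fun t ht => (hder t (interior_subset ht)).1.differentiableAt.differentiableWithinAt)
      fun t ht => ?_
    rw [(hder t (interior_subset ht)).1.deriv]
    have := Complex.normSq_nonneg (G₀ 0 1)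
    have : 0 ≤ flowCoeff a b * (A t ^ 2 * (Complex.normSq (G₀ 0 1) * ρ t ^ 2)) /
      (A t * B t - Complex.normSq (G₀ 0 1) * ρ t ^ 2) ^ 2 := by positivity
    linarith
  refine ⟨fun t => hermMatrix (A t) (B t) (ρ t * G₀ 0 1), ?_, fun t ht => ?_, fun t ht => ?_,
    ?_, ?_, fun t ht => ?_, fun h0 => ⟨?_, ?_⟩, fun h0 t ht => ⟨?_, ?_⟩⟩
  · simp only [A0, B0, ρ0, Complex.ofReal_one, one_mul]
    exact heq.symm
  · exact posDef_hermMatrix (hpos t).1 (by rw [hnsq]; exact hlt t ht)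
  · obtain ⟨h1, h2, h3⟩ := hder t ht
    rw [smul_reducedHcf_hermMatrix]
    simp only [hnsq]
    have h2' : HasDerivAt (fun s => (ρ s : ℂ) * G₀ 0 1) (-(((flowCoeff a b * (A t ^ 2 * B t) /
        (A t * B t - Complex.normSq (G₀ 0 1) * ρ t ^ 2) ^ 2 : ℝ) : ℂ) * (ρ t * G₀ 0 1))) t := by
      refine (h2.ofReal_comp.mul_const (G₀ 0 1)).congr_deriv ?_
      push_cast; ring
    intro i j
    fin_cases i <;> fin_cases j
    · exact h1.ofReal_comp.congr_deriv (by simp)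
    · exact h2'
    · exact (Complex.conjCLE.toContinuousLinearMap.hasFDerivAt.comp_hasDerivAt t h2').congr_deriv
        (by simp)
    · exact h3.ofReal_comp.congr_deriv (by simp)
  · refine tendsto_div_of_tendsto_deriv (fun t ht => (hder t ht).2.2) ?_
    -- B' depends on the components only through h, which tends to zero.
    have h1 : Filter.Tendsto (fun t => 4 * a ^ 2 - flowCoeff a b *
        (Complex.normSq (G₀ 0 1) * ρ t ^ 2 / (A t * B t)) ^ 2 /
        (1 - Complex.normSq (G₀ 0 1) * ρ t ^ 2 / (A t * B t)) ^ 2) Filter.atTop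
        (nhds (4 * a ^ 2 - flowCoeff a b * 0 ^ 2 / (1 - 0) ^ 2)) :=
      tendsto_const_nhds.sub (((hlim.pow 2).const_mul _).div ((tendsto_const_nhds.sub hlim).pow 2)
        (by norm_num))
    simp only [ne_eq, OfNat.ofNat_ne_zero, not_false_eq_true, zero_pow, mul_zero, zero_div,
      sub_zero] at h1
    refine h1.congr' ?_
    filter_upwards [Filter.eventually_ge_atTop 0] with t ht
    have := (hpos t).1; have := (hpos t).2.1
    have h4 : A t * B t - Complex.normSq (G₀ 0 1) * ρ t ^ 2 ≠ 0 := by linarith [hlt t ht]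
    have h5 : 1 - Complex.normSq (G₀ 0 1) * ρ t ^ 2 / (A t * B t)
        = (A t * B t - Complex.normSq (G₀ 0 1) * ρ t ^ 2) / (A t * B t) := by field_simp
    rw [h5]
    field_simp
  · simpa [hnsq] using hlim
  · simpa [A0] using hAanti Set.self_mem_Ici ht ht
  · have hN0 := Complex.normSq_pos.2 h0
    simp only [hermMatrix_00, Complex.ofReal_re]
    refine strictAntiOn_of_deriv_neg (convex_Ici 0)
      (fun t ht => (hder t ht).1.continuousAt.continuousWithinAt) fun t ht => ?_
    rw [(hder t (interior_subset ht)).1.deriv]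
    have h1 := hlt t (interior_subset ht)
    have h2 := (hpos t).1; have h3 := (hpos t).2.2
    have h4 : 0 < A t * B t - Complex.normSq (G₀ 0 1) * ρ t ^ 2 := by linarith
    have : 0 < flowCoeff a b * (A t ^ 2 * (Complex.normSq (G₀ 0 1) * ρ t ^ 2)) /
      (A t * B t - Complex.normSq (G₀ 0 1) * ρ t ^ 2) ^ 2 := by positivity
    linarith
  · have hN0 := Complex.normSq_pos.2 h0
    simp only [hermMatrix_01, hnsq]
    have hρ : StrictAntiOn ρ (Set.Ici 0) := by
      refine strictAntiOn_of_deriv_neg (convex_Ici 0)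
        (fun t ht => (hder t ht).2.1.continuousAt.continuousWithinAt) fun t ht => ?_
      rw [(hder t (interior_subset ht)).2.1.deriv]
      have h1 := hlt t (interior_subset ht)
      have h2 := (hpos t).1; have h3 := (hpos t).2.2; have := (hpos t).2.1
      have h4 : 0 < A t * B t - Complex.normSq (G₀ 0 1) * ρ t ^ 2 := by linarith
      have : 0 < flowCoeff a b * (A t ^ 2 * B t * ρ t) /
        (A t * B t - Complex.normSq (G₀ 0 1) * ρ t ^ 2) ^ 2 := by positivity
      linarith
    intro s hs t ht hst
    have := hρ hs ht hst
    have := (hpos t).2.2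
    change _ * _ < _ * _
    gcongr
  · simp only [hermMatrix_00, Complex.ofReal_re]
    have hd : ∀ s ∈ Set.Icc 0 t, HasDerivWithinAt A 0 (Set.Icc 0 t) s := fun s hs => by
      have := (hder s hs.1).1
      simp only [h0, map_zero, zero_mul, mul_zero, zero_div, neg_zero] at this
      exact this.hasDerivWithinAt
    have := (convex_Icc 0 t).norm_image_sub_le_of_norm_hasDerivWithin_le (C := 0) hd
      (fun s _ => by simp) (Set.left_mem_Icc.2 ht) (Set.right_mem_Icc.2 ht)
    rw [zero_mul, norm_le_zero_iff, sub_eq_zero] at this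
    rw [this, A0]
  · simp [h0]

end InoueHCF

/-! ### Locally homogeneous solutions and their uniqueness -/

namespace InoueHCF

open scoped ContDiff ComplexConjugate ComplexOrder Matrix

theorem isLocHomHCFSolution_invField {a b : ℝ} (ha : 0 < a) {I : Set ℝ}
    {G : ℝ → Matrix (Fin 2) (Fin 2) ℂ} (hG : ∀ t ∈ I, (G t).PosDef)
    (hd : ∀ t ∈ I, ∀ i j, HasDerivAt (fun s => G s i j)
      (-((2 * a ^ 2 : ℂ) • reducedHcf a b (G t)) i j) t) :
    IsLocHomHCFSolution a b I fun t => invField a b (G t) := by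
  refine ⟨⟨fun t ht => isHermitianMetricOn_invField ha (hG t ht), fun t ht p hp i j => ?_⟩,
    fun t _ => isLeftInvariant_invField ha _⟩
  rw [hcfTensor_invField_eq ha (hG t ht) hp, invField_apply]
  simp only [invField_apply]
  exact ((hd t ht i j).const_mul _).hasDerivWithinAt.congr_deriv (by rw [mul_neg])

/-- The vector field of the flow on the components of left-invariant metrics. -/
noncomputable def flowField (a b : ℝ) (G : Fin 2 → Fin 2 → ℂ) : Fin 2 → Fin 2 → ℂ :=
  fun i j => -((2 * a ^ 2 : ℂ) • reducedHcf a b (Matrix.of G)) i j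

/-- Since `reducedHcf` uses the product of the two off-diagonal entries instead of |C|², the field
is a rational function of four independent complex variables. -/
theorem contDiffAt_flowField (a b : ℝ) {G : Fin 2 → Fin 2 → ℂ} (hG : (Matrix.of G).det ≠ 0) :
    ContDiffAt ℂ 1 (flowField a b) G := by
  rw [Matrix.det_fin_two] at hG
  simp only [Matrix.of_apply] at hG
  refine contDiffAt_pi.2 fun i => contDiffAt_pi.2 fun j => ?_
  have hc : ∀ k l, ContDiffAt ℂ 1 (fun H : Fin 2 → Fin 2 → ℂ => H k l) G := fun k l => by fun_prop
  have hdet : ContDiffAt ℂ 1 (fun H : Fin 2 → Fin 2 → ℂ =>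
      (H 0 0 * H 1 1 - H 0 1 * H 1 0) ^ 2) G := by fun_prop
  have hne : (G 0 0 * G 1 1 - G 0 1 * G 1 0) ^ 2 ≠ 0 := pow_ne_zero 2 hG
  fin_cases i <;> fin_cases j <;>
    simp only [flowField, reducedHcf, Matrix.smul_apply, Matrix.of_apply, Matrix.cons_val',
      Matrix.cons_val_zero, Matrix.cons_val_one, Matrix.cons_val_fin_one, smul_eq_mul, Fin.zero_eta,
      Fin.mk_one, Matrix.det_fin_two, Fin.isValue]
  · refine ContDiffAt.neg (contDiffAt_const.mul (ContDiffAt.div ?_ hdet hne)); fun_prop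
  · refine ContDiffAt.neg (contDiffAt_const.mul (ContDiffAt.div ?_ hdet hne)); fun_prop
  · refine ContDiffAt.neg (contDiffAt_const.mul (ContDiffAt.div ?_ hdet hne)); fun_prop
  · refine ContDiffAt.neg (contDiffAt_const.mul
      ((ContDiffAt.div ?_ hdet hne).sub contDiffAt_const))
    fun_prop

/-- The components of a family of metrics at the base point. -/
noncomputable def baseComponents (a : ℝ) (g : ℝ → MetricField 2) (s : ℝ) : Fin 2 → Fin 2 → ℂ :=
  fun i j => g s (basePoint a) i j

/-- Invariance turns the evolution equation into an autonomous ODE at the base point, for any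
locally homogeneous solution and not only for those of the form `invField`. -/
theorem hasDerivWithinAt_basePoint {a b : ℝ} (ha : 0 < a) {I : Set ℝ} {g : ℝ → MetricField 2}
    (hg : IsLocHomHCFSolution a b I g) {t : ℝ} (ht : t ∈ I) :
    HasDerivWithinAt (baseComponents a g) (flowField a b (baseComponents a g t)) I t := by
  have hb := basePoint_mem ha
  refine hasDerivWithinAt_pi.2 fun i => hasDerivWithinAt_pi.2 fun j => ?_
  have h := hg.1.2 t ht _ hb i j
  rw [hcfTensor_congr isOpen_halfSpace ((hg.2 t ht).eqOn_invField ha) hb,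
    hcfTensor_invField_eq ha ((hg.1.1 t ht).2 _ hb) hb, invField_basePoint ha] at h
  exact h

/-- Uniqueness of locally homogeneous solutions. -/
theorem IsLocHomHCFSolution.eqOn {a b : ℝ} (ha : 0 < a) {T : ℝ} {g g' : ℝ → MetricField 2}
    (hg : IsLocHomHCFSolution a b (Set.Ico 0 T) g)
    (hg' : IsLocHomHCFSolution a b (Set.Ico 0 T) g')
    (h0 : Set.EqOn (g' 0) (g 0) halfSpace) {t : ℝ} (ht : t ∈ Set.Ico 0 T) :
    Set.EqOn (g' t) (g t) halfSpace := by
  have hb := basePoint_mem ha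
  have key : g' t (basePoint a) = g t (basePoint a) := by
    have hsub : Set.Icc 0 t ⊆ Set.Ico 0 T := Set.Icc_subset_Ico_right ht.2
    have hcont : ∀ {f : ℝ → MetricField 2}, IsLocHomHCFSolution a b (Set.Ico 0 T) f →
        ContinuousOn (baseComponents a f) (Set.Icc 0 t) :=
      fun hf s hs => ((hasDerivWithinAt_basePoint ha hf (hsub hs)).continuousWithinAt).mono hsub
    have hder : ∀ {f : ℝ → MetricField 2}, IsLocHomHCFSolution a b (Set.Ico 0 T) f →
        ∀ s ∈ Set.Ico 0 t, HasDerivWithinAt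
          (baseComponents a f) (flowField a b (baseComponents a f s)) (Set.Ici s) s := fun hf s hs => by
      have hs' := hsub (Set.Ico_subset_Icc_self hs)
      refine (hasDerivWithinAt_basePoint ha hf hs').mono_of_mem_nhdsWithin ?_
      exact Filter.mem_of_superset (Ico_mem_nhdsGE hs'.2) (Set.Ico_subset_Ico_left hs'.1)
    -- The two trajectories up to time t form a compact set on which the determinant does not
    -- vanish, so local Lipschitz bounds become a uniform one.
    set K : Set (Fin 2 → Fin 2 → ℂ) := baseComponents a g '' Set.Icc 0 t ∪
      baseComponents a g' '' Set.Icc 0 t with hK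
    have hKc : IsCompact K :=
      (isCompact_Icc.image_of_continuousOn (hcont hg)).union
        (isCompact_Icc.image_of_continuousOn (hcont hg'))
    have hdet : ∀ H ∈ K, (Matrix.of H).det ≠ 0 := by
      rintro H (⟨s, hs, rfl⟩ | ⟨s, hs, rfl⟩)
      · exact ((Matrix.isUnit_iff_isUnit_det _).1
          ((hg.1.1 s (hsub hs)).2 _ hb).isUnit).ne_zero
      · exact ((Matrix.isUnit_iff_isUnit_det _).1
          ((hg'.1.1 s (hsub hs)).2 _ hb).isUnit).ne_zero
    have hloc : LocallyLipschitzOn K (flowField a b) := fun H hH => by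
      obtain ⟨k, s, hs, hl⟩ := (contDiffAt_flowField a b (hdet H hH)).exists_lipschitzOnWith
      exact ⟨k, s, mem_nhdsWithin_of_mem_nhds hs, hl⟩
    obtain ⟨k, hk⟩ := hloc.exists_lipschitzOnWith_of_compact hKc
    exact ODE_solution_unique_of_mem_Icc_right (v := fun _ => flowField a b) (s := fun _ => K)
      (fun _ _ => hk) (hcont hg') (hder hg')
      (fun s hs => Or.inr ⟨s, Set.Ico_subset_Icc_self hs, rfl⟩) (hcont hg) (hder hg)
      (fun s hs => Or.inl ⟨s, Set.Ico_subset_Icc_self hs, rfl⟩)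
      (funext fun i => funext fun j => congrFun (congrFun (h0 hb) i) j)
      (Set.right_mem_Icc.2 ht.1)
  intro p hp
  rw [(hg.2 t ht).eqOn_invField ha hp, (hg'.2 t ht).eqOn_invField ha hp, key]

theorem IsLocHomHCFSolution.mono {a b : ℝ} {I J : Set ℝ} {g : ℝ → MetricField 2}
    (hg : IsLocHomHCFSolution a b I g) (hJ : J ⊆ I) : IsLocHomHCFSolution a b J g :=
  ⟨⟨fun t ht => hg.1.1 t (hJ ht), fun t ht p hp i j => (hg.1.2 t (hJ ht) p hp i j).mono hJ⟩,
    fun t ht => hg.2 t (hJ ht)⟩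

end InoueHCF

/-! ### Integral combinations of eigenvectors and the characteristic cubic -/

namespace InoueHCF

open scoped ContDiff ComplexConjugate ComplexOrder Matrix

/-- The integral linear combination `∑ nᵢ wᵢ`. -/
def intDot {R : Type*} [CommRing R] (w : Fin 3 → R) (n : Fin 3 → ℤ) : R := ∑ i, (n i : R) * w i

section intDot

variable {R : Type*} [CommRing R] (w : Fin 3 → R)

@[simp] theorem intDot_zero : intDot w 0 = 0 := by simp [intDot]

theorem intDot_add (n m : Fin 3 → ℤ) : intDot w (n + m) = intDot w n + intDot w m := by
  simp [intDot, add_mul, Finset.sum_add_distrib]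

theorem intDot_neg (n : Fin 3 → ℤ) : intDot w (-n) = -intDot w n := by
  simp [intDot]

theorem intDot_sub (n m : Fin 3 → ℤ) : intDot w (n - m) = intDot w n - intDot w m := by
  rw [sub_eq_add_neg, intDot_add, intDot_neg, sub_eq_add_neg]

theorem intDot_smul (k : ℤ) (n : Fin 3 → ℤ) : intDot w (k • n) = k * intDot w n := by
  simp [intDot, Finset.mul_sum, mul_assoc]

theorem intDot_single (i : Fin 3) : intDot w (Pi.single i 1) = w i := by
  simp [intDot, Pi.single_apply]

variable {w}

/-- Multiplication by an eigenvalue preserves the group of integral combinations of the entries of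
an eigenvector: it acts on the coefficients by the matrix from the right. -/
theorem mul_intDot {B : Matrix (Fin 3) (Fin 3) ℤ} {c : R}
    (h : (B.map (fun m : ℤ => (m : R))) *ᵥ w = c • w) (n : Fin 3 → ℤ) :
    c * intDot w n = intDot w (n ᵥ* B) := by
  have h1 : ∀ i, c * w i = ∑ j, (B i j : R) * w j := fun i => by
    have := congrFun h i
    simpa [Matrix.mulVec, dotProduct] using this.symm
  simp only [intDot, Finset.mul_sum, mul_left_comm c, h1, Matrix.vecMul, dotProduct, Int.cast_sum,
    Int.cast_mul, Finset.sum_mul]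
  rw [Finset.sum_comm]
  exact Finset.sum_congr rfl fun i _ => Finset.sum_congr rfl fun j _ => by ring

theorem inv_mulVec_eq {A : Matrix.SpecialLinearGroup (Fin 3) ℤ} {c c' : R} (hc : c' * c = 1)
    (h : ((A : Matrix (Fin 3) (Fin 3) ℤ).map (fun m : ℤ => (m : R))) *ᵥ w = c • w) :
    (((A⁻¹ : Matrix.SpecialLinearGroup (Fin 3) ℤ) : Matrix (Fin 3) (Fin 3) ℤ).map
      (fun m : ℤ => (m : R))) *ᵥ w = c' • w := by
  have h1 : (((A⁻¹ : Matrix.SpecialLinearGroup (Fin 3) ℤ) : Matrix (Fin 3) (Fin 3) ℤ).map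
      (fun m : ℤ => (m : R))) * ((A : Matrix (Fin 3) (Fin 3) ℤ).map (fun m : ℤ => (m : R))) = 1 := by
    have h2 : ((A⁻¹ : Matrix.SpecialLinearGroup (Fin 3) ℤ) : Matrix (Fin 3) (Fin 3) ℤ) *
        (A : Matrix (Fin 3) (Fin 3) ℤ) = 1 := by
      rw [← Matrix.SpecialLinearGroup.coe_mul, inv_mul_cancel]; rfl
    have h3 := congrArg (fun M : Matrix (Fin 3) (Fin 3) ℤ => M.map (Int.castRingHom R)) h2
    rw [Matrix.map_mul] at h3
    exact h3.trans (Matrix.map_one _ (map_zero _) (map_one _))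
  calc _ = c' • ((((A⁻¹ : Matrix.SpecialLinearGroup (Fin 3) ℤ) : Matrix (Fin 3) (Fin 3) ℤ).map
      (fun m : ℤ => (m : R))) *ᵥ (c • w)) := by
        rw [Matrix.mulVec_smul, smul_smul, hc, one_smul]
    _ = _ := by rw [← h, Matrix.mulVec_mulVec, h1, Matrix.one_mulVec]

/-- An eigenvalue of a matrix in `SL(3, ℤ)` is a root of the characteristic polynomial. -/
theorem eigenvalue_cubic {R : Type*} [CommRing R] [IsDomain R]
    (A : Matrix.SpecialLinearGroup (Fin 3) ℤ) : ∃ t s : ℤ, ∀ (w : Fin 3 → R) (c : R), w ≠ 0 →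
      ((A : Matrix (Fin 3) (Fin 3) ℤ).map (fun m : ℤ => (m : R))) *ᵥ w = c • w →
      c ^ 3 - t * c ^ 2 + s * c - 1 = 0 := by
  set M : Matrix (Fin 3) (Fin 3) ℤ := (A : Matrix (Fin 3) (Fin 3) ℤ) with hM
  have hdet : M.det = 1 := A.det_coe
  refine ⟨M 0 0 + M 1 1 + M 2 2, M 0 0 * M 1 1 - M 0 1 * M 1 0 + M 0 0 * M 2 2 - M 0 2 * M 2 0 +
    M 1 1 * M 2 2 - M 1 2 * M 2 1, fun w c hw h => ?_⟩
  have h1 : (M.map (fun m : ℤ => (m : R)) - c • (1 : Matrix (Fin 3) (Fin 3) R)).det = 0 := by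
    rw [← Matrix.exists_mulVec_eq_zero_iff]
    exact ⟨w, hw, by rw [Matrix.sub_mulVec, h, Matrix.smul_mulVec, Matrix.one_mulVec, sub_self]⟩
  have h2 : (M.det : R) = 1 := by rw [hdet, Int.cast_one]
  rw [Matrix.det_fin_three] at h1 h2
  simp at h1
  push_cast at h2 ⊢
  linear_combination -h1 + h2

end intDot

/-- A real number of absolute value less than one is not a double root of the characteristic
polynomial of a matrix in `SL(3, ℤ)`. -/
theorem no_double_root {t s : ℤ} {l r : ℝ} (h : r ^ 2 * l = 1) (hr1 : |r| < 1)
    (hl : l ^ 3 - t * l ^ 2 + s * l - 1 = 0) (hr : r ^ 3 - t * r ^ 2 + s * r - 1 = 0) : False := by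
  have hr0 : r ≠ 0 := by rintro rfl; simp at h
  have hr2 : r ^ 2 < 1 := by
    rw [← sq_abs]; have := abs_nonneg r; nlinarith
  have hl1 : 1 < l := by
    have : 0 < r ^ 2 := by positivity
    nlinarith
  have hlr : l - r ≠ 0 := by
    have := le_abs_self r; linarith
  have e1 : l ^ 2 + l * r + r ^ 2 - t * (l + r) + s = 0 := by
    apply mul_left_cancel₀ hlr
    linear_combination hl - hr
  -- The third root is t - l - r. The product of the roots is 1 = r²l, so it equals r and r is a
  -- double root.
  have e2 : t - l - r = r := by
    have hlr' : l * r ≠ 0 := mul_ne_zero (by linarith) hr0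
    apply mul_left_cancel₀ hlr'
    linear_combination hr - r * e1 - h
  have et : t * r ^ 2 = 1 + 2 * r ^ 3 := by linear_combination r ^ 2 * e2 + h
  have es : s * r = 2 + r ^ 3 := by
    linear_combination r * e1 + r * (l + r) * e2 + 2 * h
  -- With p the cubic, this is r p'(r) - 3p(r) = 0. A second quadratic relation allows r² to be
  -- eliminated, as in the Euclidean algorithm for p and p', leaving a linear equation for r.
  have eq1 : t * r ^ 2 - 2 * s * r + 3 = 0 := by linear_combination et - 2 * es
  have eq2 : 2 * s * r ^ 2 - (3 + t * s) * r + 2 * t = 0 := by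
    linear_combination -r * eq1 - t * es
  have eq3 : ((4 * s ^ 2 - 3 * t - t ^ 2 * s : ℤ) : ℝ) * r = ((6 * s - 2 * t ^ 2 : ℤ) : ℝ) := by
    push_cast
    linear_combination t * eq2 - 2 * s * eq1
  -- If the linear equation degenerates, either t = s = 0, which contradicts the first quadratic
  -- relation, or p = (x-1)³ and r = 1. Otherwise r is rational and integral over ℤ, hence an
  -- integer, and |r| < 1 leaves only r = 0.
  by_cases hc : 4 * s ^ 2 - 3 * t - t ^ 2 * s = 0
  · rw [hc, Int.cast_zero, zero_mul, eq_comm, Int.cast_eq_zero] at eq3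
    have hs : 3 * s = t ^ 2 := by linarith
    have ht : t * ((t - 3) * (t ^ 2 + 3 * t + 9)) = 0 := by
      linear_combination 9 * hc - (12 * s + t ^ 2) * hs
    rcases mul_eq_zero.1 ht with h0 | h0
    · have hs0 : s = 0 := by rw [h0] at hs; linarith
      simp [h0, hs0] at eq1
    · rcases mul_eq_zero.1 h0 with h3 | h3
      · have ht3 : t = 3 := by linarith
        have hs3 : s = 3 := by rw [ht3] at hs; linarith
        rw [ht3, hs3] at hr
        have : (r - 1) ^ 3 = 0 := by push_cast at hr; linear_combination hr
        have h1 : r - 1 = 0 := pow_eq_zero_iff (by norm_num) |>.1 this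
        have := le_abs_self r
        linarith
      · nlinarith [sq_nonneg (2 * t + 3)]
  · have hc' : ((4 * s ^ 2 - 3 * t - t ^ 2 * s : ℤ) : ℝ) ≠ 0 := by exact_mod_cast hc
    set q : ℚ := ((6 * s - 2 * t ^ 2 : ℤ) : ℚ) / ((4 * s ^ 2 - 3 * t - t ^ 2 * s : ℤ) : ℚ) with hq
    have hqr : (q : ℝ) = r := by
      rw [hq, Rat.cast_div, Rat.cast_intCast, Rat.cast_intCast, ← eq3, mul_div_cancel_left₀ _ hc']
    have hq3 : q ^ 3 - t * q ^ 2 + s * q - 1 = 0 := by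
      rw [← hqr] at hr; exact_mod_cast hr
    have hint : IsIntegral ℤ q := by
      refine ⟨.X ^ 3 - .C t * .X ^ 2 + .C s * .X - .C 1, by monicity!, ?_⟩
      simp only [Polynomial.eval₂_sub, Polynomial.eval₂_add, Polynomial.eval₂_mul,
        Polynomial.eval₂_pow, Polynomial.eval₂_X, Polynomial.eval₂_C]
      simpa using hq3
    obtain ⟨k, hk⟩ := IsIntegrallyClosed.isIntegral_iff.1 hint
    have hkr : (k : ℝ) = r := by rw [← hqr, ← hk]; simp
    rw [← hkr] at hr1 hr0
    have : |k| < 1 := by exact_mod_cast hr1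
    rw [Int.abs_lt_one_iff] at this
    exact hr0 (by simp [this])

end InoueHCF

/-! ### The lattice of an Inoue surface -/

namespace InoueHCF

open scoped ComplexConjugate Matrix

/-- The data defining an Inoue surface of type `S⁰`. -/
structure IsInoueData (a b : ℝ) (A : Matrix.SpecialLinearGroup (Fin 3) ℤ) (v : Fin 3 → ℝ)
    (w : Fin 3 → ℂ) : Prop where
  pos : 0 < a
  v_ne : v ≠ 0
  w_ne : w ≠ 0
  mulVec_v : ((A : Matrix (Fin 3) (Fin 3) ℤ).map (fun m : ℤ => (m : ℝ))) *ᵥ v = Sol.lam a 1 • v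
  mulVec_w :
    ((A : Matrix (Fin 3) (Fin 3) ℤ).map (fun m : ℤ => (m : ℂ))) *ᵥ w = Sol.alpha a b 1 • w

namespace IsInoueData

variable {a b : ℝ} {A : Matrix.SpecialLinearGroup (Fin 3) ℤ} {v : Fin 3 → ℝ} {w : Fin 3 → ℂ}

theorem mulVec_ofReal_v (h : IsInoueData a b A v w) :
    ((A : Matrix (Fin 3) (Fin 3) ℤ).map (fun m : ℤ => (m : ℂ))) *ᵥ (fun i => (v i : ℂ))
      = (Sol.lam a 1 : ℂ) • fun i => (v i : ℂ) := by
  ext i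
  have := congrFun h.mulVec_v i
  simp only [Matrix.mulVec, dotProduct, Matrix.map_apply, Pi.smul_apply, smul_eq_mul] at this ⊢
  exact_mod_cast this

theorem mulVec_conj_w (h : IsInoueData a b A v w) :
    ((A : Matrix (Fin 3) (Fin 3) ℤ).map (fun m : ℤ => (m : ℂ))) *ᵥ (fun i => conj (w i))
      = conj (Sol.alpha a b 1) • fun i => conj (w i) := by
  ext i
  have := congrArg (starRingEnd ℂ) (congrFun h.mulVec_w i)
  simpa [Matrix.mulVec, dotProduct] using this

theorem norm_alpha (a b s : ℝ) : ‖Sol.alpha a b s‖ ^ 2 * Sol.lam a s = 1 := by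
  rw [Sol.alpha, Complex.norm_exp, Sol.lam, ← Real.exp_nat_mul, ← Real.exp_add]
  simp
  ring

theorem one_lt_lam (h : IsInoueData a b A v w) : 1 < Sol.lam a 1 := by
  rw [Sol.lam, mul_one, Real.one_lt_exp_iff]
  exact kappa_pos h.pos

theorem norm_alpha_lt (h : IsInoueData a b A v w) : ‖Sol.alpha a b 1‖ < 1 := by
  have h1 := norm_alpha a b 1
  have h2 := h.one_lt_lam
  by_contra! h3
  nlinarith [one_le_pow₀ h3 (n := 2)]

/-- A real α would satisfy α²λ = 1 and, like λ, be a root of the characteristic polynomial, hence a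
double root of absolute value less than one. -/
theorem alpha_im_ne_zero (h : IsInoueData a b A v w) : (Sol.alpha a b 1).im ≠ 0 := by
  intro him
  obtain ⟨t, s, hts⟩ := eigenvalue_cubic (R := ℂ) A
  have hα : Sol.alpha a b 1 = (((Sol.alpha a b 1).re : ℝ) : ℂ) := Complex.ext (by simp) (by simp [him])
  have h1 := hts _ _ h.w_ne h.mulVec_w
  have h2 := hts (fun i => (v i : ℂ)) _ (fun h0 => h.v_ne (funext fun i => by
    simpa using congrFun h0 i)) h.mulVec_ofReal_v
  have h3 := norm_alpha a b 1
  have h4 := h.norm_alpha_lt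
  rw [hα] at h1 h3 h4
  rw [Complex.norm_real, Real.norm_eq_abs] at h3 h4
  rw [sq_abs] at h3
  exact no_double_root (t := t) (s := s) h3 h4 (by exact_mod_cast h2) (by exact_mod_cast h1)

/-- As α is not real, λ, α and ᾱ are three distinct eigenvalues. -/
theorem linearIndependent (h : IsInoueData a b A v w) :
    LinearIndependent ℂ ![fun i => (v i : ℂ), w, fun i => conj (w i)] := by
  refine Module.End.eigenvectors_linearIndependent'
    (Matrix.mulVecLin ((A : Matrix (Fin 3) (Fin 3) ℤ).map (fun m : ℤ => (m : ℂ))))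
    ![(Sol.lam a 1 : ℂ), Sol.alpha a b 1, conj (Sol.alpha a b 1)] ?_ _ ?_
  · have h1 : (Sol.lam a 1 : ℂ) ≠ Sol.alpha a b 1 := fun h0 =>
      h.alpha_im_ne_zero (by rw [← h0, Complex.ofReal_im])
    have h2 : (Sol.lam a 1 : ℂ) ≠ conj (Sol.alpha a b 1) := fun h0 =>
      h.alpha_im_ne_zero (by
        have := congrArg Complex.im h0
        rw [Complex.ofReal_im, Complex.conj_im] at this; linarith)
    have h3 : Sol.alpha a b 1 ≠ conj (Sol.alpha a b 1) := fun h0 =>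
      h.alpha_im_ne_zero (by
        have := congrArg Complex.im h0
        rw [Complex.conj_im] at this; linarith)
    intro i j hij
    fin_cases i <;> fin_cases j <;> simp at hij ⊢
    exacts [h1 hij, h2 hij, h1 hij.symm, h3 hij, h2 hij.symm, h3 hij.symm]
  · intro i
    rw [Module.End.hasEigenvector_iff, Module.End.mem_eigenspace_iff]
    fin_cases i
    · exact ⟨h.mulVec_ofReal_v, fun h0 => h.v_ne (funext fun i => by simpa using congrFun h0 i)⟩
    · exact ⟨h.mulVec_w, h.w_ne⟩
    · exact ⟨h.mulVec_conj_w, fun h0 => h.w_ne (funext fun i => by simpa using congrFun h0 i)⟩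

end IsInoueData

/-- The real-linear map `x ↦ (∑ xᵢ wᵢ, ∑ xᵢ vᵢ)`. -/
noncomputable def latticeMap (v : Fin 3 → ℝ) (w : Fin 3 → ℂ) : (Fin 3 → ℝ) →ₗ[ℝ] ℂ × ℝ where
  toFun x := (∑ i, (x i : ℂ) * w i, ∑ i, x i * v i)
  map_add' x y := by simp [add_mul, Finset.sum_add_distrib]
  map_smul' c x := by simp [Finset.mul_sum, mul_assoc]

namespace IsInoueData

variable {a b : ℝ} {A : Matrix.SpecialLinearGroup (Fin 3) ℤ} {v : Fin 3 → ℝ} {w : Fin 3 → ℂ}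

/-- For real coefficients, annihilating w means annihilating w̄ as well, so the independence of v, w
and w̄ applies. -/
theorem ker_latticeMap (h : IsInoueData a b A v w) : LinearMap.ker (latticeMap v w) = ⊥ := by
  rw [LinearMap.ker_eq_bot']
  intro x hx
  have h1 : ∑ i, (x i : ℂ) * w i = 0 := congrArg Prod.fst hx
  have h2 : ∑ i, x i * v i = 0 := congrArg Prod.snd hx
  have h3 : ∑ i, (x i : ℂ) * conj (w i) = 0 := by
    simpa using congrArg (starRingEnd ℂ) h1
  have hu : IsUnit (Matrix.of ![fun i => (v i : ℂ), w, fun i => conj (w i)]) := by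
    rw [← Matrix.linearIndependent_rows_iff_isUnit]
    exact h.linearIndependent
  have h4 : Matrix.of ![fun i => (v i : ℂ), w, fun i => conj (w i)] *ᵥ (fun i => (x i : ℂ)) = 0 := by
    have h2' : ∑ i, (x i : ℂ) * (v i : ℂ) = 0 := by exact_mod_cast h2
    ext i
    fin_cases i
    · simpa [Matrix.mulVec, dotProduct, mul_comm] using h2'
    · simpa [Matrix.mulVec, dotProduct, mul_comm] using h1
    · simpa [Matrix.mulVec, dotProduct, mul_comm] using h3
  have h5 := Matrix.mulVec_injective_of_isUnit hu (h4.trans (Matrix.mulVec_zero _).symm)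
  ext i
  simpa using congrFun h5 i

theorem surjective_latticeMap (h : IsInoueData a b A v w) :
    Function.Surjective (latticeMap v w) := by
  rw [← LinearMap.injective_iff_surjective_of_finrank_eq_finrank
    (by simp [Complex.finrank_real_complex])]
  exact LinearMap.ker_eq_bot.1 h.ker_latticeMap

theorem latticeMap_intCast (v : Fin 3 → ℝ) (w : Fin 3 → ℂ) (n : Fin 3 → ℤ) :
    latticeMap v w (fun i => (n i : ℝ)) = (intDot w n, intDot v n) := by
  simp [latticeMap, intDot]

/-- The lattice `{(∑ nᵢ wᵢ, ∑ nᵢ vᵢ)}` is discrete. -/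
theorem exists_discrete (h : IsInoueData a b A v w) : ∃ ε > 0, ∀ n : Fin 3 → ℤ,
    ‖intDot w n‖ < ε → |intDot v n| < ε → n = 0 := by
  obtain ⟨K, hK, hanti⟩ := (latticeMap v w).exists_antilipschitzWith h.ker_latticeMap
  refine ⟨(K : ℝ)⁻¹, by positivity, fun n h1 h2 => ?_⟩
  have h3 := hanti.le_mul_dist (fun i => (n i : ℝ)) 0
  rw [map_zero, dist_zero_right, dist_zero_right, latticeMap_intCast] at h3
  have h4 : ‖(intDot w n, intDot v n)‖ < (K : ℝ)⁻¹ := max_lt h1 h2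
  have h5 : ‖fun i => (n i : ℝ)‖ < 1 := by
    have hK' : (0 : ℝ) < K := hK
    calc _ ≤ _ := h3
      _ < K * (K : ℝ)⁻¹ := by gcongr
      _ = 1 := mul_inv_cancel₀ hK'.ne'
  rw [pi_norm_lt_iff one_pos] at h5
  ext i
  have h6 := h5 i
  rw [Real.norm_eq_abs] at h6
  have : |n i| < 1 := by exact_mod_cast h6
  rwa [Int.abs_lt_one_iff] at this

/-- The same coefficient vector, n times a power of the matrix, serves w and v simultaneously. This
makes the elements (w·n, v·n, k) a group; negative powers use that the inverse matrix is integral.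
-/
theorem exists_intDot_zpow (h : IsInoueData a b A v w) (k : ℤ) : ∀ n : Fin 3 → ℤ,
    ∃ n' : Fin 3 → ℤ, Sol.alpha a b k * intDot w n = intDot w n' ∧
      Sol.lam a k * intDot v n = intDot v n' := by
  have hα : Sol.alpha a b (-1) * Sol.alpha a b 1 = 1 := by
    rw [← Sol.alpha_add, neg_add_cancel, Sol.alpha_zero]
  have hl : Sol.lam a (-1) * Sol.lam a 1 = 1 := by
    rw [← Sol.lam_add, neg_add_cancel, Sol.lam_zero]
  induction k using Int.induction_on with
  | zero => exact fun n => ⟨n, by simp [Sol.alpha_zero], by simp [Sol.lam_zero]⟩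
  | succ k ih =>
    intro n
    obtain ⟨n', h1, h2⟩ := ih n
    refine ⟨n' ᵥ* (A : Matrix (Fin 3) (Fin 3) ℤ), ?_, ?_⟩
    · rw [← mul_intDot h.mulVec_w, ← h1, Int.cast_add, Int.cast_one, Sol.alpha_add]; ring
    · rw [← mul_intDot h.mulVec_v, ← h2, Int.cast_add, Int.cast_one, Sol.lam_add]; ring
  | pred k ih =>
    intro n
    obtain ⟨n', h1, h2⟩ := ih n
    refine ⟨n' ᵥ* ((A⁻¹ : Matrix.SpecialLinearGroup (Fin 3) ℤ) : Matrix (Fin 3) (Fin 3) ℤ), ?_, ?_⟩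
    · rw [← mul_intDot (inv_mulVec_eq hα h.mulVec_w), ← h1, sub_eq_add_neg, Int.cast_add,
        Int.cast_neg 1, Int.cast_one, Sol.alpha_add]; ring
    · rw [← mul_intDot (inv_mulVec_eq hl h.mulVec_v), ← h2, sub_eq_add_neg, Int.cast_add,
        Int.cast_neg 1, Int.cast_one, Sol.lam_add]; ring

/-- The additive group generated by the entries of `v` contains arbitrarily small nonzero
elements. -/
theorem exists_small (h : IsInoueData a b A v w) {δ : ℝ} (hδ : 0 < δ) : ∃ n : Fin 3 → ℤ,
    intDot v n ≠ 0 ∧ |intDot v n| < δ := by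
  obtain ⟨i, hi⟩ := Function.ne_iff.1 h.v_ne
  have hl := h.one_lt_lam
  -- Powers of λ⁻¹ contract a nonzero entry of v while staying in the group of integral
  -- combinations.
  have h1 : Filter.Tendsto (fun k : ℕ => (Sol.lam a 1)⁻¹ ^ k * |v i|) Filter.atTop (nhds (0 * |v i|)) :=
    (tendsto_pow_atTop_nhds_zero_of_lt_one (by positivity) (inv_lt_one_of_one_lt₀ hl)).mul_const _
  rw [zero_mul] at h1
  obtain ⟨k, hk⟩ := (h1.eventually (gt_mem_nhds hδ)).exists
  obtain ⟨n, -, hn⟩ := h.exists_intDot_zpow (-k) (Pi.single i 1)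
  have hlk : Sol.lam a ((-(k : ℤ) : ℤ) : ℝ) = (Sol.lam a 1)⁻¹ ^ k := by
    rw [Sol.lam, Sol.lam, ← Real.exp_neg, ← Real.exp_nat_mul]
    congr 1; push_cast; ring
  rw [intDot_single, hlk] at hn
  refine ⟨n, ?_, ?_⟩
  · rw [← hn]
    exact mul_ne_zero (pow_ne_zero _ (inv_ne_zero (by linarith))) hi
  · rw [← hn, abs_mul, abs_of_nonneg (by positivity)]
    exact hk

/-- Every point of `ℂ × ℝ` can be translated by the lattice into a thin tube around `ℂ × {0}` of
bounded length. -/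
theorem exists_tube (h : IsInoueData a b A v w) {δ : ℝ} (hδ : 0 < δ) : ∃ W : ℝ, ∀ (ω : ℂ) (r : ℝ),
    ∃ n : Fin 3 → ℤ, |r + intDot v n| ≤ δ ∧ ‖ω + intDot w n‖ ≤ W := by
  obtain ⟨m, hm0, hm⟩ := h.exists_small hδ
  set ε := intDot v m with hε
  refine ⟨∑ i, ‖w i‖ + ((∑ i, |v i|) / |ε| + 1) * ‖intDot w m‖, fun ω r => ?_⟩
  obtain ⟨x, hx⟩ := h.surjective_latticeMap (ω, r)
  have hx1 : ∑ i, (x i : ℂ) * w i = ω := congrArg Prod.fst hx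
  have hx2 : ∑ i, x i * v i = r := congrArg Prod.snd hx
  have hround : ∀ i, |x i - round (x i)| ≤ 1 := fun i => (abs_sub_round _).trans (by norm_num)
  -- Rounding real coordinates first brings the point into a fixed bounded region. A multiple of the
  -- small combination m then corrects the real coordinate; the multiple is bounded, so ω moves a
  -- bounded amount, uniformly in the point.
  set n₀ : Fin 3 → ℤ := fun i => round (x i) with hn₀
  have h1 : |r - intDot v n₀| ≤ ∑ i, |v i| := by
    rw [← hx2, intDot, ← Finset.sum_sub_distrib]
    refine (Finset.abs_sum_le_sum_abs _ _).trans (Finset.sum_le_sum fun i _ => ?_)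
    rw [← sub_mul, abs_mul]
    exact mul_le_of_le_one_left (abs_nonneg _) (hround i)
  have h2 : ‖ω - intDot w n₀‖ ≤ ∑ i, ‖w i‖ := by
    rw [← hx1, intDot, ← Finset.sum_sub_distrib]
    refine (norm_sum_le _ _).trans (Finset.sum_le_sum fun i _ => ?_)
    rw [← sub_mul, norm_mul]
    refine mul_le_of_le_one_left (norm_nonneg _) ?_
    have : ((x i : ℂ) - (n₀ i : ℂ)) = ((x i - round (x i) : ℝ) : ℂ) := by push_cast; rfl
    rw [this, Complex.norm_real]
    exact hround i
  set k : ℤ := round ((r - intDot v n₀) / ε) with hk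
  refine ⟨-n₀ - k • m, ?_, ?_⟩
  · rw [intDot_sub, intDot_neg, intDot_smul, ← hε]
    have : r + (-intDot v n₀ - k * ε) = ((r - intDot v n₀) / ε - k) * ε := by field_simp; ring
    rw [this, abs_mul]
    have h3 := abs_sub_round ((r - intDot v n₀) / ε)
    rw [← hk] at h3
    have := abs_nonneg ε
    nlinarith
  · rw [intDot_sub, intDot_neg, intDot_smul]
    have h3 : |(k : ℝ)| ≤ (∑ i, |v i|) / |ε| + 1 := by
      have h4 := abs_sub_round ((r - intDot v n₀) / ε)
      rw [← hk] at h4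
      have h5 : |(r - intDot v n₀) / ε| ≤ (∑ i, |v i|) / |ε| := by
        rw [abs_div]; gcongr
      have h6 : |(k : ℝ)| ≤ |(r - intDot v n₀) / ε| + |(r - intDot v n₀) / ε - k| := by
        have := abs_sub_abs_le_abs_sub (k : ℝ) ((r - intDot v n₀) / ε)
        rw [abs_sub_comm] at this
        linarith
      linarith
    have h7 : ω + (-intDot w n₀ - k * intDot w m) = (ω - intDot w n₀) - k * intDot w m := by ring
    rw [h7]
    refine (norm_sub_le _ _).trans (add_le_add h2 ?_)
    rw [norm_mul, Complex.norm_intCast]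
    gcongr

/-- The elements of the lattice. -/
theorem mem_inoueLattice_iff (h : IsInoueData a b A v w) (g : Sol a b) :
    g ∈ inoueLattice a b v w ↔
      ∃ (k : ℤ) (n : Fin 3 → ℤ), g = ⟨intDot w n, intDot v n, k⟩ := by
  constructor
  · intro hg
    induction hg using Subgroup.closure_induction with
    | mem x hx =>
      rcases hx with hx | ⟨i, rfl⟩
      · exact ⟨1, 0, by rw [Set.mem_singleton_iff.1 hx]; simp⟩
      · exact ⟨0, Pi.single i 1, by simp [intDot_single]⟩
    | one => exact ⟨0, 0, by ext1 <;> simp⟩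
    | mul x y _ _ hx hy =>
      obtain ⟨k, n, rfl⟩ := hx
      obtain ⟨l, m, rfl⟩ := hy
      obtain ⟨m', h1, h2⟩ := h.exists_intDot_zpow k m
      exact ⟨k + l, n + m', by ext1 <;> simp [intDot_add, h1, h2]⟩
    | inv x _ hx =>
      obtain ⟨k, n, rfl⟩ := hx
      obtain ⟨m', h1, h2⟩ := h.exists_intDot_zpow (-k) n
      rw [Int.cast_neg] at h1 h2
      exact ⟨-k, -m', by ext1 <;> simp [intDot_neg, h1, h2]⟩
  · rintro ⟨k, n, rfl⟩
    have hi : ∀ i, (⟨w i, v i, 0⟩ : Sol a b) ∈ inoueLattice a b v w := fun i =>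
      Subgroup.subset_closure (Or.inr ⟨i, rfl⟩)
    have h0 : (⟨0, 0, 1⟩ : Sol a b) ∈ inoueLattice a b v w := Subgroup.subset_closure (Or.inl rfl)
    have hpow : ∀ k : ℤ, (⟨0, 0, 1⟩ : Sol a b) ^ k = ⟨0, 0, k⟩ := fun k => by
      induction k using Int.induction_on with
      | zero => ext1 <;> simp
      | succ k ih => rw [zpow_add_one, ih]; ext1 <;> simp
      | pred k ih => rw [zpow_sub_one, ih]; ext1 <;> simp [sub_eq_add_neg]
    have hpow' : ∀ (i : Fin 3) (k : ℤ), (⟨w i, v i, 0⟩ : Sol a b) ^ k = ⟨k * w i, k * v i, 0⟩ :=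
      fun i k => by
      induction k using Int.induction_on with
      | zero => ext1 <;> simp
      | succ k ih =>
        rw [zpow_add_one, ih]
        ext1 <;> simp [Sol.alpha_zero, Sol.lam_zero] <;> ring
      | pred k ih =>
        rw [zpow_sub_one, ih]
        ext1 <;> simp [Sol.alpha_zero, Sol.lam_zero] <;> ring
    have : (⟨intDot w n, intDot v n, k⟩ : Sol a b) = ⟨w 0, v 0, 0⟩ ^ n 0 * ⟨w 1, v 1, 0⟩ ^ n 1 *
        ⟨w 2, v 2, 0⟩ ^ n 2 * ⟨0, 0, 1⟩ ^ k := by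
      rw [hpow, hpow', hpow', hpow']
      ext1 <;> simp [intDot, Fin.sum_univ_three, Sol.alpha_zero, Sol.lam_zero]
    rw [this]
    exact mul_mem (mul_mem (mul_mem (zpow_mem (hi 0) _) (zpow_mem (hi 1) _))
      (zpow_mem (hi 2) _)) (zpow_mem h0 _)

end IsInoueData

end InoueHCF

/-! ### Norms of tangent vectors and lengths of curves -/

namespace InoueHCF

open scoped ComplexConjugate Matrix

/-- The norm of the real tangent vector `ξ + ξ̄` for the Riemannian metric of `g`. -/
noncomputable def speed (g : MetricField 2) (p ξ : Fin 2 → ℂ) : ℝ :=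
  √(2 * (∑ i, ∑ j, g p i j * ξ i * conj (ξ j)).re)

theorem curveLength_eq (g : MetricField 2) (c : ℝ → Fin 2 → ℂ) :
    curveLength g c = ∫ t in (0 : ℝ)..1, speed g (c t) (deriv c t) := rfl

theorem speed_nonneg (g : MetricField 2) (p ξ : Fin 2 → ℂ) : 0 ≤ speed g p ξ := Real.sqrt_nonneg _

theorem speed_smul (g : MetricField 2) (p ξ : Fin 2 → ℂ) (r : ℝ) :
    speed g p (r • ξ) = |r| * speed g p ξ := by
  have : ∑ i, ∑ j, g p i j * (r • ξ) i * conj ((r • ξ) j)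
      = ((r ^ 2 : ℝ) : ℂ) * ∑ i, ∑ j, g p i j * ξ i * conj (ξ j) := by
    simp only [Finset.mul_sum, Pi.smul_apply, Complex.real_smul, map_mul, Complex.conj_ofReal]
    refine Finset.sum_congr rfl fun i _ => Finset.sum_congr rfl fun j _ => ?_
    push_cast; ring
  rw [speed, this, Complex.re_ofReal_mul, mul_left_comm, Real.sqrt_mul (sq_nonneg r),
    Real.sqrt_sq_eq_abs, speed]

theorem speed_neg (g : MetricField 2) (p ξ : Fin 2 → ℂ) : speed g p (-ξ) = speed g p ξ := by
  simpa using speed_smul g p ξ (-1)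

/-- The height `2√2 a Im τ` of a point of `ℂ × ℍ`. -/
noncomputable def height (a : ℝ) (p : Fin 2 → ℂ) : ℝ := 2 * √2 * a * (p 1).im

theorem height_pos {a : ℝ} (ha : 0 < a) {p : Fin 2 → ℂ} (hp : p ∈ halfSpace) : 0 < height a p :=
  mul_pos (kappa_pos ha) hp

theorem heightPow_one {a : ℝ} (ha : 0 < a) {p : Fin 2 → ℂ} (hp : p ∈ halfSpace) :
    heightPow a 1 p = (height a p : ℝ) := by
  rw [heightPow, one_mul, ← Complex.ofReal_exp]
  congr 1
  exact Real.exp_log (height_pos ha hp)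

theorem weight_add_conj_zero (a b : ℝ) : weight a b 0 + conj (weight a b 0) = 1 := by
  simp only [weight, Matrix.cons_val_zero, map_sub, map_mul, map_div₀, map_one, map_ofNat,
    Complex.conj_ofReal, Complex.conj_I]
  ring

theorem weight_add_conj_one (a b : ℝ) : weight a b 1 + conj (weight a b 1) = -2 := by
  simp [weight]; norm_num

/-- The sums of weights are 1 and -2 on the diagonal and have real part -1/2 off it. The phase of
the off-diagonal entry, the only place where b enters, is irrelevant for the length estimates. -/
theorem invField_hermMatrix {a : ℝ} (ha : 0 < a) (b A B : ℝ) (C : ℂ) {p : Fin 2 → ℂ}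
    (hp : p ∈ halfSpace) : ∃ C' : ℂ, Complex.normSq C' = Complex.normSq C / height a p ∧
      invField a b (hermMatrix A B C) p
        = hermMatrix (height a p * A) (B / height a p ^ 2) C' := by
  have hh := (height_pos ha hp).ne'
  have hm1 : heightPow a (-1) p = ((height a p)⁻¹ : ℝ) := by
    rw [heightPow_neg_one ha hp, height, Complex.ofReal_inv]
  refine ⟨heightPow a (weight a b 0 + conj (weight a b 1)) p * C, ?_, ?_⟩
  · have h1 : ((Complex.normSq (heightPow a (weight a b 0 + conj (weight a b 1)) p) : ℝ) : ℂ)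
        = ((height a p)⁻¹ : ℝ) := by
      rw [← Complex.mul_conj, conj_heightPow, ← heightPow_add, ← hm1]
      congr 1
      rw [map_add, Complex.conj_conj]
      linear_combination weight_add_conj_zero a b + weight_add_conj_one a b
    rw [Complex.normSq_mul, Complex.ofReal_injective h1]
    ring
  · ext i j
    rw [invField_apply]
    fin_cases i <;> fin_cases j
    · simp only [Fin.zero_eta, weight_add_conj_zero, heightPow_one ha hp, hermMatrix_00]
      push_cast; ring
    · rfl
    · simp only [Fin.zero_eta, Fin.mk_one, hermMatrix_10, map_mul, conj_heightPow, map_add,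
        Complex.conj_conj]
      rw [add_comm]
    · simp only [Fin.mk_one, weight_add_conj_one, hermMatrix_11]
      rw [show (-2 : ℂ) = -1 + -1 by norm_num, heightPow_add, hm1]
      push_cast
      field_simp

theorem speed_of_eq_hermMatrix {g : MetricField 2} {p : Fin 2 → ℂ} {A B : ℝ} {C : ℂ}
    (h : g p = hermMatrix A B C) (ξ : Fin 2 → ℂ) :
    speed g p ξ = √(2 * hermForm A B C (ξ 0) (ξ 1)) := by
  rw [speed, h]
  congr 2
  simp [Fin.sum_univ_two, hermForm, Complex.normSq_apply]
  ring

/-- |C|² < AB bounds the cross term by the one that arises from squaring the sum of the two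
coordinate norms. -/
theorem speed_invField_le {a : ℝ} (ha : 0 < a) (b : ℝ) {A B : ℝ} {C : ℂ} (hA : 0 < A) (hB : 0 < B)
    (hC : Complex.normSq C < A * B) {p : Fin 2 → ℂ} (hp : p ∈ halfSpace) (ξ : Fin 2 → ℂ) :
    speed (invField a b (hermMatrix A B C)) p ξ ≤
      √(2 * A) * √(height a p) * ‖ξ 0‖ + √(2 * B) / height a p * ‖ξ 1‖ := by
  obtain ⟨C', hC', heq⟩ := invField_hermMatrix ha b A B C hp
  have hh := height_pos ha hp
  rw [speed_of_eq_hermMatrix heq]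
  refine Real.sqrt_le_iff.2 ⟨by positivity, ?_⟩
  have h1 : (C' * ξ 0 * conj (ξ 1)).re ≤ √A * √B / √(height a p) * ‖ξ 0‖ * ‖ξ 1‖ := by
    refine (Complex.re_le_norm _).trans ?_
    rw [norm_mul, norm_mul, Complex.norm_conj]
    gcongr
    rw [← Real.sqrt_mul hA.le, ← Real.sqrt_div (by positivity)]
    refine Real.le_sqrt_of_sq_le ?_
    rw [← Complex.normSq_eq_norm_sq, hC']
    gcongr
  have h2 : √(2 * A) ^ 2 = 2 * A := Real.sq_sqrt (by positivity)
  have h3 : √(2 * B) ^ 2 = 2 * B := Real.sq_sqrt (by positivity)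
  have h4 : √(height a p) ^ 2 = height a p := Real.sq_sqrt hh.le
  have h5 : √(2 * A) * √(2 * B) = 2 * (√A * √B) := by
    rw [Real.sqrt_mul (by norm_num), Real.sqrt_mul (by norm_num)]
    linear_combination √A * √B * Real.mul_self_sqrt (show (0 : ℝ) ≤ 2 by norm_num)
  have h6 : √(height a p) / height a p = 1 / √(height a p) := by
    rw [Real.sqrt_div_self']
  rw [hermForm, Complex.normSq_eq_norm_sq, Complex.normSq_eq_norm_sq]
  calc _ ≤ 2 * (height a p * A * ‖ξ 0‖ ^ 2 + B / height a p ^ 2 * ‖ξ 1‖ ^ 2 +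
        2 * (√A * √B / √(height a p) * ‖ξ 0‖ * ‖ξ 1‖)) := by gcongr
    _ = √(2 * A) ^ 2 * √(height a p) ^ 2 * ‖ξ 0‖ ^ 2 + √(2 * B) ^ 2 / height a p ^ 2 * ‖ξ 1‖ ^ 2
        + 2 * (√(2 * A) * √(2 * B)) * (1 / √(height a p)) * ‖ξ 0‖ * ‖ξ 1‖ := by
      rw [h2, h3, h4, h5]; ring
    _ = _ := by rw [← h6]; ring

/-- Completing the square in the ζ-component leaves the Schur complement of A. The constant is
asymptotically the same as in the upper bound, which is what makes the limit circle have the right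
length. -/
theorem le_speed_invField_one {a : ℝ} (ha : 0 < a) (b : ℝ) {A B : ℝ} {C : ℂ} (hA : 0 < A)
    {p : Fin 2 → ℂ} (hp : p ∈ halfSpace) (ξ : Fin 2 → ℂ) :
    √(2 * (B - Complex.normSq C / A)) / height a p * ‖ξ 1‖ ≤
      speed (invField a b (hermMatrix A B C)) p ξ := by
  obtain ⟨C', hC', heq⟩ := invField_hermMatrix ha b A B C hp
  have hh := height_pos ha hp
  rw [speed_of_eq_hermMatrix heq]
  by_cases hneg : 2 * (B - Complex.normSq C / A) < 0
  · rw [Real.sqrt_eq_zero_of_nonpos hneg.le]; simp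
  refine Real.le_sqrt_of_sq_le ?_
  rw [mul_pow, div_pow, Real.sq_sqrt (not_lt.1 hneg), ← Complex.normSq_eq_norm_sq]
  have h1 := mul_hermForm (height a p * A) (B / height a p ^ 2) C' (ξ 0) (ξ 1)
  have h2 := Complex.normSq_nonneg (((height a p * A : ℝ) : ℂ) * ξ 0 + conj C' * ξ 1)
  have h3 : 0 < height a p * A := by positivity
  refine le_of_mul_le_mul_left ?_ h3
  rw [hC'] at h1
  calc _ = 2 * ((height a p * A * (B / height a p ^ 2) - Complex.normSq C / height a p) *
        Complex.normSq (ξ 1)) := by field_simp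
    _ ≤ 2 * (height a p * A * hermForm (height a p * A) (B / height a p ^ 2) C' (ξ 0) (ξ 1)) := by
      rw [h1]; linarith
    _ = _ := by ring

theorem le_speed_invField_zero {a : ℝ} (ha : 0 < a) (b : ℝ) {A B : ℝ} {C : ℂ} (hB : 0 < B)
    {p : Fin 2 → ℂ} (hp : p ∈ halfSpace) (ξ : Fin 2 → ℂ) :
    √(2 * (A - Complex.normSq C / B)) * √(height a p) * ‖ξ 0‖ ≤
      speed (invField a b (hermMatrix A B C)) p ξ := by
  obtain ⟨C', hC', heq⟩ := invField_hermMatrix ha b A B C hp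
  have hh := height_pos ha hp
  rw [speed_of_eq_hermMatrix heq]
  by_cases hneg : 2 * (A - Complex.normSq C / B) < 0
  · rw [Real.sqrt_eq_zero_of_nonpos hneg.le]; simp
  refine Real.le_sqrt_of_sq_le ?_
  rw [mul_pow, mul_pow, Real.sq_sqrt (not_lt.1 hneg), Real.sq_sqrt hh.le,
    ← Complex.normSq_eq_norm_sq]
  have h1 := mul_hermForm' (height a p * A) (B / height a p ^ 2) C' (ξ 0) (ξ 1)
  have h2 := Complex.normSq_nonneg (C' * ξ 0 + ((B / height a p ^ 2 : ℝ) : ℂ) * ξ 1)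
  have h3 : 0 < B / height a p ^ 2 := by positivity
  refine le_of_mul_le_mul_left ?_ h3
  rw [hC'] at h1
  calc _ = 2 * ((height a p * A * (B / height a p ^ 2) - Complex.normSq C / height a p) *
        Complex.normSq (ξ 0)) := by field_simp
    _ ≤ 2 * (B / height a p ^ 2 *
        hermForm (height a p * A) (B / height a p ^ 2) C' (ξ 0) (ξ 1)) := by
      rw [h1]; linarith
    _ = _ := by ring

/-- `C¹` curves in `ℂ × ℍ`. -/
structure IsCurve (c : ℝ → Fin 2 → ℂ) : Prop where
  contDiff : ContDiff ℝ 1 c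
  mem : ∀ t, c t ∈ halfSpace

namespace IsCurve

variable {c : ℝ → Fin 2 → ℂ}

theorem hasDerivAt (hc : IsCurve c) (t : ℝ) : HasDerivAt c (deriv c t) t :=
  (hc.contDiff.differentiable one_ne_zero t).hasDerivAt

theorem continuous_deriv (hc : IsCurve c) : Continuous (deriv c) :=
  hc.contDiff.continuous_deriv le_rfl

theorem continuous_speed (hc : IsCurve c) {a : ℝ} (ha : 0 < a) (b : ℝ)
    (G : Matrix (Fin 2) (Fin 2) ℂ) :
    Continuous fun t => speed (invField a b G) (c t) (deriv c t) := by
  have h1 : ∀ ν, Continuous fun t => heightPow a ν (c t) := fun ν =>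
    (contDiffOn_heightPow ha ν).continuousOn.comp_continuous hc.contDiff.continuous hc.mem
  have h2 : ∀ i, Continuous fun t => deriv c t i := fun i =>
    (continuous_apply i).comp hc.continuous_deriv
  simp only [speed, invField_apply]
  refine Real.continuous_sqrt.comp (continuous_const.mul (Complex.continuous_re.comp ?_))
  refine continuous_finsetSum _ fun i _ => continuous_finsetSum _ fun j _ => ?_
  exact (((h1 _).mul continuous_const).mul (h2 i)).mul (Complex.continuous_conj.comp (h2 j))

theorem curveLength_nonneg (g : MetricField 2) (c : ℝ → Fin 2 → ℂ) : 0 ≤ curveLength g c :=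
  intervalIntegral.integral_nonneg zero_le_one fun _ _ => speed_nonneg _ _ _

theorem reverse (hc : IsCurve c) : IsCurve fun t => c (1 - t) :=
  ⟨hc.contDiff.comp (contDiff_const.sub contDiff_id), fun _ => hc.mem _⟩

theorem curveLength_reverse (hc : IsCurve c) (g : MetricField 2) :
    curveLength g (fun t => c (1 - t)) = curveLength g c := by
  have hd : ∀ t, deriv (fun t => c (1 - t)) t = -deriv c (1 - t) := fun t => by
    have := (hc.hasDerivAt (1 - t)).scomp t ((hasDerivAt_id t).const_sub 1)
    exact this.deriv.trans (by simp)
  simp only [curveLength_eq, hd, speed_neg]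
  rw [intervalIntegral.integral_comp_sub_left (fun t => speed g (c t) (deriv c t)) 1]
  simp

theorem act_mem {a b : ℝ} (h : Sol a b) {p : Fin 2 → ℂ} (hp : p ∈ halfSpace) :
    h.act p ∈ halfSpace := (h • (⟨p, hp⟩ : Cover)).2

theorem act_eq {a b : ℝ} (ha : 0 < a) (h : Sol a b) (p : Fin 2 → ℂ) (i : Fin 2) :
    h.act p i = multiplier a b h.s i * p i + h.act 0 i := by
  fin_cases i
  · simp [Sol.act, multiplier_zero ha]
  · simp [Sol.act, multiplier_one]

theorem hasDerivAt_act {a b : ℝ} (ha : 0 < a) (h : Sol a b) {t : ℝ} {ξ : Fin 2 → ℂ}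
    (hc : HasDerivAt c ξ t) :
    HasDerivAt (fun t => h.act (c t)) (fun i => multiplier a b h.s i * ξ i) t := by
  refine hasDerivAt_pi.2 fun i => ?_
  have := ((hasDerivAt_pi.1 hc i).const_mul (multiplier a b h.s i)).add_const (h.act 0 i)
  exact this.congr_of_eventuallyEq (Filter.Eventually.of_forall fun s => act_eq ha h (c s) i)

theorem act (hc : IsCurve c) {a b : ℝ} (ha : 0 < a) (h : Sol a b) :
    IsCurve fun t => h.act (c t) := by
  refine ⟨contDiff_pi.2 fun i => ?_, fun t => act_mem h (hc.mem t)⟩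
  rw [show (fun t => h.act (c t) i) = fun t => multiplier a b h.s i * c t i + h.act 0 i from
    funext fun t => act_eq ha h (c t) i]
  exact (contDiff_const.mul (contDiff_pi.1 hc.contDiff i)).add contDiff_const

theorem curveLength_act (hc : IsCurve c) {a b : ℝ} (ha : 0 < a) (h : Sol a b)
    (G : Matrix (Fin 2) (Fin 2) ℂ) :
    curveLength (invField a b G) (fun t => h.act (c t)) = curveLength (invField a b G) c := by
  have hd : ∀ t, deriv (fun t => h.act (c t)) t = fun i => multiplier a b h.s i * deriv c t i :=
    fun t => (hasDerivAt_act ha h (hc.hasDerivAt t)).deriv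
  simp only [curveLength_eq, hd]
  congr 1
  ext t
  have h1 := fun i j => congrFun (congrFun (isLeftInvariant_invField (b := b) ha G h (hc.mem t)) i) j
  simp only [pullback_act_apply ha] at h1
  rw [speed, speed]
  congr 3
  refine Finset.sum_congr rfl fun i _ => Finset.sum_congr rfl fun j _ => ?_
  rw [← h1 i j, map_mul]
  ring

end IsCurve

theorem deriv_smoothTransition_of_nonpos {x : ℝ} (hx : x ≤ 0) :
    deriv Real.smoothTransition x = 0 :=
  IsLocalMin.deriv_eq_zero (Filter.Eventually.of_forall fun y => by
    rw [Real.smoothTransition.zero_of_nonpos hx]; exact Real.smoothTransition.nonneg y)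

theorem deriv_smoothTransition_of_one_le {x : ℝ} (hx : 1 ≤ x) :
    deriv Real.smoothTransition x = 0 :=
  IsLocalMax.deriv_eq_zero (Filter.Eventually.of_forall fun y => by
    rw [Real.smoothTransition.one_of_one_le hx]; exact Real.smoothTransition.le_one y)

theorem hasDerivAt_smoothTransition (x : ℝ) :
    HasDerivAt Real.smoothTransition (deriv Real.smoothTransition x) x :=
  ((Real.smoothTransition.contDiff (n := 1)).differentiable (by norm_num) x).hasDerivAt

theorem continuous_deriv_smoothTransition : Continuous (deriv Real.smoothTransition) :=
  (Real.smoothTransition.contDiff (n := 1)).continuous_deriv (by norm_num)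

theorem deriv_smoothTransition_nonneg (x : ℝ) : 0 ≤ deriv Real.smoothTransition x :=
  Real.smoothTransition.monotone.deriv_nonneg

theorem integral_deriv_smoothTransition :
    ∫ t in (0 : ℝ)..1, deriv Real.smoothTransition t = 1 := by
  rw [intervalIntegral.integral_eq_sub_of_hasDerivAt (fun x _ => hasDerivAt_smoothTransition x)
    (continuous_deriv_smoothTransition.intervalIntegrable _ _)]
  simp

namespace IsCurve

/-- Two curves can be joined to a `C¹` curve of the total length. -/
theorem exists_concat {c d : ℝ → Fin 2 → ℂ} (hc : IsCurve c) (hd : IsCurve d) (h : c 1 = d 0)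
    {a : ℝ} (ha : 0 < a) (b : ℝ) (G : Matrix (Fin 2) (Fin 2) ℂ) :
    ∃ e, IsCurve e ∧ e 0 = c 0 ∧ e 1 = d 1 ∧
      curveLength (invField a b G) e
        = curveLength (invField a b G) c + curveLength (invField a b G) d := by
  -- The first curve is traversed for t in [0, 1/3] and the second for t in [2/3, 1], both with a
  -- smooth stop. As a sum of two terms of which one is always constant, the concatenation is C¹
  -- without any gluing argument.
  set φ : ℝ → ℝ := fun t => Real.smoothTransition (3 * t) with hφ
  set ψ : ℝ → ℝ := fun t => Real.smoothTransition (3 * t - 2) with hψ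
  have dφ : ∀ t, HasDerivAt φ (3 * deriv Real.smoothTransition (3 * t)) t := fun t => by
    have := (hasDerivAt_smoothTransition (3 * t)).comp t ((hasDerivAt_id t).const_mul 3)
    exact this.congr_deriv (by ring)
  have dψ : ∀ t, HasDerivAt ψ (3 * deriv Real.smoothTransition (3 * t - 2)) t := fun t => by
    have := (hasDerivAt_smoothTransition (3 * t - 2)).comp t
      (((hasDerivAt_id t).const_mul 3).sub_const 2)
    exact this.congr_deriv (by ring)
  have cφ : Continuous fun t : ℝ => 3 * deriv Real.smoothTransition (3 * t) :=
    continuous_const.mul (continuous_deriv_smoothTransition.comp (by fun_prop))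
  have cψ : Continuous fun t : ℝ => 3 * deriv Real.smoothTransition (3 * t - 2) :=
    continuous_const.mul (continuous_deriv_smoothTransition.comp (by fun_prop))
  have sφ : ContDiff ℝ 1 φ := Real.smoothTransition.contDiff.comp (contDiff_const.mul contDiff_id)
  have sψ : ContDiff ℝ 1 ψ :=
    Real.smoothTransition.contDiff.comp ((contDiff_const.mul contDiff_id).sub contDiff_const)
  have φ1 : ∀ t, 1 / 2 ≤ t → φ t = 1 ∧ deriv Real.smoothTransition (3 * t) = 0 := fun t ht =>
    ⟨Real.smoothTransition.one_of_one_le (by linarith),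
      deriv_smoothTransition_of_one_le (by linarith)⟩
  have ψ0 : ∀ t, t ≤ 1 / 2 → ψ t = 0 ∧ deriv Real.smoothTransition (3 * t - 2) = 0 := fun t ht =>
    ⟨Real.smoothTransition.zero_of_nonpos (by linarith),
      deriv_smoothTransition_of_nonpos (by linarith)⟩
  set e : ℝ → Fin 2 → ℂ := fun t => c (φ t) + d (ψ t) - c 1 with he
  have e1 : ∀ t, t ≤ 1 / 2 → e t = c (φ t) := fun t ht => by
    simp only [he, (ψ0 t ht).1, h, add_sub_cancel_right]
  have e2 : ∀ t, 1 / 2 ≤ t → e t = d (ψ t) := fun t ht => by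
    simp only [he, (φ1 t ht).1, add_sub_cancel_left]
  have de : ∀ t, deriv e t = (3 * deriv Real.smoothTransition (3 * t)) • deriv c (φ t) +
      (3 * deriv Real.smoothTransition (3 * t - 2)) • deriv d (ψ t) := fun t =>
    ((((hc.hasDerivAt _).scomp t (dφ t)).add ((hd.hasDerivAt _).scomp t (dψ t))).sub_const
      (c 1)).deriv
  have hcurve : IsCurve e := by
    refine ⟨((hc.contDiff.comp sφ).add (hd.contDiff.comp sψ)).sub contDiff_const, fun t => ?_⟩
    rcases le_total t (1 / 2) with ht | ht
    · rw [e1 t ht]; exact hc.mem _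
    · rw [e2 t ht]; exact hd.mem _
  refine ⟨e, hcurve, ?_, ?_, ?_⟩
  · rw [e1 0 (by norm_num)]; simp [hφ]
  · rw [e2 1 (by norm_num)]; norm_num [hψ]
  · rw [curveLength_eq, ← intervalIntegral.integral_add_adjacent_intervals
      ((hcurve.continuous_speed ha b G).intervalIntegrable 0 (1 / 2))
      ((hcurve.continuous_speed ha b G).intervalIntegrable (1 / 2) 1)]
    congr 1
    · have := intervalIntegral.integral_comp_mul_deriv (a := 0) (b := 1 / 2)
        (fun t _ => dφ t) cφ.continuousOn (hc.continuous_speed ha b G)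
      rw [(φ1 (1 / 2) le_rfl).1, show φ 0 = 0 by simp [hφ]] at this
      rw [curveLength_eq, ← this]
      refine intervalIntegral.integral_congr fun t ht => ?_
      rw [Set.uIcc_of_le (by norm_num)] at ht
      simp only [Function.comp_apply]
      rw [e1 t ht.2, de, (ψ0 t ht.2).2, mul_zero, zero_smul, add_zero, speed_smul,
        abs_of_nonneg (mul_nonneg (by norm_num) (deriv_smoothTransition_nonneg _)), mul_comm]
    · have := intervalIntegral.integral_comp_mul_deriv (a := 1 / 2) (b := 1)
        (fun t _ => dψ t) cψ.continuousOn (hd.continuous_speed ha b G)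
      rw [(ψ0 (1 / 2) le_rfl).1, show ψ 1 = 1 by norm_num [hψ]] at this
      rw [curveLength_eq, ← this]
      refine intervalIntegral.integral_congr fun t ht => ?_
      rw [Set.uIcc_of_le (by norm_num)] at ht
      simp only [Function.comp_apply]
      rw [e2 t ht.1, de, (φ1 t ht.1).2, mul_zero, zero_smul, zero_add, speed_smul,
        abs_of_nonneg (mul_nonneg (by norm_num) (deriv_smoothTransition_nonneg _)), mul_comm]

end IsCurve

end InoueHCF

/-! ### Explicit curves and a priori bounds along curves -/

namespace InoueHCF

open scoped ComplexConjugate Matrix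

/-- The point `M(p, q, r, s) · basePoint` with `ζ = p + iq`. -/
noncomputable def pt (a : ℝ) (ζ : ℂ) (r s : ℝ) : Fin 2 → ℂ :=
  ![ζ, r + ((Real.exp (2 * √2 * a * s) / (2 * √2 * a) : ℝ) : ℂ) * Complex.I]

theorem pt_im (a : ℝ) (ζ : ℂ) (r s : ℝ) :
    (pt a ζ r s 1).im = Real.exp (2 * √2 * a * s) / (2 * √2 * a) := by
  simp only [pt, Matrix.cons_val_one, Matrix.cons_val_fin_one, Complex.add_im, Complex.ofReal_im,
    Complex.im_ofReal_mul, Complex.I_im, mul_one, zero_add]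

theorem pt_mem {a : ℝ} (ha : 0 < a) (ζ : ℂ) (r s : ℝ) : pt a ζ r s ∈ halfSpace := by
  have := kappa_pos ha
  change 0 < (pt a ζ r s 1).im
  rw [pt_im]
  positivity

theorem height_pt {a : ℝ} (ha : 0 < a) (ζ : ℂ) (r s : ℝ) :
    height a (pt a ζ r s) = Real.exp (2 * √2 * a * s) := by
  have := kappa_pos ha
  rw [height, pt_im]
  field_simp

theorem eq_pt {a : ℝ} (ha : 0 < a) {p : Fin 2 → ℂ} (hp : p ∈ halfSpace) :
    p = pt a (p 0) (p 1).re (Real.log (height a p) / (2 * √2 * a)) := by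
  have hk := kappa_pos ha
  ext i
  fin_cases i
  · rfl
  · apply Complex.ext
    · simp only [pt, Fin.mk_one, Matrix.cons_val_one, Matrix.cons_val_fin_one, Complex.add_re,
        Complex.ofReal_re, Complex.re_ofReal_mul, Complex.I_re, mul_zero, add_zero]
    · refine Eq.symm ((pt_im _ _ _ _).trans ?_)
      rw [mul_div_cancel₀ _ hk.ne', Real.exp_log (height_pos ha hp), height]
      field_simp
      rfl

theorem act_pt {a b : ℝ} (h : Sol a b) (ζ : ℂ) (r s : ℝ) :
    h.act (pt a ζ r s) =
      pt a (Sol.alpha a b h.s * ζ + h.w) (Sol.lam a h.s * r + h.r) (s + h.s) := by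
  ext i
  fin_cases i
  · rfl
  · simp only [Sol.act, pt, Fin.mk_one, Matrix.cons_val_one, Matrix.cons_val_fin_one, Sol.lam,
      mul_add, Real.exp_add]
    push_cast
    ring

/-- Interpolation in the coordinates (ζ, r, s). The factor of |s' - s| is exactly √(2B), with no
exponential loss, because the height cancels in the s-direction. -/
theorem exists_segment {a : ℝ} (ha : 0 < a) (b : ℝ) {A B : ℝ} {C : ℂ} (hA : 0 < A) (hB : 0 < B)
    (hC : Complex.normSq C < A * B) (ζ ζ' : ℂ) (r r' : ℝ) {s s' m : ℝ} (hs : |s| ≤ m)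
    (hs' : |s'| ≤ m) : ∃ c, IsCurve c ∧ c 0 = pt a ζ r s ∧ c 1 = pt a ζ' r' s' ∧
      curveLength (invField a b (hermMatrix A B C)) c ≤
        √(2 * A) * Real.exp (√2 * a * m) * ‖ζ' - ζ‖ +
          √(2 * B) * (Real.exp (2 * √2 * a * m) * |r' - r| + |s' - s|) := by
  have hk := kappa_pos ha
  set φ := Real.smoothTransition with hφ
  set σ : ℝ → ℝ := fun t => s + φ t * (s' - s) with hσ
  have sφ : ContDiff ℝ 1 φ := Real.smoothTransition.contDiff
  have sσ : ContDiff ℝ 1 σ := contDiff_const.add (sφ.mul contDiff_const)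
  have sc : ContDiff ℝ 1 fun t => pt a (ζ + (φ t : ℂ) * (ζ' - ζ)) (r + φ t * (r' - r)) (σ t) := by
    refine contDiff_pi.2 fun i => ?_
    fin_cases i
    · exact contDiff_const.add ((Complex.ofRealCLM.contDiff.comp sφ).mul contDiff_const)
    · refine (Complex.ofRealCLM.contDiff.comp (contDiff_const.add (sφ.mul contDiff_const))).add
        ((Complex.ofRealCLM.contDiff.comp ?_).mul contDiff_const)
      exact ((contDiff_const.mul sσ).exp).div_const _
  have hcurve : IsCurve fun t => pt a (ζ + (φ t : ℂ) * (ζ' - ζ)) (r + φ t * (r' - r)) (σ t) :=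
    ⟨sc, fun t => pt_mem ha _ _ _⟩
  refine ⟨_, hcurve, by simp [hφ, hσ], by simp [hφ, hσ], ?_⟩
  have dφ := hasDerivAt_smoothTransition
  have dσ : ∀ t, HasDerivAt σ (deriv φ t * (s' - s)) t := fun t =>
    ((dφ t).mul_const _).const_add _
  have dc : ∀ t, deriv (fun t => pt a (ζ + (φ t : ℂ) * (ζ' - ζ)) (r + φ t * (r' - r)) (σ t)) t
      = deriv φ t • ![ζ' - ζ, ((r' - r : ℝ) : ℂ) +
        ((Real.exp (2 * √2 * a * σ t) * (s' - s) : ℝ) : ℂ) * Complex.I] := fun t => by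
    refine HasDerivAt.deriv (hasDerivAt_pi.2 fun i => ?_)
    fin_cases i
    · refine (((dφ t).ofReal_comp.mul_const _).const_add _).congr_deriv ?_
      simp [hφ]
    · have h1 := (((dφ t).mul_const (r' - r)).const_add r).ofReal_comp
      have h2 := ((((dσ t).const_mul (2 * √2 * a)).exp).div_const (2 * √2 * a)).ofReal_comp.mul_const
        Complex.I
      refine (h1.add h2).congr_deriv ?_
      have e : Real.exp (2 * √2 * a * σ t) * (2 * √2 * a * (deriv φ t * (s' - s))) / (2 * √2 * a)
          = deriv φ t * (Real.exp (2 * √2 * a * σ t) * (s' - s)) := by field_simp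
      rw [e]
      simp only [Fin.mk_one, Pi.smul_apply, Matrix.cons_val_one, Matrix.cons_val_fin_one,
        Complex.real_smul, hφ]
      push_cast
      ring
  have hσm : ∀ t, |σ t| ≤ m := fun t => by
    have h0 := Real.smoothTransition.nonneg t
    have h1 := Real.smoothTransition.le_one t
    rw [abs_le] at hs hs' ⊢
    simp only [hσ, hφ]
    constructor <;> nlinarith [hs.1, hs.2, hs'.1, hs'.2]
  set K := √(2 * A) * Real.exp (√2 * a * m) * ‖ζ' - ζ‖ +
    √(2 * B) * (Real.exp (2 * √2 * a * m) * |r' - r| + |s' - s|) with hK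
  have hbound : ∀ t, speed (invField a b (hermMatrix A B C))
      (pt a (ζ + (φ t : ℂ) * (ζ' - ζ)) (r + φ t * (r' - r)) (σ t))
      (deriv (fun t => pt a (ζ + (φ t : ℂ) * (ζ' - ζ)) (r + φ t * (r' - r)) (σ t)) t)
        ≤ deriv φ t * K := fun t => by
    rw [dc, speed_smul, abs_of_nonneg (deriv_smoothTransition_nonneg t)]
    refine mul_le_mul_of_nonneg_left ?_ (deriv_smoothTransition_nonneg t)
    refine (speed_invField_le ha b hA hB hC (pt_mem ha _ _ _) _).trans ?_
    rw [height_pt ha]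
    simp only [Matrix.cons_val_zero, Matrix.cons_val_one, Matrix.cons_val_fin_one]
    have hsm := abs_le.1 (hσm t)
    have ha2 : 0 < √2 * a := by positivity
    have h1 : √(Real.exp (2 * √2 * a * σ t)) ≤ Real.exp (√2 * a * m) := by
      rw [show 2 * √2 * a * σ t = (√2 * a * σ t) + (√2 * a * σ t) by ring, Real.exp_add,
        Real.sqrt_mul_self (Real.exp_pos _).le]
      exact Real.exp_le_exp.2 (by nlinarith)
    have h2 : ‖((r' - r : ℝ) : ℂ) + ((Real.exp (2 * √2 * a * σ t) * (s' - s) : ℝ) : ℂ) *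
        Complex.I‖ ≤ |r' - r| + Real.exp (2 * √2 * a * σ t) * |s' - s| := by
      refine (norm_add_le _ _).trans ?_
      rw [norm_mul, Complex.norm_I, mul_one, Complex.norm_real, Complex.norm_real, Real.norm_eq_abs,
        Real.norm_eq_abs, abs_mul, abs_of_pos (Real.exp_pos _)]
    have h3 : (Real.exp (2 * √2 * a * σ t))⁻¹ ≤ Real.exp (2 * √2 * a * m) := by
      rw [← Real.exp_neg]
      exact Real.exp_le_exp.2 (by nlinarith)
    have hE := Real.exp_pos (2 * √2 * a * σ t)
    calc _ ≤ √(2 * A) * Real.exp (√2 * a * m) * ‖ζ' - ζ‖ + √(2 * B) / Real.exp (2 * √2 * a * σ t) *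
          (|r' - r| + Real.exp (2 * √2 * a * σ t) * |s' - s|) := by gcongr
      _ = √(2 * A) * Real.exp (√2 * a * m) * ‖ζ' - ζ‖ + √(2 * B) *
          ((Real.exp (2 * √2 * a * σ t))⁻¹ * |r' - r| + |s' - s|) := by field_simp
      _ ≤ K := by rw [hK]; gcongr
  rw [curveLength_eq]
  calc _ ≤ ∫ t in (0 : ℝ)..1, deriv φ t * K :=
        intervalIntegral.integral_mono_on zero_le_one
          ((hcurve.continuous_speed ha b _).intervalIntegrable _ _)
          ((continuous_deriv_smoothTransition.mul continuous_const).intervalIntegrable _ _)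
          fun t _ => hbound t
    _ = K := by
      rw [intervalIntegral.integral_mul_const, integral_deriv_smoothTransition, one_mul]

theorem norm_sub_le_mul_integral {E : Type*} [NormedAddCommGroup E] [NormedSpace ℝ E]
    [CompleteSpace E] {f f' : ℝ → E} {sp : ℝ → ℝ} {K : ℝ} (hf : ∀ t, HasDerivAt f (f' t) t)
    (hf' : Continuous f') (hsp : Continuous sp) (hsp0 : ∀ t, 0 ≤ sp t) (hK : 0 ≤ K)
    (hle : ∀ t ∈ Set.Icc (0 : ℝ) 1, ‖f' t‖ ≤ K * sp t) {t : ℝ} (ht : t ∈ Set.Icc (0 : ℝ) 1) :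
    ‖f t - f 0‖ ≤ K * ∫ t in (0 : ℝ)..1, sp t := by
  rw [← intervalIntegral.integral_eq_sub_of_hasDerivAt (fun x _ => hf x)
    (hf'.intervalIntegrable _ _), ← intervalIntegral.integral_const_mul]
  have hc : Continuous fun t => K * sp t := continuous_const.mul hsp
  refine (intervalIntegral.norm_integral_le_of_norm_le ht.1 (Filter.Eventually.of_forall
    fun x hx => hle x ⟨hx.1.le, hx.2.trans ht.2⟩) (hc.intervalIntegrable _ _)).trans ?_
  exact intervalIntegral.integral_mono_interval le_rfl ht.1 ht.2
    (Filter.Eventually.of_forall fun x => mul_nonneg hK (hsp0 x)) (hc.intervalIntegrable _ _)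

namespace IsCurve

variable {c : ℝ → Fin 2 → ℂ}

/-- The derivative of log height is at most |τ'|/Im τ, that is 2√2a |τ'|/height, which the
Schur-complement bound controls by the speed. -/
theorem log_height_le (hc : IsCurve c) {a : ℝ} (ha : 0 < a) (b : ℝ) {A B : ℝ} {C : ℂ} (hA : 0 < A)
    (hC : Complex.normSq C < A * B) {t : ℝ} (ht : t ∈ Set.Icc (0 : ℝ) 1) :
    √(2 * (B - Complex.normSq C / A)) * |Real.log (height a (c t)) - Real.log (height a (c 0))| ≤
      2 * √2 * a * curveLength (invField a b (hermMatrix A B C)) c := by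
  have hk := kappa_pos ha
  have hD : 0 < 2 * (B - Complex.normSq C / A) := by
    have : Complex.normSq C / A < B := by rw [div_lt_iff₀ hA]; linarith
    linarith
  have hD' := Real.sqrt_pos.2 hD
  have h1 := fun t => le_speed_invField_one ha b (B := B) (C := C) hA (hc.mem t) (deriv c t)
  generalize √(2 * (B - Complex.normSq C / A)) = K at *
  have himd : ∀ t, HasDerivAt (fun t => height a (c t)) (2 * √2 * a * (deriv c t 1).im) t := fun t =>
    (Complex.imCLM.hasFDerivAt.comp_hasDerivAt t (hasDerivAt_pi.1 (hc.hasDerivAt t) 1)).const_mul _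
  have hhc : Continuous fun t => height a (c t) :=
    continuous_iff_continuousAt.2 fun t => (himd t).continuousAt
  have hdc : Continuous fun t => 2 * √2 * a * (deriv c t 1).im / height a (c t) :=
    (continuous_const.mul (Complex.continuous_im.comp
      ((continuous_apply 1).comp hc.continuous_deriv))).div hhc
      fun t => (height_pos ha (hc.mem t)).ne'
  have := norm_sub_le_mul_integral (f := fun t => Real.log (height a (c t)))
    (f' := fun t => 2 * √2 * a * (deriv c t 1).im / height a (c t))
    (K := 2 * √2 * a / K)
    (fun t => (himd t).log (height_pos ha (hc.mem t)).ne') hdc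
    (hc.continuous_speed ha b (hermMatrix A B C)) (fun t => speed_nonneg _ _ _) (by positivity)
    (fun t _ => ?_) ht
  · rw [Real.norm_eq_abs, ← curveLength_eq] at this
    calc _ ≤ K * (2 * √2 * a / K *
          curveLength (invField a b (hermMatrix A B C)) c) := by gcongr
      _ = _ := by field_simp
  · have hh := height_pos ha (hc.mem t)
    rw [Real.norm_eq_abs, abs_div, abs_mul, abs_of_pos hk, abs_of_pos hh]
    calc _ ≤ 2 * √2 * a * ‖deriv c t 1‖ / height a (c t) := by
          gcongr; exact Complex.abs_im_le_norm _
      _ = 2 * √2 * a / K *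
          (K / height a (c t) * ‖deriv c t 1‖) := by field_simp
      _ ≤ _ := by gcongr; exact h1 t

/-- Short curves starting at `p` do not get far in the coordinates of `ℂ × ℍ`. -/
theorem exists_norm_sub_le {a : ℝ} (ha : 0 < a) (b : ℝ) {A B : ℝ} {C : ℂ} (hA : 0 < A) (hB : 0 < B)
    (hC : Complex.normSq C < A * B) {p : Fin 2 → ℂ} (hp : p ∈ halfSpace) :
    ∃ M > 0, ∃ δ > 0, ∀ c, IsCurve c → c 0 = p →
      curveLength (invField a b (hermMatrix A B C)) c ≤ δ →
      ∀ i, ‖c 1 i - p i‖ ≤ M * curveLength (invField a b (hermMatrix A B C)) c := by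
  have hk := kappa_pos ha
  have hD : 0 < 2 * (B - Complex.normSq C / A) := by
    have : Complex.normSq C / A < B := by rw [div_lt_iff₀ hA]; linarith
    linarith
  have hD0 : 0 < 2 * (A - Complex.normSq C / B) := by
    have : Complex.normSq C / B < A := by rw [div_lt_iff₀ hB]; linarith
    linarith
  have hK1 := Real.sqrt_pos.2 hD
  have hK0 := Real.sqrt_pos.2 hD0
  set K1 := √(2 * (B - Complex.normSq C / A)) with hK1d
  set K0 := √(2 * (A - Complex.normSq C / B)) with hK0d
  have hy := height_pos ha hp
  set y := height a p with hyd
  have hM0 : 0 < 1 / (K0 * √(y * Real.exp (-1))) := by positivity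
  have hM1 : 0 < y * Real.exp 1 / K1 := by positivity
  -- For length at most K1/(2√2a), log height changes by at most 1. The height thus stays within a
  -- factor e of y, and the speed controls both coordinate derivatives with the stated constants.
  refine ⟨max (1 / (K0 * √(y * Real.exp (-1)))) (y * Real.exp 1 / K1), lt_max_of_lt_left hM0,
    K1 / (2 * √2 * a), by positivity, fun c hc hc0 hL => ?_⟩
  have hrange : ∀ t ∈ Set.Icc (0 : ℝ) 1, y * Real.exp (-1) ≤ height a (c t) ∧
      height a (c t) ≤ y * Real.exp 1 := fun t ht => by
    have h1 := hc.log_height_le ha b hA hC ht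
    rw [hc0, ← hK1d, ← hyd] at h1
    have h2 : K1 * |Real.log (height a (c t)) - Real.log y| ≤ K1 * 1 := by
      refine h1.trans ?_
      rw [le_div_iff₀ hk] at hL
      linarith
    have h3 := abs_le.1 (le_of_mul_le_mul_left h2 hK1)
    have hh := height_pos ha (hc.mem t)
    constructor
    · rw [← Real.log_le_log_iff (by positivity) hh, Real.log_mul hy.ne' (Real.exp_pos _).ne',
        Real.log_exp]
      linarith
    · rw [← Real.log_le_log_iff hh (by positivity), Real.log_mul hy.ne' (Real.exp_pos _).ne',
        Real.log_exp]
      linarith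
  have hone : (1 : ℝ) ∈ Set.Icc (0 : ℝ) 1 := Set.right_mem_Icc.2 zero_le_one
  have hL0 := curveLength_nonneg (invField a b (hermMatrix A B C)) c
  have hcd : ∀ i, Continuous fun t => deriv c t i := fun i =>
    (continuous_apply i).comp hc.continuous_deriv
  have h0 : ‖c 1 0 - p 0‖ ≤ 1 / (K0 * √(y * Real.exp (-1))) *
      curveLength (invField a b (hermMatrix A B C)) c := by
    rw [← hc0]
    refine norm_sub_le_mul_integral (f := fun t => c t 0)
      (fun t => hasDerivAt_pi.1 (hc.hasDerivAt t) 0) (hcd 0)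
      (hc.continuous_speed ha b (hermMatrix A B C)) (fun t => speed_nonneg _ _ _) hM0.le
      (fun t ht => ?_) hone
    have h1 := le_speed_invField_zero ha b (A := A) (C := C) hB (hc.mem t) (deriv c t)
    rw [← hK0d] at h1
    have h2 := Real.sqrt_le_sqrt (hrange t ht).1
    have h3 : 0 < √(y * Real.exp (-1)) := by positivity
    rw [div_mul_eq_mul_div, one_mul, le_div_iff₀ (by positivity)]
    refine le_trans ?_ h1
    calc _ = K0 * √(y * Real.exp (-1)) * ‖deriv c t 0‖ := by ring
      _ ≤ _ := by gcongr
  have h1 : ‖c 1 1 - p 1‖ ≤ y * Real.exp 1 / K1 *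
      curveLength (invField a b (hermMatrix A B C)) c := by
    rw [← hc0]
    refine norm_sub_le_mul_integral (f := fun t => c t 1)
      (fun t => hasDerivAt_pi.1 (hc.hasDerivAt t) 1) (hcd 1)
      (hc.continuous_speed ha b (hermMatrix A B C)) (fun t => speed_nonneg _ _ _) hM1.le
      (fun t ht => ?_) hone
    have h1 := le_speed_invField_one ha b (B := B) (C := C) hA (hc.mem t) (deriv c t)
    rw [← hK1d] at h1
    have hh := height_pos ha (hc.mem t)
    calc ‖deriv c t 1‖ = height a (c t) / K1 * (K1 / height a (c t) * ‖deriv c t 1‖) := by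
          field_simp
      _ ≤ y * Real.exp 1 / K1 * speed (invField a b (hermMatrix A B C)) (c t) (deriv c t) := by
        gcongr
        exact (hrange t ht).2
  intro i
  fin_cases i
  · exact h0.trans (by gcongr; exact le_max_left _ _)
  · exact h1.trans (by gcongr; exact le_max_right _ _)

end IsCurve

end InoueHCF

/-! ### The Riemannian distance makes X a compact metric space -/

namespace InoueHCF

open scoped ComplexConjugate Matrix

theorem height_act {a b : ℝ} (h : Sol a b) (p : Fin 2 → ℂ) :
    height a (h.act p) = Sol.lam a h.s * height a p := by
  simp [height, Sol.act]
  ring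

theorem log_height_act {a b : ℝ} (ha : 0 < a) (h : Sol a b) {p : Fin 2 → ℂ} (hp : p ∈ halfSpace) :
    Real.log (height a (h.act p)) = 2 * √2 * a * h.s + Real.log (height a p) := by
  rw [height_act, Real.log_mul (Sol.lam_pos _).ne' (height_pos ha hp).ne', Sol.lam, Real.log_exp]

section Projection

variable {a b : ℝ} {v : Fin 3 → ℝ} {w : Fin 3 → ℂ}

theorem proj_eq_iff {p q : Cover} :
    proj a b v w p = proj a b v w q ↔ ∃ γ ∈ inoueLattice a b v w, γ.act q.1 = p.1 := by
  rw [proj, proj, Quotient.eq]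
  change p ∈ MulAction.orbit _ q ↔ _
  rw [MulAction.mem_orbit_iff]
  constructor
  · rintro ⟨γ, h⟩
    exact ⟨γ.1, γ.2, congrArg Subtype.val h⟩
  · rintro ⟨γ, hγ, h⟩
    exact ⟨⟨γ, hγ⟩, Subtype.ext h⟩

theorem proj_surjective : Function.Surjective (proj a b v w) := Quotient.mk_surjective

theorem riemDist_nonneg (g : MetricField 2) (P Q : InoueS0 a b v w) :
    0 ≤ riemDist a b v w g P Q := by
  refine Real.sInf_nonneg ?_
  rintro _ ⟨c, -, -, -, rfl⟩
  exact IsCurve.curveLength_nonneg _ _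

theorem IsCurve.riemDist_le {c : ℝ → Fin 2 → ℂ} (hc : IsCurve c) (g : MetricField 2) {p q : Cover}
    (h0 : c 0 = p.1) {γ : Sol a b} (hγ : γ ∈ inoueLattice a b v w) (h1 : c 1 = γ.act q.1) :
    riemDist a b v w g (proj a b v w p) (proj a b v w q) ≤ curveLength g c := by
  refine csInf_le ⟨0, ?_⟩ ⟨fun t => ⟨c t, hc.mem t⟩, hc.contDiff, ?_, ?_, rfl⟩
  · rintro _ ⟨c, -, -, -, rfl⟩
    exact IsCurve.curveLength_nonneg _ _
  · exact congrArg _ (Subtype.ext h0)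
  · exact proj_eq_iff.2 ⟨γ, hγ, h1.symm⟩

theorem exists_isCurve {a : ℝ} (ha : 0 < a) {p q : Fin 2 → ℂ} (hp : p ∈ halfSpace)
    (hq : q ∈ halfSpace) : ∃ c, IsCurve c ∧ c 0 = p ∧ c 1 = q := by
  obtain ⟨c, hc, h0, h1, -⟩ := exists_segment ha 0 (A := 1) (B := 1) (C := 0) one_pos one_pos
    (by simp) (p 0) (q 0) (p 1).re (q 1).re
    (le_max_left |Real.log (height a p) / (2 * √2 * a)| |Real.log (height a q) / (2 * √2 * a)|)
    (le_max_right _ _)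
  exact ⟨c, hc, h0.trans (eq_pt ha hp).symm, h1.trans (eq_pt ha hq).symm⟩

/-- A nearly minimal curve may start at another representative of the first point; a lattice element
moves it to the given one without changing its length. -/
theorem exists_curve_of_riemDist_lt (ha : 0 < a) (G : Matrix (Fin 2) (Fin 2) ℂ) {p q : Cover}
    {L : ℝ}
    (hL : riemDist a b v w (invField a b G) (proj a b v w p) (proj a b v w q) < L) :
    ∃ c, IsCurve c ∧ c 0 = p.1 ∧ (∃ γ ∈ inoueLattice a b v w, c 1 = γ.act q.1) ∧
      curveLength (invField a b G) c < L := by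
  obtain ⟨c₀, hc₀, h0, h1⟩ := exists_isCurve ha p.2 q.2
  rw [riemDist] at hL
  obtain ⟨_, ⟨c, hc, h0, h1, rfl⟩, hlt⟩ := exists_lt_of_csInf_lt (by
    exact ⟨_, fun t => ⟨c₀ t, hc₀.mem t⟩, hc₀.contDiff, congrArg _ (Subtype.ext h0),
      congrArg _ (Subtype.ext h1), rfl⟩) hL
  obtain ⟨γ, hγ, hγ0⟩ := proj_eq_iff.1 h0
  obtain ⟨γ', hγ', hγ1⟩ := proj_eq_iff.1 h1
  have hc' : IsCurve fun t => (c t : Fin 2 → ℂ) := ⟨hc, fun t => (c t).2⟩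
  refine ⟨_, hc'.act ha γ⁻¹, ?_, ⟨γ⁻¹ * γ', mul_mem (inv_mem hγ) hγ', ?_⟩, ?_⟩
  · change γ⁻¹.act (c 0).1 = _
    rw [← hγ0, ← Sol.act_mul, inv_mul_cancel, Sol.act_one]
  · change γ⁻¹.act (c 1).1 = _
    rw [← hγ1, ← Sol.act_mul]
  · rwa [hc'.curveLength_act ha]

theorem riemDist_comm (g : MetricField 2) (P Q : InoueS0 a b v w) :
    riemDist a b v w g P Q = riemDist a b v w g Q P := by
  unfold riemDist
  congr 1
  ext L
  constructor <;>
  · rintro ⟨c, hc, h0, h1, rfl⟩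
    have hc' : IsCurve fun t => (c t : Fin 2 → ℂ) := ⟨hc, fun t => (c t).2⟩
    exact ⟨fun t => c (1 - t), hc'.reverse.contDiff, by simpa using h1, by simpa using h0,
      (hc'.curveLength_reverse g).symm⟩

theorem riemDist_triangle (ha : 0 < a) (G : Matrix (Fin 2) (Fin 2) ℂ) (P Q R : InoueS0 a b v w) :
    riemDist a b v w (invField a b G) P R ≤
      riemDist a b v w (invField a b G) P Q + riemDist a b v w (invField a b G) Q R := by
  obtain ⟨p, rfl⟩ := proj_surjective P
  obtain ⟨q, rfl⟩ := proj_surjective Q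
  obtain ⟨r, rfl⟩ := proj_surjective R
  refine le_of_forall_pos_le_add fun ε hε => ?_
  obtain ⟨c, hc, c0, ⟨γ, hγ, c1⟩, hcl⟩ :=
    exists_curve_of_riemDist_lt (b := b) (v := v) (w := w) (p := p) (q := q) ha G (lt_add_of_pos_right _ (half_pos hε))
  obtain ⟨d, hd, d0, ⟨γ', hγ', d1⟩, hdl⟩ :=
    exists_curve_of_riemDist_lt (b := b) (v := v) (w := w) (p := q) (q := r) ha G (lt_add_of_pos_right _ (half_pos hε))
  obtain ⟨e, he, e0, e1, hel⟩ := hc.exists_concat (hd.act ha γ)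
    (by rw [c1]; exact congrArg _ d0.symm) ha b G
  have := he.riemDist_le (invField a b G) (q := r) (e0.trans c0) (mul_mem hγ hγ')
    (e1.trans (by rw [Sol.act_mul]; exact congrArg _ d1))
  rw [hel, hd.curveLength_act ha] at this
  linarith

end Projection

namespace IsInoueData

variable {a b : ℝ} {N : Matrix.SpecialLinearGroup (Fin 3) ℤ} {v : Fin 3 → ℝ} {w : Fin 3 → ℂ}

/-- The lattice acts properly discontinuously. -/
theorem exists_eq_of_act_near (h : IsInoueData a b N v w) (q : Fin 2 → ℂ) :
    ∃ η > 0, ∀ γ ∈ inoueLattice a b v w, ∀ γ' ∈ inoueLattice a b v w, |γ.s - γ'.s| < 1 →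
      (∀ i, ‖γ.act q i - γ'.act q i‖ < η) → γ = γ' := by
  obtain ⟨ε, hε, hdisc⟩ := h.exists_discrete
  refine ⟨ε, hε, fun γ hγ γ' hγ' hs hact => ?_⟩
  obtain ⟨k, n, rfl⟩ := (h.mem_inoueLattice_iff γ).1 hγ
  obtain ⟨k', n', rfl⟩ := (h.mem_inoueLattice_iff γ').1 hγ'
  have hk : k = k' := by
    have : |k - k'| < 1 := by
      simp only at hs
      exact_mod_cast hs
    exact sub_eq_zero.1 (Int.abs_lt_one_iff.1 this)
  subst hk
  have h0 := hact 0
  have h1 := hact 1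
  simp only [Sol.act, Matrix.cons_val_zero, Matrix.cons_val_one, Matrix.cons_val_fin_one,
    add_sub_add_left_eq_sub, ← intDot_sub] at h0 h1
  have := hdisc (n - n') h0 (by
    rw [← Complex.ofReal_sub, Complex.norm_real, Real.norm_eq_abs, ← intDot_sub] at h1
    exact h1)
  rw [sub_eq_zero.1 this]

variable {A B : ℝ} {C : ℂ}

/-- Curves of length tending to zero from p end at lattice translates of q converging to p. By
proper discontinuity the translate is eventually the same one, so it equals p. -/
theorem eq_of_riemDist_eq_zero (h : IsInoueData a b N v w) (hA : 0 < A) (hB : 0 < B)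
    (hC : Complex.normSq C < A * B) {P Q : InoueS0 a b v w}
    (hPQ : riemDist a b v w (invField a b (hermMatrix A B C)) P Q = 0) : P = Q := by
  obtain ⟨p, rfl⟩ := proj_surjective P
  obtain ⟨q, rfl⟩ := proj_surjective Q
  have ha := h.pos
  have hk := kappa_pos ha
  obtain ⟨M, hM, δ, hδ, hnear⟩ := IsCurve.exists_norm_sub_le ha b hA hB hC p.2
  obtain ⟨η, hη, heq⟩ := h.exists_eq_of_act_near q.1
  have hD : 0 < √(2 * (B - Complex.normSq C / A)) := by
    refine Real.sqrt_pos.2 ?_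
    have : Complex.normSq C / A < B := by rw [div_lt_iff₀ hA]; linarith
    linarith
  set D := √(2 * (B - Complex.normSq C / A)) with hDdef
  have key : ∀ ε > 0, ε ≤ δ → ∃ γ ∈ inoueLattice a b v w, (∀ i, ‖γ.act q.1 i - p.1 i‖ ≤ M * ε) ∧
      D * |γ.s + (Real.log (height a q.1) - Real.log (height a p.1)) / (2 * √2 * a)| ≤ ε := by
    intro ε hε hεδ
    obtain ⟨c, hc, c0, ⟨γ, hγ, c1⟩, hlt⟩ := exists_curve_of_riemDist_lt ha (hermMatrix A B C)
      (hPQ.trans_lt hε)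
    refine ⟨γ, hγ, fun i => ?_, ?_⟩
    · have := hnear c hc c0 (hlt.le.trans hεδ) i
      rw [c1] at this
      exact this.trans (by gcongr)
    · have := hc.log_height_le ha b hA hC (t := 1) (by simp)
      rw [c1, c0, log_height_act ha γ q.2] at this
      rw [show 2 * √2 * a * γ.s + Real.log (height a q.1) - Real.log (height a p.1) =
        2 * √2 * a * (γ.s + (Real.log (height a q.1) - Real.log (height a p.1)) / (2 * √2 * a)) by
          field_simp; ring, abs_mul, abs_of_pos hk, mul_left_comm] at this
      exact (le_of_mul_le_mul_left this hk).trans hlt.le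
  -- With these quarters, two lattice elements found at scales at most θ have s-components differing
  -- by at most 1/2 and images of q differing by at most η/2, so they coincide.
  set θ := min δ (min (D / 4) (η / (4 * M))) with hθ
  have hθpos : 0 < θ := by positivity
  have hθδ : θ ≤ δ := min_le_left _ _
  have hθD : θ ≤ D / 4 := (min_le_right _ _).trans (min_le_left _ _)
  have hθη : M * θ ≤ η / 4 := by
    have : θ ≤ η / (4 * M) := (min_le_right _ _).trans (min_le_right _ _)
    calc M * θ ≤ M * (η / (4 * M)) := by gcongr
      _ = η / 4 := by field_simp
  obtain ⟨γ, hγ, hγn, hγs⟩ := key θ hθpos hθδ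
  have hs : ∀ x : ℝ, D * |x| ≤ θ → |x| ≤ 1 / 4 := fun x hx => by
    have : D * |x| ≤ D * (1 / 4) := by linarith
    exact le_of_mul_le_mul_left this hD
  have hle : ∀ i, ∀ ε > 0, ‖γ.act q.1 i - p.1 i‖ ≤ 0 + ε := by
    intro i ε hε
    set ε' := min θ (ε / M)
    have hε' : 0 < ε' := by positivity
    have hε'θ : ε' ≤ θ := min_le_left _ _
    obtain ⟨γ', hγ', hγn', hγs'⟩ := key ε' hε' (hε'θ.trans hθδ)
    have : γ = γ' := by
      refine heq γ hγ γ' hγ' ?_ fun j => ?_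
      · have h1 := abs_le.1 (hs _ hγs)
        have h2 := abs_le.1 (hs _ (hγs'.trans hε'θ))
        rw [abs_lt]
        constructor <;> linarith [h1.1, h1.2, h2.1, h2.2]
      · have h1 := hγn j
        have h2 := (hγn' j).trans (mul_le_mul_of_nonneg_left hε'θ hM.le)
        have h3 := norm_sub_le_norm_sub_add_norm_sub (γ.act q.1 j) (p.1 j) (γ'.act q.1 j)
        rw [norm_sub_rev (p.1 j)] at h3
        linarith
    rw [this, zero_add]
    refine (hγn' i).trans ?_
    calc M * ε' ≤ M * (ε / M) := by gcongr; exact min_le_right _ _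
      _ = ε := by field_simp
  refine proj_eq_iff.2 ⟨γ, hγ, funext fun i => ?_⟩
  have := le_of_forall_pos_le_add (hle i)
  exact sub_eq_zero.1 (norm_le_zero_iff.1 this)

theorem riemDist_proj_pt_le (h : IsInoueData a b N v w) (hA : 0 < A) (hB : 0 < B)
    (hC : Complex.normSq C < A * B) (ζ ζ' : ℂ) (r r' : ℝ) {s s' m : ℝ} (hs : |s| ≤ m)
    (hs' : |s'| ≤ m) :
    riemDist a b v w (invField a b (hermMatrix A B C))
        (proj a b v w ⟨pt a ζ r s, pt_mem h.pos ζ r s⟩)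
        (proj a b v w ⟨pt a ζ' r' s', pt_mem h.pos ζ' r' s'⟩) ≤
      √(2 * A) * Real.exp (√2 * a * m) * ‖ζ' - ζ‖ +
        √(2 * B) * (Real.exp (2 * √2 * a * m) * |r' - r| + |s' - s|) := by
  obtain ⟨c, hc, c0, c1, hle⟩ := exists_segment h.pos b hA hB hC ζ ζ' r r' hs hs'
  refine le_trans ?_ hle
  exact hc.riemDist_le _ c0 (one_mem _) (c1.trans (Sol.act_one _).symm)

theorem riemDist_self (h : IsInoueData a b N v w) (hA : 0 < A) (hB : 0 < B)
    (hC : Complex.normSq C < A * B) (P : InoueS0 a b v w) :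
    riemDist a b v w (invField a b (hermMatrix A B C)) P P = 0 := by
  obtain ⟨⟨p, hp⟩, rfl⟩ := proj_surjective P
  refine le_antisymm ?_ (riemDist_nonneg _ _ _)
  have := h.riemDist_proj_pt_le hA hB hC (p 0) (p 0) (p 1).re (p 1).re
    (le_refl |Real.log (height a p) / (2 * √2 * a)|) le_rfl
  simp only [← eq_pt h.pos hp] at this
  simpa using this

/-- Every point of `X` has a representative with bounded coordinates and `s ∈ [0, 1]`. -/
theorem exists_proj_pt (h : IsInoueData a b N v w) : ∃ W, ∀ P : InoueS0 a b v w,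
    ∃ ζ r s, ‖ζ‖ ≤ W ∧ |r| ≤ 1 ∧ 0 ≤ s ∧ s ≤ 1 ∧
      P = proj a b v w ⟨pt a ζ r s, pt_mem h.pos ζ r s⟩ := by
  obtain ⟨W, hW⟩ := h.exists_tube one_pos
  refine ⟨W, fun P => ?_⟩
  obtain ⟨⟨p, hp⟩, rfl⟩ := proj_surjective P
  set s := Real.log (height a p) / (2 * √2 * a)
  -- The power of the generator is chosen to bring s into [0, 1); the translations then bound r and
  -- ζ.
  set k : ℤ := -⌊s⌋
  obtain ⟨n, hr, hζ⟩ := hW (Sol.alpha a b k * p 0) (Sol.lam a k * (p 1).re)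
  refine ⟨_, _, s + k, hζ, hr, ?_, ?_, ?_⟩
  · simp only [k, Int.cast_neg]; linarith [Int.floor_le s]
  · simp only [k, Int.cast_neg]; linarith [Int.lt_floor_add_one s]
  · refine (proj_eq_iff.2 ⟨⟨intDot w n, intDot v n, k⟩,
      (h.mem_inoueLattice_iff _).2 ⟨k, n, rfl⟩, ?_⟩).symm
    change Sol.act _ p = _
    conv_lhs => rw [eq_pt h.pos hp]
    exact act_pt _ _ _ _

end IsInoueData

/-- `d` is the distance function of a compact metric space. -/
def IsCompactMetric {X : Type*} (d : X → X → ℝ) : Prop :=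
  ∃ (_ : MetricSpace X) (_ : CompactSpace X), ∀ x y : X, dist x y = d x y

/-- A distance function for which a compact space surjects onto `X` by a Lipschitz map makes `X` a
compact metric space. -/
theorem isCompactMetric_of_lipschitz {X K : Type*} [PseudoMetricSpace K] [CompactSpace K]
    (d : X → X → ℝ) (d_self : ∀ x, d x x = 0) (d_comm : ∀ x y, d x y = d y x)
    (d_triangle : ∀ x y z, d x z ≤ d x y + d y z) (eq_of_d : ∀ {x y}, d x y = 0 → x = y)
    (f : K → X) (hf : Function.Surjective f) (c : ℝ) (hc : ∀ x y, d (f x) (f y) ≤ c * dist x y) :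
    IsCompactMetric d := by
  let inst : MetricSpace X :=
    { dist := d
      dist_self := d_self
      dist_comm := d_comm
      dist_triangle := d_triangle
      eq_of_dist_eq_zero := eq_of_d }
  have hlip : LipschitzWith (Real.toNNReal c) f := LipschitzWith.of_dist_le' hc
  refine ⟨inst, ?_, fun _ _ => rfl⟩
  exact hf.compactSpace hlip.continuous

/-- The Riemannian distance of a locally homogeneous metric makes `X` a compact metric space. -/
theorem IsInoueData.isCompactMetric_riemDist {a b : ℝ} {N : Matrix.SpecialLinearGroup (Fin 3) ℤ}
    {v : Fin 3 → ℝ} {w : Fin 3 → ℂ} (h : IsInoueData a b N v w) {A B : ℝ} {C : ℂ} (hA : 0 < A)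
    (hB : 0 < B) (hC : Complex.normSq C < A * B) :
    IsCompactMetric (riemDist a b v w (invField a b (hermMatrix A B C))) := by
  obtain ⟨W, hW⟩ := h.exists_proj_pt
  -- This compact box of coordinates surjects onto X, and the segment estimate makes the surjection
  -- Lipschitz.
  let K : Set (ℂ × ℝ × ℝ) := Metric.closedBall 0 W ×ˢ Set.Icc (-1) 1 ×ˢ Set.Icc 0 1
  have hK : IsCompact K := (isCompact_closedBall 0 W).prod (isCompact_Icc.prod isCompact_Icc)
  have : CompactSpace K := isCompact_iff_compactSpace.1 hK
  refine isCompactMetric_of_lipschitz (K := K) _ (h.riemDist_self hA hB hC) (riemDist_comm _)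
    (riemDist_triangle h.pos _) (h.eq_of_riemDist_eq_zero hA hB hC)
    (fun x => proj a b v w ⟨pt a x.1.1 x.1.2.1 x.1.2.2, pt_mem h.pos _ _ _⟩) (fun P => ?_)
    (√(2 * A) * Real.exp (√2 * a * 1) + √(2 * B) * (Real.exp (2 * √2 * a * 1) + 1)) fun x y => ?_
  · obtain ⟨ζ, r, s, hζ, hr, hs0, hs1, rfl⟩ := hW P
    exact ⟨⟨(ζ, r, s), by simpa using hζ, abs_le.1 hr, hs0, hs1⟩, rfl⟩
  · obtain ⟨⟨ζ, r, s⟩, -, -, hs0, hs1⟩ := x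
    obtain ⟨⟨ζ', r', s'⟩, -, -, hs0', hs1'⟩ := y
    refine (h.riemDist_proj_pt_le hA hB hC ζ ζ' r r' (s := s) (s' := s') (m := 1)
      (abs_le.2 ⟨by simp only at hs0; linarith, hs1⟩)
      (abs_le.2 ⟨by simp only at hs0'; linarith, hs1'⟩)).trans ?_
    rw [Subtype.dist_eq, dist_comm, Prod.dist_eq, Prod.dist_eq, dist_eq_norm, dist_eq_norm,
      dist_eq_norm, Real.norm_eq_abs, Real.norm_eq_abs]
    set ρ := max ‖ζ' - ζ‖ (max |r' - r| |s' - s|)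
    have h1 : ‖ζ' - ζ‖ ≤ ρ := le_max_left _ _
    have h2 : |r' - r| ≤ ρ := (le_max_left _ _).trans (le_max_right _ _)
    have h3 : |s' - s| ≤ ρ := (le_max_right _ _).trans (le_max_right _ _)
    calc _ ≤ √(2 * A) * Real.exp (√2 * a * 1) * ρ +
          √(2 * B) * (Real.exp (2 * √2 * a * 1) * ρ + ρ) := by gcongr
      _ = _ := by ring

end InoueHCF

/-! ### Gromov–Hausdorff collapse to the circle -/

namespace InoueHCF

open scoped ComplexConjugate Matrix
open Filter Topology

/-- Surjections of vanishing distortion onto a fixed space give Gromov-Hausdorff convergence. -/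
theorem gHConverges_of_isCompactMetric {X Y : Type} [Nonempty X] [MetricSpace Y] [CompactSpace Y]
    [Nonempty Y] {d : ℝ → X → X → ℝ} (hd : ∀ᶠ t in atTop, IsCompactMetric (d t)) {Φ : X → Y}
    (hΦ : Function.Surjective Φ)
    (happ : ∀ ε > 0, ∀ᶠ t in atTop, ∀ x y, |d t x y - dist (Φ x) (Φ y)| ≤ ε) :
    GHConverges d Y := by
  intro ε hε
  filter_upwards [hd, happ ε hε] with t ht hdist
  obtain ⟨iM, iC, heq⟩ := ht
  refine ⟨iM, iC, inferInstance, heq, ?_⟩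
  -- The whole space and the surjection Φ serve as approximation, so only the distortion contributes
  -- and the distance is at most ε/2.
  have := GromovHausdorff.ghDist_le_of_approx_subsets (s := (Set.univ : Set X)) (ε₁ := 0)
    (ε₂ := ε) (ε₃ := 0) (fun x => Φ x.1) (fun x => ⟨x, trivial, (dist_self x).le⟩)
    (fun y => by
      obtain ⟨x, rfl⟩ := hΦ y
      exact ⟨⟨x, trivial⟩, (dist_self _).le⟩)
    (fun x y => by rw [Subtype.dist_eq, heq]; exact hdist x y)
  linarith

/-- The map from `X` to the circle induced by `log` of the height. -/
noncomputable def circleMap (a b : ℝ) (v : Fin 3 → ℝ) (w : Fin 3 → ℂ) (P : InoueS0 a b v w) :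
    AddCircle (2 * √2 * a) :=
  (Real.log (height a P.out.1) : ℝ)

namespace IsInoueData

variable {a b : ℝ} {N : Matrix.SpecialLinearGroup (Fin 3) ℤ} {v : Fin 3 → ℝ} {w : Fin 3 → ℂ}

theorem coe_log_height_act (h : IsInoueData a b N v w) {γ : Sol a b}
    (hγ : γ ∈ inoueLattice a b v w) {p : Fin 2 → ℂ} (hp : p ∈ halfSpace) :
    ((Real.log (height a (γ.act p)) : ℝ) : AddCircle (2 * √2 * a)) =
      (Real.log (height a p) : ℝ) := by
  obtain ⟨k, n, rfl⟩ := (h.mem_inoueLattice_iff γ).1 hγ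
  rw [log_height_act h.pos _ hp, mul_comm _ (k : ℝ), ← zsmul_eq_mul, AddCircle.coe_add,
    AddCircle.coe_zsmul, AddCircle.coe_period, smul_zero, zero_add]

/-- Lattice elements change log height by integral multiples of the period, so the choice of
representative does not matter. -/
theorem circleMap_proj (h : IsInoueData a b N v w) (p : Cover) :
    circleMap a b v w (proj a b v w p) = (Real.log (height a p.1) : ℝ) := by
  obtain ⟨γ, hγ, hp⟩ := proj_eq_iff.1 (Quotient.out_eq (proj a b v w p) :
    proj a b v w (proj a b v w p).out = proj a b v w p)
  rw [circleMap, ← hp, h.coe_log_height_act hγ p.2]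

theorem circleMap_surjective (h : IsInoueData a b N v w) :
    Function.Surjective (circleMap a b v w) := by
  intro x
  obtain ⟨y, rfl⟩ := QuotientAddGroup.mk_surjective x
  have hk := kappa_pos h.pos
  refine ⟨proj a b v w ⟨pt a 0 0 (y / (2 * √2 * a)), pt_mem h.pos _ _ _⟩, ?_⟩
  rw [h.circleMap_proj, height_pt h.pos, Real.log_exp, mul_div_cancel₀ _ hk.ne']

theorem dist_circleMap_proj (h : IsInoueData a b N v w) (p q : Cover) :
    dist (circleMap a b v w (proj a b v w p)) (circleMap a b v w (proj a b v w q)) =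
      ‖((Real.log (height a q.1) - Real.log (height a p.1) : ℝ) : AddCircle (2 * √2 * a))‖ := by
  rw [h.circleMap_proj, h.circleMap_proj, dist_comm, dist_eq_norm, AddCircle.coe_sub]

theorem norm_coe_le_abs (p x : ℝ) : ‖(x : AddCircle p)‖ ≤ |x| :=
  QuotientAddGroup.norm_mk_le_norm

variable {A B : ℝ} {C : ℂ}

theorem dist_circleMap_le (h : IsInoueData a b N v w) (hA : 0 < A)
    (hC : Complex.normSq C < A * B) (P Q : InoueS0 a b v w) :
    √(2 * (B - Complex.normSq C / A)) * dist (circleMap a b v w P) (circleMap a b v w Q) ≤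
      2 * √2 * a * riemDist a b v w (invField a b (hermMatrix A B C)) P Q := by
  obtain ⟨p, rfl⟩ := proj_surjective P
  obtain ⟨q, rfl⟩ := proj_surjective Q
  have hk := kappa_pos h.pos
  rw [← div_le_iff₀' hk]
  refine le_of_forall_gt fun L hL => ?_
  obtain ⟨c, hc, c0, ⟨γ, hγ, c1⟩, hlt⟩ := exists_curve_of_riemDist_lt h.pos (hermMatrix A B C) hL
  refine lt_of_le_of_lt ?_ hlt
  rw [div_le_iff₀' hk]
  have := hc.log_height_le h.pos b hA hC (t := 1) (by simp)
  refine le_trans (mul_le_mul_of_nonneg_left ?_ (Real.sqrt_nonneg _)) this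
  rw [h.dist_circleMap_proj, AddCircle.coe_sub, ← h.coe_log_height_act hγ q.2,
    ← AddCircle.coe_sub, c0, c1]
  exact norm_coe_le_abs _ _

/-- W depends on δ but not on the metric. So the ζ-displacement, however long, is harmless once A is
small, and the error left in the r-direction is proportional to δ. -/
theorem exists_riemDist_le (h : IsInoueData a b N v w) {δ : ℝ} (hδ : 0 < δ) :
    ∃ W, ∀ {A B : ℝ} {C : ℂ}, 0 < A → 0 < B → Complex.normSq C < A * B →
      ∀ P Q : InoueS0 a b v w, riemDist a b v w (invField a b (hermMatrix A B C)) P Q ≤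
        √(2 * A) * Real.exp (√2 * a * 2) * W + √(2 * B) * (Real.exp (2 * √2 * a * 2) * δ +
          dist (circleMap a b v w P) (circleMap a b v w Q) / (2 * √2 * a)) := by
  obtain ⟨W, hW⟩ := h.exists_tube hδ
  obtain ⟨W', hW'⟩ := h.exists_proj_pt
  refine ⟨W, fun {A B C} hA hB hC P Q => ?_⟩
  have hk := kappa_pos h.pos
  obtain ⟨ζ, r, s, -, -, hs0, hs1, rfl⟩ := hW' P
  obtain ⟨ζ', r', s', -, -, hs0', hs1', rfl⟩ := hW' Q
  rw [h.dist_circleMap_proj, height_pt h.pos, height_pt h.pos, Real.log_exp, Real.log_exp,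
    ← mul_sub, AddCircle.norm_eq' _ hk, inv_mul_cancel_left₀ hk.ne', mul_div_cancel_left₀ _ hk.ne']
  -- The nearest representative in the s-direction realises the circle distance, and |s' + k - s| ≤
  -- 1/2 keeps |s' + k| below the bound m = 2 used for the segment.
  set k : ℤ := -round (s' - s)
  have hks : s' - s - (round (s' - s) : ℤ) = s' + k - s := by simp only [k, Int.cast_neg]; ring
  have hround := abs_sub_round (s' - s)
  rw [hks] at hround ⊢
  obtain ⟨n, hr, hζ⟩ := hW (Sol.alpha a b k * ζ' - ζ) (Sol.lam a k * r' - r)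
  have hγ : (⟨intDot w n, intDot v n, k⟩ : Sol a b) ∈ inoueLattice a b v w :=
    (h.mem_inoueLattice_iff _).2 ⟨k, n, rfl⟩
  have hproj : proj a b v w ⟨pt a (Sol.alpha a b k * ζ' + intDot w n)
      (Sol.lam a k * r' + intDot v n) (s' + k), pt_mem h.pos _ _ _⟩ =
      proj a b v w ⟨pt a ζ' r' s', pt_mem h.pos ζ' r' s'⟩ :=
    proj_eq_iff.2 ⟨_, hγ, act_pt _ _ _ _⟩
  have habs := abs_le.1 hround
  have hle := h.riemDist_proj_pt_le hA hB hC ζ (Sol.alpha a b k * ζ' + intDot w n) r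
    (Sol.lam a k * r' + intDot v n) (s := s) (s' := s' + k) (m := 2)
    (abs_le.2 ⟨by linarith, by linarith⟩) (abs_le.2 ⟨by linarith [habs.1], by linarith [habs.2]⟩)
  rw [hproj] at hle
  rw [sub_add_eq_add_sub] at hr hζ
  refine hle.trans ?_
  have h1 := mul_le_mul_of_nonneg_left hζ
    (by positivity : 0 ≤ √(2 * A) * Real.exp (√2 * a * 2))
  have h2 := mul_le_mul_of_nonneg_left hr (Real.exp_pos (2 * √2 * a * 2)).le
  exact add_le_add h1 (mul_le_mul_of_nonneg_left (add_le_add_left h2 _) (Real.sqrt_nonneg _))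

/-- If the metrics degenerate in the directions transverse to `s`, the surfaces converge to a
circle. -/
theorem gHConverges (h : IsInoueData a b N v w) [Fact (0 < 2 * √2 * a)] {A B : ℝ → ℝ} {C : ℝ → ℂ}
    (hA : ∀ᶠ t in atTop, 0 < A t) (hB : ∀ᶠ t in atTop, 0 < B t)
    (hC : ∀ᶠ t in atTop, Complex.normSq (C t) < A t * B t) (hA0 : Tendsto A atTop (𝓝 0))
    (hBlim : Tendsto (fun t => 2 * B t) atTop (𝓝 ((2 * √2 * a) ^ 2)))
    (hClim : Tendsto (fun t => 2 * (B t - Complex.normSq (C t) / A t)) atTop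
      (𝓝 ((2 * √2 * a) ^ 2))) :
    GHConverges (fun t => riemDist a b v w (invField a b (hermMatrix (A t) (B t) (C t))))
      (AddCircle (2 * √2 * a)) := by
  have hk := kappa_pos h.pos
  set κ := 2 * √2 * a with hκ
  have : Nonempty (InoueS0 a b v w) := ⟨proj a b v w ⟨_, basePoint_mem h.pos⟩⟩
  refine gHConverges_of_isCompactMetric ?_ h.circleMap_surjective fun ε hε => ?_
  · filter_upwards [hA, hB, hC] with t h1 h2 h3 using h.isCompactMetric_riemDist h1 h2 h3
  set E := Real.exp (κ * 2)
  have hE : 0 < E := Real.exp_pos _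
  -- Chosen so that the r-error κEδ is ε/2 in the limit.
  set δ := ε / (2 * κ * E) with hδ
  obtain ⟨W, hW⟩ := h.exists_riemDist_le (δ := δ) (by positivity)
  -- Boundedness of the circle turns the relative errors of the two comparisons into additive ones.
  have hD : ∀ x y : AddCircle κ, dist x y ≤ κ := fun x y => by
    rw [dist_eq_norm]
    refine (AddCircle.norm_le_half_period κ hk.ne').trans ?_
    rw [abs_of_pos hk]; linarith
  have sB : Tendsto (fun t => √(2 * B t)) atTop (𝓝 κ) := by
    simpa [Real.sqrt_sq hk.le] using hBlim.sqrt
  have sC : Tendsto (fun t => √(2 * (B t - Complex.normSq (C t) / A t))) atTop (𝓝 κ) := by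
    simpa [Real.sqrt_sq hk.le] using hClim.sqrt
  have sA : Tendsto (fun t => √(2 * A t)) atTop (𝓝 0) := by
    simpa using (hA0.const_mul 2).sqrt
  have up : Tendsto (fun t => √(2 * A t) * Real.exp (√2 * a * 2) * W + √(2 * B t) * (E * δ) +
      |√(2 * B t) - κ|) atTop (𝓝 (0 * Real.exp (√2 * a * 2) * W + κ * (E * δ) + |κ - κ|)) :=
    (((sA.mul_const _).mul_const _).add (sB.mul_const _)).add (sB.sub_const κ).abs
  have hlim : 0 * Real.exp (√2 * a * 2) * W + κ * (E * δ) + |κ - κ| = ε / 2 := by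
    rw [hδ, sub_self, abs_zero]; field_simp; ring
  rw [hlim] at up
  have lo : Tendsto (fun t => |√(2 * (B t - Complex.normSq (C t) / A t)) - κ|) atTop (𝓝 |κ - κ|) :=
    (sC.sub_const κ).abs
  rw [sub_self, abs_zero] at lo
  filter_upwards [hA, hB, hC, up.eventually (ge_mem_nhds (half_lt_self hε)),
    lo.eventually (ge_mem_nhds hε)] with t h1 h2 h3 h4 h5 P Q
  have hup := hW h1 h2 h3 P Q
  have hlo := h.dist_circleMap_le h1 h3 P Q
  set D := dist (circleMap a b v w P) (circleMap a b v w Q) with hDdef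
  have hD0 : 0 ≤ D := dist_nonneg
  have hD1 : D ≤ κ := hD _ _
  rw [abs_le]
  constructor
  · set x := √(2 * (B t - Complex.normSq (C t) / A t))
    have h6 := (abs_le.1 h5).1
    have h7 : (κ - ε) * D ≤ κ * riemDist a b v w _ P Q :=
      (mul_le_mul_of_nonneg_right (by linarith) hD0).trans hlo
    have h8 : ε * D ≤ ε * κ := by gcongr
    refine le_of_mul_le_mul_left (a := κ) ?_ hk
    linarith
  · have h6 : √(2 * B t) * (D / κ) ≤ D + |√(2 * B t) - κ| := by
      have h7 : (√(2 * B t) - κ) * (D / κ) ≤ |√(2 * B t) - κ| * 1 :=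
        mul_le_mul (le_abs_self _) ((div_le_one hk).2 hD1) (by positivity) (abs_nonneg _)
      have h8 : κ * (D / κ) = D := by field_simp
      linarith
    rw [mul_add] at hup
    linarith

end IsInoueData

end InoueHCF

/-! ### Scaling and the main theorem -/

namespace InoueHCF

theorem hermMatrix_smul (k A B : ℝ) (C : ℂ) :
    hermMatrix (k * A) (k * B) (k * C) = k • hermMatrix A B C := by
  ext i j
  fin_cases i <;> fin_cases j <;> simp

theorem invField_smul (a b k : ℝ) (G : Matrix (Fin 2) (Fin 2) ℂ) :
    invField a b (k • G) = fun p => k • invField a b G p := by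
  ext p i j
  simp only [invField_apply, Matrix.smul_apply, Complex.real_smul]
  ring

end InoueHCF

theorem mainTheorem6 (a b : ℝ) (ha : 0 < a) (hb : b ≠ 0)
    (A : Matrix.SpecialLinearGroup (Fin 3) ℤ) (v : Fin 3 → ℝ) (w : Fin 3 → ℂ)
    (hv : v ≠ 0) (hw : w ≠ 0)
    (hAv : ((A : Matrix (Fin 3) (Fin 3) ℤ).map (fun m : ℤ => (m : ℝ))).mulVec v =
      Real.exp (2 * √2 * a) • v)
    (hAw : ((A : Matrix (Fin 3) (Fin 3) ℤ).map (fun m : ℤ => (m : ℂ))).mulVec w =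
      Complex.exp ((√2 : ℂ) * (-(a : ℂ) + b * Complex.I)) • w)
    (g₀ : MetricField 2) (hg₀ : IsLocHomMetric a b g₀) :
    ∃ g : ℝ → MetricField 2,
      IsLocHomHCFSolution a b (Set.Ici 0) g ∧
      Set.EqOn (g 0) g₀ halfSpace ∧
      (∀ (T : ℝ) (g' : ℝ → MetricField 2), IsLocHomHCFSolution a b (Set.Ico 0 T) g' →
        Set.EqOn (g' 0) g₀ halfSpace → ∀ t ∈ Set.Ico 0 T, Set.EqOn (g' t) (g t) halfSpace) ∧
      Asymptotics.IsEquivalent Filter.atTop (fun t => compY a (g t)) (fun t => 8 * a ^ 2 * t) ∧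
      (compZ a g₀ ≠ 0 →
        StrictAntiOn (fun t => compX a (g t)) (Set.Ici 0) ∧
        StrictAntiOn (fun t => compU a (g t)) (Set.Ici 0)) ∧
      (compZ a g₀ = 0 →
        ∀ t ∈ Set.Ici (0 : ℝ), compX a (g t) = compX a g₀ ∧ compU a (g t) = 0) ∧
      (haveI : Fact (0 < 2 * √2 * a) := ⟨by positivity⟩
       GHConverges
        (fun t => riemDist a b v w (fun p => (1 + t)⁻¹ • g t p)) (AddCircle (2 * √2 * a))) := by
  have hdata : IsInoueData a b A v w := by
    refine ⟨ha, hv, hw, by simpa [Sol.lam] using hAv, ?_⟩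
    rw [Sol.alpha, one_mul]
    exact hAw
  have hb₀ := basePoint_mem ha
  obtain ⟨G, hG0, hGpos, hGder, hGy, hGh, hGx, hGne, hGzero⟩ :=
    exists_flow ha b (hg₀.1.2 _ hb₀)
  have hsol : IsLocHomHCFSolution a b (Set.Ici 0) fun t => invField a b (G t) :=
    isLocHomHCFSolution_invField ha hGpos hGder
  have h0 : Set.EqOn (invField a b (G 0)) g₀ halfSpace := by
    rw [hG0]
    exact (hg₀.2.eqOn_invField ha).symm
  have hcomp := fun t => comp_invField ha b (G t)
  have hcomp₀ : comp a g₀ = comp a (invField a b (G 0)) := comp_congr (h0 hb₀).symm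
  have hx₀ : compX a g₀ = 4 * (G 0 0 0).re := by
    rw [compX, hcomp₀]; exact (hcomp 0).1
  have hz₀ : compZ a g₀ = 0 ↔ g₀ (basePoint a) 0 1 = 0 := by
    have h1 : compU a g₀ = 8 * Complex.normSq (G 0 0 1) := by
      rw [compU, compZ, hcomp₀]; exact (hcomp 0).2.2
    rw [hG0] at h1
    rw [← norm_eq_zero, ← sq_eq_zero_iff, ← Complex.normSq_eq_zero]
    change compU a g₀ = 0 ↔ _
    rw [h1]
    simp
  refine ⟨fun t => invField a b (G t), hsol, h0, fun T g' hg' hg'0 t ht => ?_, ?_, fun hz => ?_,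
    fun hz t ht => ?_, ?_⟩
  · exact (hsol.mono Set.Ico_subset_Ici_self).eqOn ha hg' (hg'0.trans h0.symm) ht
  · refine (Asymptotics.isEquivalent_iff_tendsto_one ?_).2 ?_
    · filter_upwards [Filter.eventually_gt_atTop 0] with t ht
      positivity
    · have h1 := hGy.const_mul (2 / (8 * a ^ 2))
      rw [show 2 / (8 * a ^ 2) * (4 * a ^ 2) = 1 by field_simp; norm_num] at h1
      refine h1.congr fun t => ?_
      rw [Pi.div_apply, (hcomp t).2.1, div_mul_div_comm]
  · obtain ⟨h1, h2⟩ := hGne (hz₀.not.1 hz)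
    constructor
    · intro s hs t ht hst
      simp only [(hcomp _).1]
      have : (G t 0 0).re < (G s 0 0).re := h1 hs ht hst
      linarith
    · intro s hs t ht hst
      simp only [(hcomp _).2.2]
      have : Complex.normSq (G t 0 1) < Complex.normSq (G s 0 1) := h2 hs ht hst
      linarith
  · obtain ⟨h1, h2⟩ := hGzero (hz₀.1 hz) t ht
    simp only [(hcomp _).1, (hcomp _).2.2, hx₀, h1, h2, hG0]
    simp
  · have : Fact (0 < 2 * √2 * a) := ⟨kappa_pos ha⟩
    have hinv : Filter.Tendsto (fun t : ℝ => (1 + t)⁻¹) Filter.atTop (nhds 0) :=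
      (Filter.tendsto_atTop_add_const_left _ 1 Filter.tendsto_id).inv_tendsto_atTop
    have hratio : Filter.Tendsto (fun t : ℝ => t * (1 + t)⁻¹) Filter.atTop (nhds 1) := by
      have : Filter.Tendsto (fun t : ℝ => 1 - (1 + t)⁻¹) Filter.atTop (nhds (1 - 0)) := hinv.const_sub 1
      rw [sub_zero] at this
      refine this.congr' ?_
      filter_upwards [Filter.eventually_ge_atTop 0] with t ht
      have : 1 + t ≠ 0 := by positivity
      field_simp
      ring
    have hB : Filter.Tendsto (fun t => 2 * ((1 + t)⁻¹ * (G t 1 1).re)) Filter.atTop (nhds ((2 * √2 * a) ^ 2)) := by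
      have h1 := (hratio.mul hGy).const_mul 2
      rw [show 2 * (1 * (4 * a ^ 2)) = (2 * √2 * a) ^ 2 by
        rw [mul_pow, mul_pow, Real.sq_sqrt zero_le_two]; ring] at h1
      refine h1.congr' ?_
      filter_upwards [Filter.eventually_gt_atTop 0] with t ht
      field_simp
    have key := hdata.gHConverges (A := fun t => (1 + t)⁻¹ * (G t 0 0).re)
      (B := fun t => (1 + t)⁻¹ * (G t 1 1).re) (C := fun t => ((1 + t)⁻¹ : ℝ) * G t 0 1)
      ?_ ?_ ?_ ?_ hB ?_
    -- Rescaling the metric rescales its matrix. Nonnegative t suffices for a limit at infinity, and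
    -- only there is G t known to be Hermitian.
    · have hfun : ∀ᶠ t in Filter.atTop, riemDist a b v w (fun p => (1 + t)⁻¹ • invField a b (G t) p) =
          riemDist a b v w (invField a b (hermMatrix ((1 + t)⁻¹ * (G t 0 0).re)
            ((1 + t)⁻¹ * (G t 1 1).re) (((1 + t)⁻¹ : ℝ) * G t 0 1))) := by
        filter_upwards [Filter.eventually_ge_atTop 0] with t ht
        rw [hermMatrix_smul, ← (PosDef.eq_hermMatrix (hGpos t ht)).1]
        congr 1
        exact (invField_smul _ _ _ _).symm
      intro ε hε
      filter_upwards [hfun, key ε hε] with t h1 h2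
      rwa [h1]
    · filter_upwards [Filter.eventually_ge_atTop 0] with t ht
      have := (PosDef.eq_hermMatrix (hGpos t ht)).2.1
      positivity
    · filter_upwards [Filter.eventually_ge_atTop 0] with t ht
      have := (PosDef.eq_hermMatrix (hGpos t ht)).2.2.1
      positivity
    · filter_upwards [Filter.eventually_ge_atTop 0] with t ht
      have := (PosDef.eq_hermMatrix (hGpos t ht)).2.2.2
      rw [map_mul, Complex.normSq_ofReal, mul_mul_mul_comm]
      gcongr
    -- The coefficient A never exceeds its initial value, so after division by 1 + t it tends to
    -- zero.
    · refine squeeze_zero' ?_ ?_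
        (by simpa using hinv.mul_const (g₀ (basePoint a) 0 0).re)
      · filter_upwards [Filter.eventually_ge_atTop 0] with t ht
        have := (PosDef.eq_hermMatrix (hGpos t ht)).2.1
        positivity
      · filter_upwards [Filter.eventually_ge_atTop 0] with t ht
        have := hGx t ht
        gcongr
    -- The Schur complement is B(1 - h) with h → 0, so it has the same limit as B after rescaling.
    · have h1 := hB.mul (hGh.const_sub 1)
      rw [sub_zero, mul_one] at h1
      refine h1.congr' ?_
      filter_upwards [Filter.eventually_ge_atTop 0] with t ht
      have hA' := (PosDef.eq_hermMatrix (hGpos t ht)).2.1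
      have hB' := (PosDef.eq_hermMatrix (hGpos t ht)).2.2.1
      rw [map_mul, Complex.normSq_ofReal]
      field_simp
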